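/- Let $V=\mathbb{C}^3$, $\mathbb{P}^2=\mathbb{P}(V)$ (lines in $V$), and let $T=T_{\mathbb{P}^2}$ be its tangent bundle, with fibre $\mathrm{Hom}(p,V/p)$ at the line $p$. Let $\mathbb{P}(T)$ be the projective bundle of one-dimensional quotients of the fibres of $T$, embedded in $\mathbb{P}^7$ by the complete linear system of $\mathcal{O}_{\mathbb{P}(T)}(1)$: for a basis $s_1,\dots,s_8$ of $H^0(\mathbb{P}^2,T)=\mathrm{End}(V)/\mathbb{C}\cdot\mathrm{id}$, the point $(p,[q])$, with $0\ne q\in T_p^*$, goes to $[q(s_1(p)):\dots:q(s_8(p))]$. Let $H\subset\mathbb{P}^7$ be any hyperplane and let $Y=H\cap\mathbb{P}(T)$ be the scheme-theoretic intersection. Then either (i) $Y$ is an irreducible and reduced surface of degree six that spans $H\cong\mathbb{P}^6$, or (ii) $Y$ is the scheme-theoretic union of two distinct irreducible and reduced surfaces of degree three. Moreover, if $Y$ is irreducible, then $Y$ is reduced, and either $Y$ is a nonsingular Del Pezzo surface of degree six (a nonsingular surface of degree six spanning $H\cong\mathbb{P}^6$ with canonical sheaf $\omega_Y\cong\mathcal{O}_Y(-1)$),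 or $Y$ is singular at exactly one point, and the (Hilbert–Samuel) multiplicity of $Y$ at that point is two or three. -/

import Mathlib

open scoped LinearAlgebra.Projectivization

noncomputable section

namespace TangentPlane

/-! ### The projectivized tangent bundle of the plane and its natural embedding -/

/-- The vector space `V` with `ℙ² = ℙ(V)`, the set of lines in `V`. -/
abbrev V : Type := Fin 3 → ℂ

/-- The tangent space of `ℙ² = ℙ(V)` at the line `p ⊆ V`, that is, `Hom(p, V / p)`. -/
abbrev TangentAt (p : ℙ ℂ V) : Type :=
  p.submodule →ₗ[ℂ] (V ⧸ p.submodule)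

/-- The points of `ℙ(T_{ℙ²})`: a point `p` of `ℙ²` with a one-dimensional quotient of the
tangent space at `p`, given as the line that a nonzero functional on the tangent space spans.
(The convention is the one in which `𝒪(1)` is a quotient of the pull-back of the bundle.) -/
abbrev ProjTangent : Type :=
  Σ p : ℙ ℂ V, ℙ ℂ (Module.Dual ℂ (TangentAt p))

/-- The space `H⁰(ℙ², T) = H⁰(ℙ(T), 𝒪(1))`: by the Euler sequence
`0 → 𝒪 → 𝒪(1)³ → T → 0` it consists of the triples of linear forms (the endomorphisms of `V`)
modulo the multiples of the triple of coordinates (the identity). -/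
abbrev Sections : Type :=
  Module.End ℂ V ⧸ Submodule.span ℂ {(1 : Module.End ℂ V)}

/-- The value at `p` of the vector field given by an endomorphism `A`:
the composite `p → V → V → V / p` of the inclusion, `A` and the projection. -/
def evalEnd (p : ℙ ℂ V) : Module.End ℂ V →ₗ[ℂ] TangentAt p where
  toFun A := p.submodule.mkQ ∘ₗ A ∘ₗ p.submodule.subtype
  map_add' A B := by ext; simp
  map_smul' c A := by ext; simp

/-- The value at `p` of a section of the tangent bundle. -/
def evalSection (p : ℙ ℂ V) : Sections →ₗ[ℂ] TangentAt p :=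
  (Submodule.span ℂ {(1 : Module.End ℂ V)}).liftQ (evalEnd p) (by
    rw [Submodule.span_singleton_le_iff_mem, LinearMap.mem_ker]
    ext x
    simp [evalEnd])

/-- The tangent bundle is globally generated. -/
theorem evalSection_surjective (p : ℙ ℂ V) : Function.Surjective (evalSection p) := by
  intro t
  obtain ⟨g, hg⟩ := Module.projective_lifting_property p.submodule.mkQ t
    (Submodule.mkQ_surjective _)
  obtain ⟨A, hA⟩ := LinearMap.exists_extend g
  refine ⟨Submodule.Quotient.mk A, ?_⟩
  change evalEnd p A = t
  rw [← hg, ← hA]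
  rfl

theorem finrank_sections : Module.finrank ℂ Sections = 8 := by
  have h := Submodule.finrank_quotient_add_finrank
    (Submodule.span ℂ {(1 : Module.End ℂ V)})
  rw [finrank_span_singleton one_ne_zero, Module.finrank_linearMap] at h
  simp at h
  exact h

/-- The natural morphism of `ℙ(T)` to projective space, in the homogeneous coordinates given by a
basis `b` of `H⁰(T)`: the point `(p, [q])` goes to `[q(b₁(p)) : … : q(bₘ(p))]`. -/
def naturalEmbedding {ι : Type} [Finite ι] (b : Module.Basis ι ℂ Sections) (x : ProjTangent) :
    ℙ ℂ (ι → ℂ) :=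
  Projectivization.map
    ((b.constr ℂ (M' := ℂ)).symm.toLinearMap ∘ₗ (evalSection x.1).dualMap)
    ((b.constr ℂ (M' := ℂ)).symm.injective.comp
      (LinearMap.dualMap_injective_of_surjective (evalSection_surjective x.1)))
    x.2

/-! ### Multiplicities of local rings and differential 2-forms on fields -/

/-- The function `H` agrees for large arguments with a polynomial of degree `r` whose leading
coefficient is `e / r!`. -/
def HasGrowth (H : ℕ → ℕ) (r e : ℕ) : Prop :=
  ∃ P : Polynomial ℚ, (∀ᶠ n : ℕ in Filter.atTop, (H n : ℚ) = P.eval (n : ℚ)) ∧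
    P.natDegree = r ∧ P.leadingCoeff * (r.factorial : ℚ) = e

/-- The local ring `R` of dimension `r` has (Hilbert–Samuel) multiplicity `e`: the length of
`R / 𝔪ⁿ⁺¹` is for large `n` a polynomial in `n` with leading term `(e / r!) nʳ`. -/
def HasMultiplicity (R : Type) [CommRing R] (r e : ℕ) : Prop :=
  ∃ _ : IsLocalRing R, ringKrullDim R = r ∧
    HasGrowth (fun n =>
      (Module.length R (R ⧸ IsLocalRing.maximalIdeal R ^ (n + 1))).toNat) r e

/-- The differential 2-forms `⋀² Ω` of a field of functions `K` over `ℂ`. -/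
abbrev TwoForms (K : Type) [Field K] [Algebra ℂ K] : Type :=
  ⋀[K]^2 (Ω[K⁄ℂ])

/-- The 2-form `da ∧ db`. -/
def wedgeD {K : Type} [Field K] [Algebra ℂ K] (a b : K) : TwoForms K :=
  exteriorPower.ιMulti K 2 ![KaehlerDifferential.D ℂ K a, KaehlerDifferential.D ℂ K b]

/-- The 2-forms that are regular over a subring `A` of `K`: the `A`-module generated by the forms
`da ∧ db` with `a, b ∈ A`. If `K` is the function field of a surface and `A` is the local ring at a
nonsingular point, this is the stalk of the canonical sheaf `ω = ⋀² Ω` at that point. -/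
def regularTwoForms {K : Type} [Field K] [Algebra ℂ K] (A : Subalgebra ℂ K) :
    Submodule A (TwoForms K) :=
  Submodule.span A {w | ∃ a ∈ A, ∃ b ∈ A, w = wedgeD a b}

/-! ### Closed subschemes of projective space, given by homogeneous ideals -/

section Projective

variable {ι : Type}

/-- The ideal of the polynomials that vanish on a set of points of projective space. -/
def vanishingIdeal (Z : Set (ℙ ℂ (ι → ℂ))) : Ideal (MvPolynomial ι ℂ) where
  carrier := {f | ∀ (v : ι → ℂ) (hv : v ≠ 0), Projectivization.mk ℂ v hv ∈ Z →
    MvPolynomial.eval v f = 0}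
  zero_mem' := by intro v hv hZ; simp
  add_mem' := by
    intro f g hf hg v hv hZ
    simp [hf v hv hZ, hg v hv hZ]
  smul_mem' := by
    intro c f hf v hv hZ
    simp [hf v hv hZ]

/-- The saturation of an ideal with respect to the irrelevant ideal: the largest
ideal that defines the same closed subscheme of projective space. -/
def saturation (I : Ideal (MvPolynomial ι ℂ)) : Ideal (MvPolynomial ι ℂ) where
  carrier := {f | ∀ i, ∃ k : ℕ, MvPolynomial.X i ^ k * f ∈ I}
  zero_mem' := fun i => ⟨0, by simp⟩
  add_mem' := by
    intro f g hf hg i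
    obtain ⟨k, hk⟩ := hf i
    obtain ⟨l, hl⟩ := hg i
    refine ⟨k + l, ?_⟩
    have h1 := I.mul_mem_left (MvPolynomial.X i ^ l) hk
    have h2 := I.mul_mem_left (MvPolynomial.X i ^ k) hl
    convert I.add_mem h1 h2 using 1
    ring
  smul_mem' := by
    intro c f hf i
    obtain ⟨k, hk⟩ := hf i
    refine ⟨k, ?_⟩
    convert I.mul_mem_left c hk using 1
    simp only [smul_eq_mul]
    ring

/-- The saturated ideal of the scheme-theoretic intersection of the closed set `Z` (with its
reduced structure) with the hyperplane `h = 0`. -/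
def hyperplaneSection (Z : Set (ℙ ℂ (ι → ℂ))) (h : MvPolynomial ι ℂ) :
    Ideal (MvPolynomial ι ℂ) :=
  saturation (vanishingIdeal Z ⊔ Ideal.span {h})

/-- The Hilbert function `n ↦ dim (S / I)ₙ` of a homogeneous ideal. -/
def hilbertFunction (I : Ideal (MvPolynomial ι ℂ)) (n : ℕ) : ℕ :=
  Module.finrank ℂ (MvPolynomial.homogeneousSubmodule ι ℂ n ⧸
    (I.restrictScalars ℂ).submoduleOf (MvPolynomial.homogeneousSubmodule ι ℂ n))

/-- `I` is the homogeneous ideal of an irreducible (and reduced) projective surface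
of degree `d`. -/
structure IsIrreducibleSurface (I : Ideal (MvPolynomial ι ℂ)) (d : ℕ) : Prop where
  isPrime : I.IsPrime
  isHomogeneous : ∀ f ∈ I, ∀ n : ℕ, MvPolynomial.homogeneousComponent n f ∈ I
  hilbert : HasGrowth (hilbertFunction I) 2 d

/-- The closed subscheme with saturated ideal `I` spans a linear subspace of dimension `m`. -/
def SpansDim (I : Ideal (MvPolynomial ι ℂ)) (m : ℕ) : Prop :=
  hilbertFunction I 1 = m + 1

/-- The (closed) points of the closed subscheme defined by `I`. -/
def points (I : Ideal (MvPolynomial ι ℂ)) : Set (ℙ ℂ (ι → ℂ)) :=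
  {p | I ≤ vanishingIdeal {p}}

/-! ### Local rings and the canonical sheaf of a projective variety -/

variable (P : Ideal (MvPolynomial ι ℂ)) [P.IsPrime]

/-- The field of fractions of the homogeneous coordinate ring. -/
abbrev ConeField : Type := FractionRing (MvPolynomial ι ℂ ⧸ P)

/-- A polynomial as an element of the field of fractions of the homogeneous coordinate ring. -/
def toConeField (f : MvPolynomial ι ℂ) : ConeField P :=
  algebraMap (MvPolynomial ι ℂ ⧸ P) (ConeField P) (Ideal.Quotient.mk P f)

/-- The function field of the projective variety with homogeneous prime ideal `P`,
generated by the fractions of forms of equal degree, as a subfield of the field of fractions of the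
homogeneous coordinate ring. -/
def functionSubfield : IntermediateField ℂ (ConeField P) :=
  IntermediateField.adjoin ℂ {x | ∃ (n : ℕ) (f g : MvPolynomial ι ℂ),
    f.IsHomogeneous n ∧ g.IsHomogeneous n ∧ g ∉ P ∧ x = toConeField P f / toConeField P g}

/-- The function field of the projective variety with homogeneous prime ideal `P`. -/
def FunctionField : Type := functionSubfield P

instance : Field (FunctionField P) := inferInstanceAs (Field (functionSubfield P))

instance : Algebra ℂ (FunctionField P) := inferInstanceAs (Algebra ℂ (functionSubfield P))

/-- The inclusion of the function field into the field of fractions of the homogeneous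
coordinate ring. -/
def FunctionField.incl : FunctionField P →ₐ[ℂ] ConeField P := (functionSubfield P).val

/-- The rational function `x` is the fraction `f / g` of two forms of equal degree. -/
def IsFraction (x : FunctionField P) (f g : MvPolynomial ι ℂ) : Prop :=
  (∃ n : ℕ, f.IsHomogeneous n ∧ g.IsHomogeneous n) ∧
    FunctionField.incl P x = toConeField P f / toConeField P g

/-- The local ring at the point `p` of the projective variety with homogeneous prime
ideal `P`, as a subring of the function field: the fractions of forms of equal degree whose
denominator does not vanish at `p`. -/
def localRing (p : ℙ ℂ (ι → ℂ)) : Subalgebra ℂ (FunctionField P) :=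
  Algebra.adjoin ℂ {x | ∃ f g : MvPolynomial ι ℂ, g ∉ vanishingIdeal {p} ∧ IsFraction P x f g}

/-- The singular points of a projective variety. -/
def singularLocus : Set (ℙ ℂ (ι → ℂ)) :=
  {p | p ∈ points P ∧ ¬ IsRegularLocalRing (localRing P p)}

/-- The (Hilbert–Samuel) multiplicity of the surface with homogeneous prime ideal `P` at the
point `p` is `e`. -/
def HasMultiplicityAt (p : ℙ ℂ (ι → ℂ)) (e : ℕ) : Prop :=
  HasMultiplicity (localRing P p) 2 e

/-- The canonical sheaf `ω` of a nonsingular surface is isomorphic to `𝒪(-1)`. If `l₀` is a linear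
form that does not vanish identically on the surface, then `𝒪(-1)`, multiplied by `l₀`, is the sheaf
of rational functions whose stalk at `p` is generated by `l₀ / l`, for any linear form `l` with
`l(p) ≠ 0`; an isomorphism with `ω` is multiplication by a rational 2-form `η`. -/
def CanonicalIsMinusOne : Prop :=
  ∃ l₀ : MvPolynomial ι ℂ, l₀.IsHomogeneous 1 ∧ l₀ ∉ P ∧ ∃ η : TwoForms (FunctionField P),
    ∀ p ∈ points P, ∀ l : MvPolynomial ι ℂ, l.IsHomogeneous 1 → l ∉ vanishingIdeal {p} →
      ∀ c : FunctionField P, IsFraction P c l₀ l →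
        regularTwoForms (localRing P p) = Submodule.span (localRing P p) {c • η}

/-- `P` is the homogeneous ideal of a nonsingular Del Pezzo surface of degree `d`: a nonsingular
surface of degree `d` that spans a projective space of dimension `d` and has `ω ≅ 𝒪(-1)`;
in particular its anticanonical sheaf is very ample. -/
structure IsNonsingularDelPezzo (d : ℕ) : Prop where
  isSurface : IsIrreducibleSurface P d
  spans : SpansDim P d
  nonsingular : singularLocus P = ∅
  canonical : CanonicalIsMinusOne P

end Projective

end TangentPlane

end

noncomputable section

namespace TangentPlane

open MvPolynomial

/-! ### The bihomogeneous coordinate ring of `ℙ² × ℙ²` -/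

/-! A one-dimensional quotient of `Hom(p, V/p)` is, up to scalars, a functional on `V` that
annihilates `p`. So `ℙ(T)` is the flag variety of pairs of a vector `x` and a covector `y` with `y x
= 0`, and the section given by an endomorphism `A` has the coordinate `y A x` there
(`vanishingIdeal_range`). A hyperplane is a nonscalar `A` modulo scalars, and `Y` is the locus `y x
= y A x = 0` in `ℙ² × ℙ²`. The map `segre` of coordinate rings is onto the diagonal bidegrees modulo
the incidence equation (`exists_segre`), so the ideal of `Y` is, up to saturation, the preimage of
`(y x, y A x)` (`comap_segre_sup`), and all computations take place in six variables.

A suitable basis of `V` and a scalar shift bring `A` to one of five forms (`exists_normalForm`). If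
some `A - r` has rank one, then `y (A - r) x` is a linear form in `x` times a linear form in `y`,
and `Y` is the union of the two corresponding cubic surfaces (`saturation_reducible`). Otherwise `A`
has one Jordan block for each eigenvalue, the ideal `(y x, y A x)` is prime
(`isPrime_span_incidence`), and its Koszul relation gives the Hilbert polynomial `3n² + 3n + 1`,
hence degree six.

By the Jacobian criterion a singular point is a pair of a right and a left eigenvector for the same
eigenvalue with `y x = 0`. There is none for three distinct eigenvalues, and exactly one if an
eigenvalue is repeated. Near that point `Y` is a hypersurface in affine 3-space whose equation has
order two, so the multiplicity is two; the value three does not occur.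

For distinct eigenvalues the products `xₖ yₖ` are proportional on `Y` with nonzero constants. The
form `dlog (x₁/x₀) ∧ dlog (x₂/x₀)` then trivializes `ω(1)`: in the chart `xᵢ = yⱼ = 1` with `i ≠ j`
and third index `k`, the functions `xₖ, yₖ` are coordinates, and `dxₖ ∧ dyₖ` is this form times a
constant times `x₀ y₀`, a section of `𝒪(1)`. -/

/-- The polynomial ring in the coordinates `x` of a vector and `y` of a covector. -/
abbrev BiPoly : Type := MvPolynomial (Fin 3 ⊕ Fin 3) ℂ

/-- The coordinates of the vector. -/
def xv (k : Fin 3) : BiPoly := X (Sum.inl k)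

/-- The coordinates of the covector. -/
def yv (k : Fin 3) : BiPoly := X (Sum.inr k)

/-- The bilinear form `y M x` of a matrix `M`. -/
def bilin : Matrix (Fin 3) (Fin 3) ℂ →ₗ[ℂ] BiPoly where
  toFun M := ∑ j, ∑ k, C (M j k) * (yv j * xv k)
  map_add' M N := by simp [add_mul, Finset.sum_add_distrib]
  map_smul' c M := by simp [Finset.mul_sum, mul_assoc, MvPolynomial.smul_eq_C_mul]

/-- The equation `y x = 0` of the flag variety. -/
def incidence : BiPoly := bilin 1

theorem incidence_eq : incidence = xv 0 * yv 0 + xv 1 * yv 1 + xv 2 * yv 2 := by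
  simp [incidence, bilin, Fin.sum_univ_three]
  ring

theorem bilin_single (j k : Fin 3) : bilin (Matrix.single j k 1) = yv j * xv k := by
  simp only [bilin, LinearMap.coe_mk, AddHom.coe_mk]
  rw [Finset.sum_eq_single j, Finset.sum_eq_single k]
  · simp
  · intro k' _ hk
    simp [hk.symm]
  · simp
  · intro j' _ hj
    simp [hj.symm]
  · simp

/-- The zero of bihomogeneous polynomials given by a vector and a covector. -/
def pt (x y : Fin 3 → ℂ) : Fin 3 ⊕ Fin 3 → ℂ := Sum.elim x y

@[simp] theorem eval_pt_xv (x y : Fin 3 → ℂ) (k : Fin 3) : eval (pt x y) (xv k) = x k := by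
  simp [pt, xv]

@[simp] theorem eval_pt_yv (x y : Fin 3 → ℂ) (k : Fin 3) : eval (pt x y) (yv k) = y k := by
  simp [pt, yv]

theorem eval_bilin (x y : Fin 3 → ℂ) (M : Matrix (Fin 3) (Fin 3) ℂ) :
    eval (pt x y) (bilin M) = y ⬝ᵥ M.mulVec x := by
  simp [bilin, dotProduct, Matrix.mulVec, Finset.mul_sum]
  refine Finset.sum_congr rfl fun j _ => Finset.sum_congr rfl fun k _ => by ring

/-! ### Prime elements and prime ideals -/

/-- A polynomial of degree one in `X i` is irreducible if its two coefficients have no common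
factor. Here the only possible common factor is `X a`, and the point `v` shows that it does not
divide `g`. -/
theorem prime_mul_X_add {σ : Type} {a i : σ} {c : ℂ} (hc : c ≠ 0) {g : MvPolynomial σ ℂ}
    (hai : i ≠ a) (hi : i ∉ g.vars) (v : σ → ℂ) (hv : v a = 0) (hg : eval v g ≠ 0) :
    Prime (C c * X a * X i + g) := by
  classical
  refine (irreducible_mul_X_add _ g i ?_ ?_ hi ?_).prime
  · exact mul_ne_zero (by simpa using hc) (X_ne_zero a)
  · intro h
    have := vars_mul (C c) (X a : MvPolynomial σ ℂ) h
    simp [vars_X] at this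
    exact hai this
  · have hX : IsRelPrime (X a : MvPolynomial σ ℂ) g := by
      refine X_prime.irreducible.isRelPrime_iff_not_dvd.2 ?_
      rintro ⟨d, rfl⟩
      simp [hv] at hg
    exact (isRelPrime_mul_unit_left_left ((isUnit_iff_ne_zero.2 hc).map C)).2 hX

/-- Setting a variable to zero. -/
def killVar (s : Fin 3 ⊕ Fin 3) : BiPoly →ₐ[ℂ] BiPoly :=
  aeval (fun t => if t = s then 0 else X t)

theorem sub_killVar_mem (s : Fin 3 ⊕ Fin 3) (f : BiPoly) :
    f - killVar s f ∈ Ideal.span {(X s : BiPoly)} := by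
  rw [← Ideal.Quotient.mk_eq_mk_iff_sub_mem]
  have : (Ideal.Quotient.mkₐ ℂ (Ideal.span {(X s : BiPoly)})) =
      (Ideal.Quotient.mkₐ ℂ (Ideal.span {(X s : BiPoly)})).comp (killVar s) := by
    ext t
    by_cases h : t = s
    · subst h
      simp only [killVar, AlgHom.comp_apply, aeval_X, if_true, map_zero]
      simp
    · simp [killVar, h]
  exact congr($this f)

theorem exists_eq_killVar_add (s : Fin 3 ⊕ Fin 3) (f : BiPoly) :
    ∃ g, f = killVar s f + X s * g := by
  obtain ⟨g, hg⟩ := Ideal.mem_span_singleton.1 (sub_killVar_mem s f)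
  exact ⟨g, by rw [← hg]; ring⟩

theorem prime_incidence : Prime incidence := by
  have := prime_mul_X_add (σ := Fin 3 ⊕ Fin 3) (a := .inl 0) (i := .inr 0) (c := 1) one_ne_zero
    (g := xv 1 * yv 1 + xv 2 * yv 2) (by simp) ?_ (pt ![0, 1, 0] ![0, 1, 0]) rfl (by simp)
  · rw [incidence_eq]
    simpa [xv, yv, add_assoc] using this
  · classical
    intro h
    have := vars_add_subset _ _ h
    simp only [Finset.mem_union] at this
    rcases this with h | h <;> simpa [xv, yv, vars_X] using vars_mul _ _ h

/-- Two of the three terms `xₖ yₖ` survive, which still form an irreducible quadric. -/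
theorem prime_killVar_incidence (s : Fin 3 ⊕ Fin 3) : Prime (killVar s incidence) := by
  have key : ∀ i j : Fin 3, i ≠ j → Prime (xv i * yv i + xv j * yv j) := by
    intro i j hij
    have := prime_mul_X_add (σ := Fin 3 ⊕ Fin 3) (a := .inl i) (i := .inr i) (c := 1) one_ne_zero
      (g := xv j * yv j) (by simp) ?_ (pt (Pi.single j 1) (Pi.single j 1)) (by simp [pt, hij])
      (by simp)
    · simpa [xv, yv] using this
    · classical
      intro h
      simpa [xv, yv, vars_X, hij] using vars_mul _ _ h
  rw [incidence_eq]
  rcases s with k | k <;> fin_cases k <;> simp [killVar, xv, yv] <;>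
    first
    | exact key 0 1 (by decide)
    | exact key 0 2 (by decide)
    | exact key 1 2 (by decide)

/-- The ideal is the preimage under `killVar s` of the principal ideal of a prime element. -/
theorem isPrime_span_incidence_X (s : Fin 3 ⊕ Fin 3) :
    (Ideal.span {incidence, (X s : BiPoly)}).IsPrime := by
  have h : Ideal.span {incidence, (X s : BiPoly)} =
      (Ideal.span {killVar s incidence}).comap (killVar s) := by
    have hX : killVar s (X s) = 0 := by simp [killVar]
    apply le_antisymm
    · rw [Ideal.span_le]
      rintro f (rfl | rfl)
      · exact Ideal.mem_span_singleton_self _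
      · simp [hX]
    · intro f hf
      obtain ⟨c, hc⟩ := Ideal.mem_span_singleton.1 (Ideal.mem_comap.1 hf)
      obtain ⟨a, ha⟩ := exists_eq_killVar_add s f
      obtain ⟨b, hb⟩ := exists_eq_killVar_add s incidence
      rw [Ideal.mem_span_pair]
      refine ⟨c, a - b * c, ?_⟩
      rw [ha, hc]
      linear_combination c * hb
  rw [h]
  have := (Ideal.span_singleton_prime (prime_killVar_incidence s).ne_zero).2
    (prime_killVar_incidence s)
  exact Ideal.comap_isPrime _ _

/-- Multiplication by the last coordinate is injective modulo the two equations. -/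
theorem mem_of_mul_mem {q : BiPoly} (hq : ¬ killVar (.inl 2) incidence ∣ killVar (.inl 2) q)
    {f : BiPoly} (hf : xv 2 * f ∈ Ideal.span {incidence, q}) :
    f ∈ Ideal.span {incidence, q} := by
  have hp := prime_killVar_incidence (.inl 2)
  obtain ⟨a, b, hab⟩ := Ideal.mem_span_pair.1 hf
  have h0 : killVar (.inl 2) a * killVar (.inl 2) incidence +
      killVar (.inl 2) b * killVar (.inl 2) q = 0 := by
    rw [← map_mul, ← map_mul, ← map_add, hab]
    simp [xv, killVar]
  obtain ⟨a', ha⟩ := exists_eq_killVar_add (.inl 2) a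
  obtain ⟨b', hb⟩ := exists_eq_killVar_add (.inl 2) b
  obtain ⟨r, hr⟩ := exists_eq_killVar_add (.inl 2) incidence
  obtain ⟨q', hq'⟩ := exists_eq_killVar_add (.inl 2) q
  generalize killVar (.inl 2) a = a0 at *
  generalize killVar (.inl 2) b = b0 at *
  generalize killVar (.inl 2) incidence = F0 at *
  generalize killVar (.inl 2) q = q0 at *
  -- Modulo `x₂` the coefficients satisfy `a₀ F₀ + b₀ q₀ = 0`. Since `F₀` is prime and does not
  -- divide `q₀`, this relation is `-c` times the Koszul relation. Adding `c` times the Koszul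
  -- relation to `(a, b)` makes both coefficients divisible by `x₂`.
  obtain ⟨c, hc⟩ : F0 ∣ b0 := by
    refine (hp.dvd_or_dvd (a := b0) (b := q0) ⟨-a0, ?_⟩).resolve_right hq
    linear_combination h0
  have ha0 : a0 = - (c * q0) := by
    apply mul_right_cancel₀ hp.ne_zero
    rw [hc] at h0
    linear_combination h0
  rw [Ideal.mem_span_pair]
  refine ⟨a' + c * q', b' - c * r, ?_⟩
  apply mul_left_cancel₀ (X_ne_zero (R := ℂ) (Sum.inl 2 : Fin 3 ⊕ Fin 3))
  change xv 2 * _ = xv 2 * f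
  change q = q0 + xv 2 * q' at hq'
  change incidence = F0 + xv 2 * r at hr
  change a = a0 + xv 2 * a' at ha
  change b = b0 + xv 2 * b' at hb
  rw [← hab, ha, hb, ha0, hc]
  linear_combination (c * q) * hr - (c * incidence) * hq'

/-- The substitution `y₂ = -(x₀ y₀ + x₁ y₁) / x₂`. -/
def elimY : BiPoly →ₐ[ℂ] FractionRing BiPoly :=
  aeval (fun s => if s = .inr 2 then
    - algebraMap BiPoly (FractionRing BiPoly) (xv 0 * yv 0 + xv 1 * yv 1) /
      algebraMap BiPoly (FractionRing BiPoly) (xv 2) else algebraMap BiPoly _ (X s))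

theorem algebraMap_xv_ne_zero : algebraMap BiPoly (FractionRing BiPoly) (xv 2) ≠ 0 := by
  rw [Ne, FaithfulSMul.algebraMap_eq_zero_iff]
  exact X_ne_zero _

/-- Clearing denominators: modulo the incidence equation, a power of `x₂` times `f` is a polynomial
`g` from which `y₂` has been eliminated. -/
theorem exists_pow_mul_elimY (f : BiPoly) : ∃ (N : ℕ) (g : BiPoly),
    xv 2 ^ N * f - g ∈ Ideal.span {incidence} ∧
    algebraMap BiPoly (FractionRing BiPoly) g = algebraMap BiPoly _ (xv 2 ^ N) * elimY f := by
  induction f using MvPolynomial.induction_on with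
  | C a => exact ⟨0, C a, by simp, by simp [elimY]; rfl⟩
  | add f f' h h' =>
    obtain ⟨N, g, h1, h2⟩ := h
    obtain ⟨N', g', h1', h2'⟩ := h'
    refine ⟨N + N', xv 2 ^ N' * g + xv 2 ^ N * g', ?_, ?_⟩
    · convert Ideal.add_mem _ (Ideal.mul_mem_left _ (xv 2 ^ N') h1)
        (Ideal.mul_mem_left _ (xv 2 ^ N) h1') using 1
      ring
    · simp only [map_add, map_mul, h2, h2', pow_add]
      ring
  | mul_X f s h =>
    obtain ⟨N, g, h1, h2⟩ := h
    by_cases hs : s = .inr 2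
    · subst hs
      refine ⟨N + 1, - g * (xv 0 * yv 0 + xv 1 * yv 1), ?_, ?_⟩
      · convert Ideal.add_mem _ (Ideal.mul_mem_left _ (xv 2 * yv 2) h1)
          (Ideal.mul_mem_left _ g (Ideal.mem_span_singleton_self incidence)) using 1
        rw [incidence_eq]
        simp only [yv]
        ring
      · have : elimY (X (Sum.inr 2)) =
            - algebraMap BiPoly (FractionRing BiPoly) (xv 0 * yv 0 + xv 1 * yv 1) /
              algebraMap BiPoly (FractionRing BiPoly) (xv 2) := by simp [elimY]
        have h0 := algebraMap_xv_ne_zero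
        rw [map_mul, map_neg, h2, map_mul elimY, this, pow_succ, map_mul _ _ (xv 2)]
        field_simp
    · refine ⟨N, g * X s, ?_, ?_⟩
      · convert Ideal.mul_mem_right (X s) _ h1 using 1
        ring
      · have : elimY (X s) = algebraMap BiPoly (FractionRing BiPoly) (X s) := by simp [elimY, hs]
        rw [map_mul, h2, map_mul elimY, this]
        ring

/-- The ideal of a complete intersection of the incidence variety with a divisor `q = 0`
is prime if `q` is prime, does not involve the last coordinate of the covector, and the
intersection with `x₂ = 0` is proper. -/
theorem isPrime_span_incidence {q : BiPoly} (hq : Prime q)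
    (hq2 : elimY q = algebraMap BiPoly (FractionRing BiPoly) q) (hqx : ¬ q ∣ xv 2)
    (hq0 : ¬ killVar (.inl 2) incidence ∣ killVar (.inl 2) q) (x y : Fin 3 → ℂ)
    (hx : eval (pt x y) incidence = 0) (hy : eval (pt x y) q = 0) :
    (Ideal.span {incidence, q}).IsPrime := by
  set J := Ideal.span {incidence, q} with hJ
  -- Since `x₂` is a nonzerodivisor modulo `J`, primality may be tested after `x₂` is inverted.
  have hpow : ∀ (N : ℕ) (f : BiPoly), xv 2 ^ N * f ∈ J → f ∈ J := by
    intro N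
    induction N with
    | zero => intro f hf; simpa using hf
    | succ N ih =>
      intro f hf
      refine ih f (mem_of_mul_mem hq0 ?_)
      rwa [← mul_assoc, ← pow_succ']
  have hFJ : Ideal.span {incidence} ≤ J := Ideal.span_mono (by simp)
  have hqJ : q ∈ J := Ideal.subset_span (by simp)
  have hF : elimY incidence = 0 := by
    have h0 := algebraMap_xv_ne_zero
    rw [incidence_eq]
    simp [elimY, xv, yv] at h0 ⊢
    field_simp
    ring
  refine ⟨?_, ?_⟩
  · rw [Ideal.ne_top_iff_one]
    intro h
    obtain ⟨a, b, hab⟩ := Ideal.mem_span_pair.1 h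
    simpa [hx, hy] using congr(eval (pt x y) $hab)
  · intro f g hfg
    obtain ⟨N, f', hf1, hf2⟩ := exists_pow_mul_elimY f
    obtain ⟨M, g', hg1, hg2⟩ := exists_pow_mul_elimY g
    obtain ⟨a, b, hab⟩ := Ideal.mem_span_pair.1 hfg
    obtain ⟨K, b', -, hb2⟩ := exists_pow_mul_elimY b
    -- With `x₂` inverted the incidence equation is solved for `y₂` and drops out, so membership in
    -- `J` becomes divisibility by the prime `q`, up to powers of `x₂`.
    have hdvd : q ∣ xv 2 ^ K * (f' * g') := by
      refine ⟨xv 2 ^ (N + M) * b', ?_⟩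
      apply IsFractionRing.injective BiPoly (FractionRing BiPoly)
      have : elimY f * elimY g = elimY b * algebraMap BiPoly _ q := by
        rw [← map_mul, ← hab, map_add, map_mul, hF, map_mul, hq2]
        ring
      simp only [map_mul, hf2, hg2, hb2, pow_add]
      linear_combination (algebraMap BiPoly (FractionRing BiPoly) (xv 2 ^ K) *
        algebraMap BiPoly (FractionRing BiPoly) (xv 2 ^ N) *
        algebraMap BiPoly (FractionRing BiPoly) (xv 2 ^ M)) * this
    have hq' : q ∣ f' ∨ q ∣ g' := by
      rcases hq.dvd_or_dvd hdvd with h | h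
      · exact absurd (hq.dvd_of_dvd_pow h) hqx
      · exact hq.dvd_or_dvd h
    refine hq'.imp (fun h => hpow N f ?_) (fun h => hpow M g ?_)
    · have := J.add_mem (hFJ hf1) (J.mem_of_dvd h hqJ)
      simpa using this
    · have := J.add_mem (hFJ hg1) (J.mem_of_dvd h hqJ)
      simpa using this

/-- The bilinear forms `μ x_a y₀ + ν x_b y₁` with `a ≠ b`. -/
theorem isPrime_span_incidence_two_terms {a b : Fin 3} (hab : a ≠ b) {μ ν : ℂ} (hμ : μ ≠ 0)
    (hν : ν ≠ 0) (hne : eval (pt ![1, 1, 0] ![1, -1, 0])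
      (C μ * (xv a * yv 0) + C ν * (xv b * yv 1)) ≠ 0) :
    (Ideal.span {incidence, C μ * (xv a * yv 0) + C ν * (xv b * yv 1)}).IsPrime := by
  have hprime : Prime (C μ * (xv a * yv 0) + C ν * (xv b * yv 1)) := by
    have := prime_mul_X_add (σ := Fin 3 ⊕ Fin 3) (a := .inl a) (i := .inr 0) hμ
      (g := C ν * (xv b * yv 1)) (by simp) ?_ (pt (Pi.single b 1) (Pi.single 1 1))
      (by simp [pt, hab]) (by simpa using hν)
    · simpa [xv, yv, mul_assoc] using this
    · classical
      intro h
      have := vars_mul _ _ h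
      rw [vars_C, Finset.empty_union] at this
      simpa [xv, yv, vars_X] using vars_mul _ _ this
  refine isPrime_span_incidence hprime ?_ ?_ ?_ ![0, 0, 0] ![0, 0, 1] ?_ ?_
  · simp only [elimY, xv, yv, map_add, map_mul, aeval_X, algHom_C]
    simp
    rfl
  -- For `y = 0` the bilinear form vanishes, while `x₂` need not.
  · rintro ⟨c, hc⟩
    simpa using congr(eval (pt ![1, 1, 1] ![0, 0, 0]) $hc)
  · rintro ⟨c, hc⟩
    -- The point lies on `x₂ = 0`, so `killVar` does not change values there. It also lies on the
    -- incidence variety, so divisibility would force `q` to vanish, contrary to `hne`.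
    have h1 : ∀ f : BiPoly, eval (pt ![1, 1, 0] ![1, -1, 0]) (killVar (.inl 2) f) =
        eval (pt ![1, 1, 0] ![1, -1, 0]) f := by
      intro f
      obtain ⟨g, hg⟩ := exists_eq_killVar_add (.inl 2) f
      conv_rhs => rw [hg]
      simp [pt]
    have := congr(eval (pt ![1, 1, 0] ![1, -1, 0]) $hc)
    rw [map_mul, h1, h1, incidence_eq] at this
    apply hne
    rw [this]
    simp
  · simp [incidence_eq]
  · simp

end TangentPlane

end

noncomputable section

namespace TangentPlane

open MvPolynomial

/-! ### The bigrading -/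

/-- The bidegrees of the coordinates. -/
def bideg : Fin 3 ⊕ Fin 3 → ℕ × ℕ := Sum.elim (fun _ => (1, 0)) (fun _ => (0, 1))

/-- The bihomogeneous polynomials of a given bidegree. -/
abbrev biPart (d : ℕ × ℕ) : Submodule ℂ BiPoly := weightedHomogeneousSubmodule ℂ bideg d

theorem weight_bideg (d : Fin 3 ⊕ Fin 3 →₀ ℕ) :
    Finsupp.weight bideg d = (∑ k, d (.inl k), ∑ k, d (.inr k)) := by
  rw [Finsupp.weight_apply, Finsupp.sum_fintype _ _ (by simp)]
  ext <;> simp [bideg, Prod.fst_sum, Prod.snd_sum]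

theorem card_sum_eq (n : ℕ) : Nat.card {d : Fin 3 →₀ ℕ // ∑ k, d k = n} = (n + 2).choose 2 := by
  have h : (n + 2).choose 2 = (Finset.finsuppAntidiag (Finset.univ (α := Fin 3)) n).card := by
    rw [Finset.card_finsuppAntidiag_nat_eq_choose, Finset.card_univ, Fintype.card_fin,
      show 3 + n - 1 = n + 2 by omega, ← Nat.choose_symm_add]
  rw [h, ← Nat.card_eq_finsetCard]
  exact Nat.card_congr (Equiv.subtypeEquivRight fun d => by simp)

theorem finrank_restrictSupport {σ : Type} (s : Set (σ →₀ ℕ)) :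
    Module.finrank ℂ (restrictSupport ℂ s) = Nat.card s :=
  Module.finrank_eq_nat_card_basis (basisRestrictSupport ℂ s)

theorem biPart_eq_restrictSupport (d : ℕ × ℕ) :
    biPart d = restrictSupport ℂ {c | Finsupp.weight bideg c = d} :=
  weightedHomogeneousSubmodule_eq_finsupp_supported ℂ bideg d

/-- The exponents of bidegree `(a, b)`. -/
def biExponentEquiv (a b : ℕ) : {c : Fin 3 ⊕ Fin 3 →₀ ℕ | Finsupp.weight bideg c = (a, b)} ≃
    {d : Fin 3 →₀ ℕ // ∑ k, d k = a} × {d : Fin 3 →₀ ℕ // ∑ k, d k = b} :=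
  ((Finsupp.sumFinsuppEquivProdFinsupp (γ := ℕ) (α := Fin 3) (β := Fin 3)).subtypeEquiv
    (q := fun p => (∑ k, p.1 k = a) ∧ (∑ k, p.2 k = b)) (by
      intro c
      simp [weight_bideg, Finsupp.sumFinsuppEquivProdFinsupp])).trans
    (Equiv.subtypeProdEquivProd (p := fun d : Fin 3 →₀ ℕ => ∑ k, d k = a)
      (q := fun d : Fin 3 →₀ ℕ => ∑ k, d k = b))

instance (n : ℕ) : Finite {d : Fin 3 →₀ ℕ // ∑ k, d k = n} := by
  apply Nat.finite_of_card_ne_zero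
  rw [card_sum_eq]
  exact (Nat.choose_pos (by omega)).ne'

theorem finrank_biPart (a b : ℕ) :
    Module.finrank ℂ (biPart (a, b)) = (a + 2).choose 2 * (b + 2).choose 2 := by
  rw [biPart_eq_restrictSupport, finrank_restrictSupport, Nat.card_congr (biExponentEquiv a b),
    Nat.card_prod, card_sum_eq, card_sum_eq]

instance (d : ℕ × ℕ) : FiniteDimensional ℂ (biPart d) := by
  rw [biPart_eq_restrictSupport]
  have : Finite {c | Finsupp.weight bideg c = d} := Finite.of_equiv _ (biExponentEquiv d.1 d.2).symm
  exact Module.Finite.of_basis (basisRestrictSupport ℂ _)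

theorem xv_mem (k : Fin 3) : xv k ∈ biPart (1, 0) := isWeightedHomogeneous_X ℂ bideg _

theorem yv_mem (k : Fin 3) : yv k ∈ biPart (0, 1) := isWeightedHomogeneous_X ℂ bideg _

theorem bilin_mem (M : Matrix (Fin 3) (Fin 3) ℂ) : bilin M ∈ biPart (1, 1) := by
  change ∑ j, ∑ k, C (M j k) * (yv j * xv k) ∈ biPart (1, 1)
  refine Submodule.sum_mem _ fun j _ => Submodule.sum_mem _ fun k _ => ?_
  have : yv j * xv k ∈ biPart (1, 1) := IsWeightedHomogeneous.mul (yv_mem j) (xv_mem k)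
  rw [← smul_eq_C_mul]
  exact Submodule.smul_mem _ _ this

theorem incidence_mem : incidence ∈ biPart (1, 1) := bilin_mem 1

theorem component_mul {e : ℕ × ℕ} {q : BiPoly} (hq : q ∈ biPart e) (d : ℕ × ℕ) (a : BiPoly) :
    weightedHomogeneousComponent bideg (e + d) (q * a) =
      q * weightedHomogeneousComponent bideg d a := by
  induction a using MvPolynomial.monomial_add_induction_on with
  | C c =>
    have h1 := isWeightedHomogeneous_C bideg c
    rw [weightedHomogeneousComponent_of_mem (IsWeightedHomogeneous.mul hq h1),
      weightedHomogeneousComponent_of_mem h1]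
    simp
  | monomial_add m c f _ _ ih =>
    have h1 := isWeightedHomogeneous_monomial bideg m c rfl
    rw [mul_add, map_add, ih, map_add, mul_add]
    congr 1
    rw [weightedHomogeneousComponent_of_mem (IsWeightedHomogeneous.mul hq h1),
      weightedHomogeneousComponent_of_mem h1]
    simp

theorem component_mul_of_not_le {e d : ℕ × ℕ} {q : BiPoly} (hq : q ∈ biPart e) (hd : ¬ e ≤ d)
    (a : BiPoly) : weightedHomogeneousComponent bideg d (q * a) = 0 := by
  induction a using MvPolynomial.monomial_add_induction_on with
  | C c =>
    have h1 := isWeightedHomogeneous_C bideg c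
    rw [weightedHomogeneousComponent_of_mem (IsWeightedHomogeneous.mul hq h1), if_neg]
    rintro rfl
    exact hd (by simp)
  | monomial_add m c f _ _ ih =>
    have h1 := isWeightedHomogeneous_monomial bideg m c rfl
    rw [mul_add, map_add, ih, add_zero,
      weightedHomogeneousComponent_of_mem (IsWeightedHomogeneous.mul hq h1), if_neg]
    rintro rfl
    exact hd (by simp)

/-- Rescaling the two groups of variables. -/
theorem aeval_scale {A : Type*} [CommRing A] [Algebra ℂ A] {m n : ℕ} {f : BiPoly}
    (hf : f ∈ biPart (m, n)) (g : Fin 3 ⊕ Fin 3 → A) (s t : A) :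
    aeval (Sum.elim (fun k => s * g (.inl k)) (fun k => t * g (.inr k))) f =
      s ^ m * t ^ n * aeval g f := by
  rw [mem_weightedHomogeneousSubmodule] at hf
  induction hf using IsWeightedHomogeneous.induction_on with
  | zero => simp
  | add p q hp hq h1 h2 => rw [map_add, h1, h2, map_add]; ring
  | monomial d r hr =>
    rw [weight_bideg, Prod.mk.injEq] at hr
    rw [aeval_monomial, aeval_monomial, Finsupp.prod_fintype _ _ (by simp),
      Finsupp.prod_fintype _ _ (by simp), Fintype.prod_sum_type, Fintype.prod_sum_type]
    simp only [Sum.elim_inl, Sum.elim_inr, mul_pow, Finset.prod_mul_distrib,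
      Finset.prod_pow_eq_pow_sum, hr.1, hr.2]
    ring

/-! ### Dimensions of the bigraded pieces of a complete intersection -/

theorem mem_span_pair_biPart {e d₁ d₂ d : ℕ × ℕ} {F q f : BiPoly} (hF : F ∈ biPart e)
    (h₁ : e + d₁ = d) {e' : ℕ × ℕ} (hq : q ∈ biPart e') (h₂ : e' + d₂ = d) (hf : f ∈ biPart d)
    (hJ : f ∈ Ideal.span {F, q}) :
    ∃ a ∈ biPart d₁, ∃ b ∈ biPart d₂, f = F * a + q * b := by
  obtain ⟨a, b, hab⟩ := Ideal.mem_span_pair.1 hJ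
  refine ⟨_, weightedHomogeneousComponent_mem bideg a d₁, _,
    weightedHomogeneousComponent_mem bideg b d₂, ?_⟩
  rw [← component_mul hF, ← component_mul hq, h₁, h₂, ← map_add]
  rw [← IsWeightedHomogeneous.weightedHomogeneousComponent_same hf, ← hab]
  congr 1
  ring

/-- Multiplication by a polynomial, as a linear map. -/
abbrev mulBy (F : BiPoly) : BiPoly →ₗ[ℂ] BiPoly := LinearMap.mulLeft ℂ F

theorem mulBy_injective {F : BiPoly} (hF : F ≠ 0) : Function.Injective (mulBy F) :=
  fun _ _ h => mul_left_cancel₀ hF h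

theorem finrank_map_mulBy {F : BiPoly} (hF : F ≠ 0) (W : Submodule ℂ BiPoly) :
    Module.finrank ℂ (W.map (mulBy F)) = Module.finrank ℂ W :=
  (Submodule.equivMapOfInjective _ (mulBy_injective hF) W).finrank_eq.symm

theorem inf_biPart_eq {e e' d₁ d₂ d : ℕ × ℕ} {F q : BiPoly} (hF : F ∈ biPart e)
    (h₁ : e + d₁ = d) (hq : q ∈ biPart e') (h₂ : e' + d₂ = d) :
    (Ideal.span {F, q}).restrictScalars ℂ ⊓ biPart d =
      (biPart d₁).map (mulBy F) ⊔ (biPart d₂).map (mulBy q) := by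
  apply le_antisymm
  · rintro f ⟨hf, hd⟩
    obtain ⟨a, ha, b, hb, rfl⟩ := mem_span_pair_biPart hF h₁ hq h₂ hd hf
    exact Submodule.add_mem_sup ⟨a, ha, rfl⟩ ⟨b, hb, rfl⟩
  · refine sup_le ?_ ?_
    · rintro _ ⟨a, ha, rfl⟩
      exact ⟨Ideal.mul_mem_right _ _ (Ideal.subset_span (by simp)),
        h₁ ▸ IsWeightedHomogeneous.mul hF ha⟩
    · rintro _ ⟨a, ha, rfl⟩
      exact ⟨Ideal.mul_mem_right _ _ (Ideal.subset_span (by simp)),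
        h₂ ▸ IsWeightedHomogeneous.mul hq ha⟩

/-- Exactness of the Koszul complex of `F, q`: an equality `F a = q b` forces `F ∣ b`, because the
prime `F` does not divide `q`. -/
theorem map_mulBy_inf {e e' d₁ d₂ d₃ : ℕ × ℕ} {F q : BiPoly} (hF : F ∈ biPart e)
    (hFp : Prime F) (hFq : ¬ F ∣ q) (hq : q ∈ biPart e') (h : e + d₃ = d₂) (h' : e' + d₃ = d₁) :
    (biPart d₁).map (mulBy F) ⊓ (biPart d₂).map (mulBy q) = (biPart d₃).map (mulBy (F * q)) := by
  have hq0 : q ≠ 0 := by rintro rfl; simp at hFq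
  apply le_antisymm
  · rintro _ ⟨⟨a, ha, rfl⟩, ⟨b, hb, hab⟩⟩
    simp only [LinearMap.mulLeft_apply] at hab ⊢
    obtain ⟨c, rfl⟩ := (hFp.dvd_or_dvd ⟨a, hab⟩).resolve_left hFq
    have hc : F * c = F * weightedHomogeneousComponent bideg d₃ c := by
      rw [← component_mul hF, h, IsWeightedHomogeneous.weightedHomogeneousComponent_same hb]
    refine ⟨_, weightedHomogeneousComponent_mem bideg c d₃, ?_⟩
    simp only [LinearMap.mulLeft_apply]
    rw [← hab, hc]
    ring
  · rintro _ ⟨c, hc, rfl⟩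
    refine ⟨⟨q * c, h' ▸ IsWeightedHomogeneous.mul hq hc, ?_⟩,
      ⟨F * c, h ▸ IsWeightedHomogeneous.mul hF hc, ?_⟩⟩ <;>
    · simp only [LinearMap.mulLeft_apply]
      ring

theorem finrank_quotient_submoduleOf (W N : Submodule ℂ BiPoly) [FiniteDimensional ℂ N] :
    Module.finrank ℂ (N ⧸ W.submoduleOf N) + Module.finrank ℂ (W ⊓ N : Submodule ℂ BiPoly) =
      Module.finrank ℂ N := by
  rw [← Submodule.finrank_quotient_add_finrank (W.submoduleOf N)]
  congr 1
  have : W ⊓ N = (W.submoduleOf N).map N.subtype := by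
    rw [Submodule.submoduleOf, Submodule.map_comap_subtype, inf_comm]
  rw [this]
  exact Submodule.finrank_map_subtype_eq _ _

/-- The dimension of a bigraded piece of a complete intersection of codimension two. -/
theorem finrank_biPart_quotient {e e' d₁ d₂ d₃ d : ℕ × ℕ} {F q : BiPoly} (hF : F ∈ biPart e)
    (hFp : Prime F) (hFq : ¬ F ∣ q) (hq : q ∈ biPart e') (h₁ : e + d₁ = d) (h₂ : e' + d₂ = d)
    (h : e + d₃ = d₂) (h' : e' + d₃ = d₁) :
    Module.finrank ℂ (biPart d ⧸
      ((Ideal.span {F, q}).restrictScalars ℂ).submoduleOf (biPart d)) +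
      Module.finrank ℂ (biPart d₁) + Module.finrank ℂ (biPart d₂) =
      Module.finrank ℂ (biPart d) + Module.finrank ℂ (biPart d₃) := by
  have hq0 : q ≠ 0 := by rintro rfl; simp at hFq
  -- The piece of bidegree `d` of the ideal is the sum of the multiples of `F` and of `q`, and these
  -- meet in the multiples of `F q`. The dimension formula for a sum of subspaces gives the count.
  have e1 := finrank_quotient_submoduleOf ((Ideal.span {F, q}).restrictScalars ℂ) (biPart d)
  have e2 := Submodule.finrank_sup_add_finrank_inf_eq ((biPart d₁).map (mulBy F))
    ((biPart d₂).map (mulBy q))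
  rw [map_mulBy_inf hF hFp hFq hq h h', ← inf_biPart_eq hF h₁ hq h₂,
    finrank_map_mulBy hFp.ne_zero, finrank_map_mulBy hq0,
    finrank_map_mulBy (mul_ne_zero hFp.ne_zero hq0)] at e2
  omega

/-- In bidegree `(1, 1)` there is no room for a Koszul relation, so the dimension is `9 - 2`. -/
theorem finrank_biPart_quotient_one {q : BiPoly} (hq : q ∈ biPart (1, 1))
    (hFq : ¬ incidence ∣ q) :
    Module.finrank ℂ (biPart (1, 1) ⧸
      ((Ideal.span {incidence, q}).restrictScalars ℂ).submoduleOf (biPart (1, 1))) = 7 := by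
  have hF := incidence_mem
  have hq0 : q ≠ 0 := by rintro rfl; simp at hFq
  have e1 := finrank_quotient_submoduleOf ((Ideal.span {incidence, q}).restrictScalars ℂ)
    (biPart (1, 1))
  have e2 := Submodule.finrank_sup_add_finrank_inf_eq ((biPart (0, 0)).map (mulBy incidence))
    ((biPart (0, 0)).map (mulBy q))
  have hinf : (biPart (0, 0)).map (mulBy incidence) ⊓ (biPart (0, 0)).map (mulBy q) = ⊥ := by
    rw [eq_bot_iff]
    rintro _ ⟨⟨a, ha, rfl⟩, ⟨b, hb, hab⟩⟩
    simp only [LinearMap.mulLeft_apply] at hab ⊢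
    obtain ⟨c, rfl⟩ := (prime_incidence.dvd_or_dvd ⟨a, hab⟩).resolve_left hFq
    have hc : incidence * c = 0 := by
      rw [← IsWeightedHomogeneous.weightedHomogeneousComponent_same hb,
        component_mul_of_not_le hF (by decide)]
    rw [hc, mul_zero] at hab
    simp [← hab]
  rw [hinf, ← inf_biPart_eq hF rfl hq rfl, finrank_map_mulBy prime_incidence.ne_zero,
    finrank_map_mulBy hq0, finrank_bot, finrank_biPart] at e2
  rw [finrank_biPart] at e1
  simp at e1 e2
  omega

end TangentPlane

end

noncomputable section

namespace TangentPlane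

open MvPolynomial

/-! ### The homomorphism of homogeneous coordinate rings -/

/-- The homomorphism of coordinate rings of the map `(x, y) ↦ (y B₁ x, …, y B₈ x)`. -/
def segre (B : Fin 8 → Matrix (Fin 3) (Fin 3) ℂ) : MvPolynomial (Fin 8) ℂ →ₐ[ℂ] BiPoly :=
  aeval (fun i => bilin (B i))

/-- The matrices `B` and the identity generate the space of matrices. -/
def SpansModOne (B : Fin 8 → Matrix (Fin 3) (Fin 3) ℂ) : Prop :=
  ∀ M : Matrix (Fin 3) (Fin 3) ℂ, ∃ (c : Fin 8 → ℂ) (r : ℂ), M = ∑ i, c i • B i + r • 1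

variable {B : Fin 8 → Matrix (Fin 3) (Fin 3) ℂ}

theorem segre_mem {n : ℕ} {f : MvPolynomial (Fin 8) ℂ} (hf : f.IsHomogeneous n) :
    segre B f ∈ biPart (n, n) := by
  induction hf using IsWeightedHomogeneous.induction_on with
  | zero => simp
  | add p q hp hq h1 h2 => rw [map_add]; exact Submodule.add_mem _ h1 h2
  | monomial d r hr =>
    rw [segre, aeval_monomial, Finsupp.prod]
    have h1 := IsWeightedHomogeneous.prod d.support (fun i => bilin (B i) ^ d i)
      (fun i => d i • ((1, 1) : ℕ × ℕ)) (w := bideg)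
      fun i _ => IsWeightedHomogeneous.pow (bilin_mem (B i)) (d i)
    have h2 : ∑ i ∈ d.support, d i • ((1, 1) : ℕ × ℕ) = (n, n) := by
      rw [← Finset.sum_smul, ← hr, Finsupp.weight_apply, Finsupp.sum]
      simp
    rw [h2] at h1
    exact h1.C_mul r

/-- The identity matrix gives the incidence form, so modulo that form every bilinear form is a
combination of the eight coordinates. -/
theorem exists_linear (hB : SpansModOne B) (M : Matrix (Fin 3) (Fin 3) ℂ) :
    ∃ l : MvPolynomial (Fin 8) ℂ, l.IsHomogeneous 1 ∧
      bilin M - segre B l ∈ Ideal.span {incidence} := by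
  obtain ⟨c, r, hM⟩ := hB M
  refine ⟨∑ i, C (c i) * X i, ?_, ?_⟩
  · exact IsHomogeneous.sum _ _ _ fun i _ => (isHomogeneous_X ℂ i).C_mul _
  · have : bilin M - segre B (∑ i, C (c i) * X i) = C r * incidence := by
      rw [hM]
      simp [segre, incidence, smul_eq_C_mul]
    rw [this]
    exact Ideal.mul_mem_left _ _ (Ideal.mem_span_singleton_self _)

/-- A monomial of bidegree `(n, n)` is a product of `n` factors `yⱼ xₖ`, each of which is linear in
the eight coordinates modulo the incidence form. -/
theorem exists_segre_monomial (hB : SpansModOne B) (n : ℕ) (d : Fin 3 ⊕ Fin 3 →₀ ℕ)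
    (hd : Finsupp.weight bideg d = (n, n)) : ∃ f : MvPolynomial (Fin 8) ℂ, f.IsHomogeneous n ∧
      monomial d 1 - segre B f ∈ Ideal.span {incidence} := by
  induction n generalizing d with
  | zero =>
    refine ⟨1, isHomogeneous_one _ _, ?_⟩
    have : d = 0 := by
      rw [weight_bideg] at hd
      simp only [Prod.mk.injEq, Finset.sum_eq_zero_iff, Finset.mem_univ, true_imp_iff] at hd
      ext (i | i)
      · exact hd.1 i
      · exact hd.2 i
    subst this
    simp
  | succ n ih =>
    rw [weight_bideg, Prod.mk.injEq] at hd
    obtain ⟨k, hk⟩ : ∃ k, d (.inl k) ≠ 0 := by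
      by_contra! h
      simp [h] at hd
    obtain ⟨j, hj⟩ : ∃ j, d (.inr j) ≠ 0 := by
      by_contra! h
      simp [h] at hd
    obtain ⟨d', rfl⟩ : ∃ d', d = d' + (Finsupp.single (.inl k) 1 + Finsupp.single (.inr j) 1) := by
      refine ⟨d - (Finsupp.single (.inl k) 1 + Finsupp.single (.inr j) 1), ?_⟩
      rw [tsub_add_cancel_of_le]
      rw [Finsupp.le_def]
      rintro (i | i)
      · by_cases h : i = k
        · subst h; simp; omega
        · simp [Ne.symm h]
      · by_cases h : i = j
        · subst h; simp; omega
        · simp [Ne.symm h]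
    obtain ⟨f, hf, hf'⟩ := ih d' (by
      rw [weight_bideg, Prod.mk.injEq]
      simp [Finset.sum_add_distrib, Finsupp.single_apply] at hd
      exact hd)
    obtain ⟨l, hl, hl'⟩ := exists_linear hB (Matrix.single j k 1)
    rw [bilin_single] at hl'
    refine ⟨f * l, hf.mul hl, ?_⟩
    have : monomial (d' + (Finsupp.single (Sum.inl k) 1 + Finsupp.single (Sum.inr j) 1)) (1 : ℂ) =
        monomial d' 1 * (yv j * xv k) := by
      simp [xv, yv, X, monomial_mul, add_comm (Finsupp.single (Sum.inl k) 1)]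
    rw [this, map_mul]
    convert Ideal.add_mem _ (Ideal.mul_mem_right (yv j * xv k) _ hf')
      (Ideal.mul_mem_left _ (segre B f) hl') using 1
    ring

/-- Surjectivity onto the diagonal part modulo the incidence form; this is the projective normality
of the flag variety in `ℙ⁷`. -/
theorem exists_segre (hB : SpansModOne B) {n : ℕ} {g : BiPoly} (hg : g ∈ biPart (n, n)) :
    ∃ f : MvPolynomial (Fin 8) ℂ, f.IsHomogeneous n ∧
      g - segre B f ∈ Ideal.span {incidence} := by
  rw [mem_weightedHomogeneousSubmodule] at hg
  induction hg using IsWeightedHomogeneous.induction_on with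
  | zero => exact ⟨0, isHomogeneous_zero _ _ _, by simp⟩
  | add p q hp hq h1 h2 =>
    obtain ⟨f, hf, hf'⟩ := h1
    obtain ⟨g, hg, hg'⟩ := h2
    refine ⟨f + g, hf.add hg, ?_⟩
    convert Ideal.add_mem _ hf' hg' using 1
    rw [map_add]
    ring
  | monomial d r hr =>
    obtain ⟨f, hf, hf'⟩ := exists_segre_monomial hB n d hr
    refine ⟨C r * f, hf.C_mul r, ?_⟩
    convert Ideal.mul_mem_left _ (C r) hf' using 1
    rw [mul_sub, C_mul_monomial, map_mul, mul_one]
    simp [segre]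

/-- The Hilbert function of the diagonal part of a bigraded ring. -/
theorem hilbertFunction_comap (hB : SpansModOne B) {J : Ideal BiPoly} (hJ : incidence ∈ J)
    (n : ℕ) : hilbertFunction (J.comap (segre B)) n =
      Module.finrank ℂ (biPart (n, n) ⧸ (J.restrictScalars ℂ).submoduleOf (biPart (n, n))) := by
  let T : homogeneousSubmodule (Fin 8) ℂ n →ₗ[ℂ] biPart (n, n) :=
    LinearMap.codRestrict _ ((segre B).toLinearMap ∘ₗ Submodule.subtype _)
      fun f => segre_mem ((mem_homogeneousSubmodule n _).1 f.2)
  let U := ((J.restrictScalars ℂ).submoduleOf (biPart (n, n))).mkQ ∘ₗ T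
  have hU : Function.Surjective U := by
    intro z
    obtain ⟨g, rfl⟩ := Submodule.mkQ_surjective _ z
    obtain ⟨f, hf, hf'⟩ := exists_segre hB g.2
    refine ⟨⟨f, hf⟩, ?_⟩
    rw [← sub_eq_zero]
    simp only [U, LinearMap.comp_apply, ← map_sub]
    rw [Submodule.mkQ_apply, Submodule.Quotient.mk_eq_zero]
    change segre B f - g ∈ J
    rw [← neg_sub, J.neg_mem_iff]
    exact (Ideal.span_singleton_le_iff_mem J).2 hJ hf'
  have hker : LinearMap.ker U = ((J.comap (segre B)).restrictScalars ℂ).submoduleOf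
      (homogeneousSubmodule (Fin 8) ℂ n) := by
    ext f
    rw [LinearMap.mem_ker]
    simp only [U, LinearMap.comp_apply]
    rw [Submodule.mkQ_apply, Submodule.Quotient.mk_eq_zero]
    rfl
  rw [hilbertFunction, ← hker]
  exact (U.quotKerEquivOfSurjective hU).finrank_eq

theorem component_mem_span_pair {e e' : ℕ × ℕ} {F q : BiPoly} (hF : F ∈ biPart e)
    (hq : q ∈ biPart e') {f : BiPoly} (hf : f ∈ Ideal.span {F, q}) (d : ℕ × ℕ) :
    weightedHomogeneousComponent bideg d f ∈ Ideal.span {F, q} := by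
  have key : ∀ {e : ℕ × ℕ} {p : BiPoly}, p ∈ biPart e → p ∈ Ideal.span {F, q} → ∀ a,
      weightedHomogeneousComponent bideg d (p * a) ∈ Ideal.span {F, q} := by
    intro e p hp hpJ a
    by_cases h : e ≤ d
    · obtain ⟨c, rfl⟩ := exists_add_of_le h
      rw [component_mul hp]
      exact Ideal.mul_mem_right _ _ hpJ
    · rw [component_mul_of_not_le hp h]
      exact Ideal.zero_mem _
  obtain ⟨a, b, rfl⟩ := Ideal.mem_span_pair.1 hf
  rw [map_add, mul_comm a, mul_comm b]
  exact Ideal.add_mem _ (key hF (Ideal.subset_span (by simp)) a)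
    (key hq (Ideal.subset_span (by simp)) b)

theorem segre_homogeneousComponent (n : ℕ) (f : MvPolynomial (Fin 8) ℂ) :
    segre B (homogeneousComponent n f) =
      weightedHomogeneousComponent bideg (n, n) (segre B f) := by
  conv_rhs => rw [← sum_homogeneousComponent f, map_sum, map_sum]
  have h : ∀ i, weightedHomogeneousComponent bideg (n, n) (segre B (homogeneousComponent i f)) =
      if n = i then segre B (homogeneousComponent n f) else 0 := by
    intro i
    rw [weightedHomogeneousComponent_of_mem (segre_mem (homogeneousComponent_isHomogeneous i f))]
    by_cases hi : n = i
    · subst hi; simp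
    · simp [hi]
  rw [Finset.sum_congr rfl fun i _ => h i, Finset.sum_ite_eq]
  split_ifs with hn
  · rfl
  · rw [homogeneousComponent_eq_zero _ _ (by simpa using hn), map_zero]

theorem homogeneousComponent_mem_comap {e : ℕ × ℕ} {q : BiPoly} (hq : q ∈ biPart e)
    {f : MvPolynomial (Fin 8) ℂ} (hf : f ∈ (Ideal.span {incidence, q}).comap (segre B)) (n : ℕ) :
    homogeneousComponent n f ∈ (Ideal.span {incidence, q}).comap (segre B) := by
  rw [Ideal.mem_comap, segre_homogeneousComponent]
  exact component_mem_span_pair incidence_mem hq hf _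

/-- If `f` has degree `m + 1` and `segre f = F a + q b`, then `b` has the diagonal bidegree `(m, m)`
and lifts to a polynomial `g` modulo `F`. Subtracting `α⁻¹ g h` from `f` leaves an element of the
ideal of the flag variety. -/
theorem comap_segre_sup (hB : SpansModOne B) {q : BiPoly} (hq : q ∈ biPart (1, 1))
    {h : MvPolynomial (Fin 8) ℂ} {α β : ℂ} (hα : α ≠ 0)
    (hh : segre B h = C α * q + C β * incidence) :
    (Ideal.span {incidence}).comap (segre B) ⊔ Ideal.span {h} =
      (Ideal.span {incidence, q}).comap (segre B) := by
  have hF : Ideal.span {incidence} ≤ Ideal.span {incidence, q} := Ideal.span_mono (by simp)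
  apply le_antisymm
  · refine sup_le (Ideal.comap_mono hF) ?_
    rw [Ideal.span_singleton_le_iff_mem, Ideal.mem_comap, hh]
    exact Ideal.add_mem _ (Ideal.mul_mem_left _ _ (Ideal.subset_span (by simp)))
      (Ideal.mul_mem_left _ _ (Ideal.subset_span (by simp)))
  · have key : ∀ n (f : MvPolynomial (Fin 8) ℂ), f.IsHomogeneous n →
        segre B f ∈ Ideal.span {incidence, q} →
        f ∈ (Ideal.span {incidence}).comap (segre B) ⊔ Ideal.span {h} := by
      intro n f hf hfJ
      have hfn := segre_mem (B := B) hf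
      cases n with
      -- Both generators have bidegree `(1, 1)`, so the ideal has no nonzero element of bidegree
      -- `(0, 0)`.
      | zero =>
        apply Ideal.mem_sup_left
        rw [Ideal.mem_comap]
        obtain ⟨a, b, hab⟩ := Ideal.mem_span_pair.1 hfJ
        rw [← IsWeightedHomogeneous.weightedHomogeneousComponent_same hfn, ← hab, map_add,
          mul_comm a, mul_comm b, component_mul_of_not_le incidence_mem (by decide),
          component_mul_of_not_le hq (by decide), add_zero]
        exact Ideal.zero_mem _
      | succ m =>
        obtain ⟨a, -, b, hb, hab⟩ := mem_span_pair_biPart (d₁ := (m, m)) (d₂ := (m, m))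
          incidence_mem (by ext <;> simp [add_comm]) hq (by ext <;> simp [add_comm]) hfn hfJ
        obtain ⟨g, -, hg⟩ := exists_segre hB hb
        have h1 : f = (f - C α⁻¹ * g * h) + C α⁻¹ * g * h := by ring
        rw [h1]
        refine Ideal.add_mem _ (Ideal.mem_sup_left ?_)
          (Ideal.mem_sup_right (Ideal.mul_mem_left _ _ (Ideal.mem_span_singleton_self h)))
        rw [Ideal.mem_comap]
        have hC : segre B (C α⁻¹) = C α⁻¹ := by simp [segre]
        have hCC : (C α⁻¹ * C α : BiPoly) = 1 := by
          rw [← map_mul, inv_mul_cancel₀ hα, map_one]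
        have h2 : segre B (f - C α⁻¹ * g * h) = q * (b - segre B g) +
            (a - C α⁻¹ * C β * segre B g) * incidence := by
          rw [map_sub, map_mul, map_mul, hC, hh, hab]
          linear_combination (- segre B g * q) * hCC
        rw [h2]
        exact Ideal.add_mem _ (Ideal.mul_mem_left _ _ hg)
          (Ideal.mul_mem_left _ _ (Ideal.mem_span_singleton_self _))
    intro f hf
    rw [← sum_homogeneousComponent f]
    refine Ideal.sum_mem _ fun n _ => key n _ (homogeneousComponent_isHomogeneous n f) ?_
    exact homogeneousComponent_mem_comap hq hf n

theorem le_saturation {ι : Type} (I : Ideal (MvPolynomial ι ℂ)) : I ≤ saturation I :=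
  fun f hf i => ⟨0, by simpa using hf⟩

/-- A prime that omits one coordinate absorbs the saturation, since powers of that coordinate can be
cancelled. -/
theorem saturation_le {ι : Type} {I P : Ideal (MvPolynomial ι ℂ)} (hP : P.IsPrime) (hI : I ≤ P)
    {i : ι} (hi : X i ∉ P) : saturation I ≤ P := by
  intro f hf
  obtain ⟨k, hk⟩ := hf i
  exact (hP.mem_or_mem (hI hk)).resolve_left fun h => hi (hP.mem_of_pow_mem k h)

/-- The nonzero vectors and covectors at which all polynomials of an ideal vanish. -/
structure IsZeroOf (J : Ideal BiPoly) (x y : Fin 3 → ℂ) : Prop where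
  vec_ne_zero : x ≠ 0
  covec_ne_zero : y ≠ 0
  eval_eq_zero : ∀ f ∈ J, eval (pt x y) f = 0

theorem isZeroOf_span_pair {F q : BiPoly} {x y : Fin 3 → ℂ} (hx : x ≠ 0) (hy : y ≠ 0)
    (h₁ : eval (pt x y) F = 0) (h₂ : eval (pt x y) q = 0) :
    IsZeroOf (Ideal.span {F, q}) x y := by
  refine ⟨hx, hy, fun f hf => ?_⟩
  obtain ⟨a, b, rfl⟩ := Ideal.mem_span_pair.1 hf
  simp [h₁, h₂]

theorem eval_segre (x y : Fin 3 → ℂ) (f : MvPolynomial (Fin 8) ℂ) :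
    eval (pt x y) (segre B f) = eval (fun i => y ⬝ᵥ (B i).mulVec x) f := by
  have : (aeval (pt x y)).comp (segre B) = aeval (R := ℂ) fun i => y ⬝ᵥ (B i).mulVec x := by
    ext i
    simp only [AlgHom.comp_apply, segre, aeval_X, ← eval_bilin]
    rfl
  exact congr($this f)

/-- If all coordinates vanished, then `y M x = 0` for every matrix `M`, in particular `yⱼ xₖ = 0`
for all `j, k`. -/
theorem coordinates_ne_zero (hB : SpansModOne B) {x y : Fin 3 → ℂ} (hx : x ≠ 0) (hy : y ≠ 0)
    (hxy : y ⬝ᵥ x = 0) : (fun i => y ⬝ᵥ (B i).mulVec x) ≠ 0 := by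
  intro h
  obtain ⟨k, hk⟩ := Function.ne_iff.1 hx
  obtain ⟨j, hj⟩ := Function.ne_iff.1 hy
  obtain ⟨c, r, hM⟩ := hB (Matrix.single j k 1)
  have h1 := eval_bilin x y (Matrix.single j k 1)
  rw [bilin_single, hM, Matrix.add_mulVec, Matrix.sum_mulVec, dotProduct_add,
    dotProduct_sum] at h1
  simp only [map_mul, eval_pt_yv, eval_pt_xv, Matrix.smul_mulVec, dotProduct_smul,
    Matrix.one_mulVec, hxy, smul_zero, add_zero] at h1
  have h2 : ∀ i, y ⬝ᵥ (B i).mulVec x = 0 := fun i => congr_fun h i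
  simp only [h2, smul_zero, Finset.sum_const_zero] at h1
  exact mul_ne_zero hj hk h1

theorem exists_X_notMem (hB : SpansModOne B) {J : Ideal BiPoly} (hJ : incidence ∈ J)
    {x y : Fin 3 → ℂ} (h : IsZeroOf J x y) : ∃ i, X i ∉ J.comap (segre B) := by
  by_contra! hX
  have hxy : y ⬝ᵥ x = 0 := by
    have := h.eval_eq_zero _ hJ
    rwa [incidence, eval_bilin, Matrix.one_mulVec] at this
  refine coordinates_ne_zero hB h.vec_ne_zero h.covec_ne_zero hxy (funext fun i => ?_)
  have := h.eval_eq_zero _ (hX i)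
  rwa [eval_segre, eval_X] at this

/-! ### Degrees -/

/-- The Koszul resolution gives `C(n+2,2)² - 2 C(n+1,2)² + C(n,2)² = 3n² + 3n + 1`. -/
theorem hasGrowth_six (hB : SpansModOne B) {q : BiPoly} (hq : q ∈ biPart (1, 1))
    (hFq : ¬ incidence ∣ q) :
    HasGrowth (hilbertFunction ((Ideal.span {incidence, q}).comap (segre B))) 2 6 := by
  have hdeg : (Polynomial.C 3 * Polynomial.X ^ 2 + Polynomial.C 3 * Polynomial.X +
      Polynomial.C 1 : Polynomial ℚ).natDegree = 2 := Polynomial.natDegree_quadratic (by norm_num)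
  refine ⟨_, ?_, hdeg, ?_⟩
  -- The last Koszul term lives in bidegree `(n - 2, n - 2)`, hence the restriction to `n ≥ 2`.
  · filter_upwards [Filter.eventually_ge_atTop 2] with n hn
    obtain ⟨n, rfl⟩ := Nat.exists_eq_add_of_le' hn
    rw [hilbertFunction_comap hB (Ideal.subset_span (by simp))]
    have := finrank_biPart_quotient (d := (n + 2, n + 2)) (d₁ := (n + 1, n + 1))
      (d₂ := (n + 1, n + 1)) (d₃ := (n, n)) incidence_mem prime_incidence hFq hq
      (by ext <;> simp <;> omega) (by ext <;> simp <;> omega) (by ext <;> simp <;> omega)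
      (by ext <;> simp <;> omega)
    simp only [finrank_biPart] at this
    have h2 := congr(($this : ℚ))
    push_cast [Nat.cast_choose_two] at h2
    simp only [Polynomial.eval_add, Polynomial.eval_mul, Polynomial.eval_C, Polynomial.eval_pow,
      Polynomial.eval_X]
    push_cast
    linear_combination h2
  · rw [Polynomial.leadingCoeff_quadratic (by norm_num)]
    norm_num [Nat.factorial]

/-- The same count with one equation of bidegree `(1, 0)` or `(0, 1)` gives `(3n² + 5n + 2) / 2`,
the Hilbert polynomial of a cubic scroll. -/
theorem hasGrowth_three (hB : SpansModOne B) (s : Fin 3 ⊕ Fin 3) :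
    HasGrowth (hilbertFunction ((Ideal.span {incidence, (X s : BiPoly)}).comap (segre B))) 2 3 := by
  have hdeg : (Polynomial.C (3 / 2) * Polynomial.X ^ 2 + Polynomial.C (5 / 2) * Polynomial.X +
      Polynomial.C 1 : Polynomial ℚ).natDegree = 2 := Polynomial.natDegree_quadratic (by norm_num)
  have hFs : ¬ incidence ∣ (X s : BiPoly) := by
    rintro ⟨c, hc⟩
    have := congr(eval (pt (fun k => if Sum.inl k = s then 1 else 0)
      (fun k => if Sum.inr k = s then 1 else 0)) $hc)
    rw [incidence_eq] at this
    rcases s with k | k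
    · rw [show (X (Sum.inl k) : BiPoly) = xv k from rfl] at this
      simp at this
    · rw [show (X (Sum.inr k) : BiPoly) = yv k from rfl] at this
      simp at this
  refine ⟨_, ?_, hdeg, ?_⟩
  · filter_upwards [Filter.eventually_ge_atTop 2] with n hn
    obtain ⟨n, rfl⟩ := Nat.exists_eq_add_of_le' hn
    rw [hilbertFunction_comap hB (Ideal.subset_span (by simp))]
    simp only [Polynomial.eval_add, Polynomial.eval_mul, Polynomial.eval_C, Polynomial.eval_pow,
      Polynomial.eval_X]
    rcases s with k | k
    · have := finrank_biPart_quotient (d := (n + 2, n + 2)) (d₁ := (n + 1, n + 1))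
        (d₂ := (n + 1, n + 2)) (d₃ := (n, n + 1)) incidence_mem prime_incidence hFs (xv_mem k)
        (by ext <;> simp <;> omega) (by ext <;> simp <;> omega) (by ext <;> simp <;> omega)
        (by ext <;> simp <;> omega)
      simp only [finrank_biPart] at this
      have h2 := congr(($this : ℚ))
      push_cast [Nat.cast_choose_two] at h2
      push_cast
      linear_combination h2
    · have := finrank_biPart_quotient (d := (n + 2, n + 2)) (d₁ := (n + 1, n + 1))
        (d₂ := (n + 2, n + 1)) (d₃ := (n + 1, n)) incidence_mem prime_incidence hFs (yv_mem k)
        (by ext <;> simp <;> omega) (by ext <;> simp <;> omega) (by ext <;> simp <;> omega)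
        (by ext <;> simp <;> omega)
      simp only [finrank_biPart] at this
      have h2 := congr(($this : ℚ))
      push_cast [Nat.cast_choose_two] at h2
      push_cast
      linear_combination h2
  · rw [Polynomial.leadingCoeff_quadratic (by norm_num)]
    norm_num [Nat.factorial]

theorem isIrreducibleSurface_six (hB : SpansModOne B) {q : BiPoly} (hq : q ∈ biPart (1, 1))
    (hFq : ¬ incidence ∣ q) (hJ : (Ideal.span {incidence, q}).IsPrime) :
    IsIrreducibleSurface ((Ideal.span {incidence, q}).comap (segre B)) 6 :=
  ⟨Ideal.comap_isPrime _ _, fun _ hf n => homogeneousComponent_mem_comap hq hf n,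
    hasGrowth_six hB hq hFq⟩

theorem spansDim_six (hB : SpansModOne B) {q : BiPoly} (hq : q ∈ biPart (1, 1))
    (hFq : ¬ incidence ∣ q) :
    SpansDim ((Ideal.span {incidence, q}).comap (segre B)) 6 := by
  rw [SpansDim, hilbertFunction_comap hB (Ideal.subset_span (by simp))]
  exact finrank_biPart_quotient_one hq hFq

theorem isIrreducibleSurface_three (hB : SpansModOne B) (s : Fin 3 ⊕ Fin 3) :
    IsIrreducibleSurface ((Ideal.span {incidence, (X s : BiPoly)}).comap (segre B)) 3 := by
  have := isPrime_span_incidence_X s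
  refine ⟨Ideal.comap_isPrime _ _, fun f hf n => ?_, hasGrowth_three hB s⟩
  exact homogeneousComponent_mem_comap (isWeightedHomogeneous_X ℂ bideg s) hf n

end TangentPlane

end

noncomputable section

namespace TangentPlane

/-! ### Normal forms of endomorphisms modulo scalars -/

theorem linearIndependent_triple {u v w : V}
    (h : ∀ a b c : ℂ, a • u + b • v + c • w = 0 → a = 0 ∧ b = 0 ∧ c = 0) :
    LinearIndependent ℂ ![u, v, w] := by
  rw [Fintype.linearIndependent_iff]
  intro g hg
  rw [Fin.sum_univ_three] at hg
  obtain ⟨h0, h1, h2⟩ := h _ _ _ hg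
  intro i
  fin_cases i <;> assumption

theorem exists_basis_toMatrix {u v w : V} (h : LinearIndependent ℂ ![u, v, w])
    (A : Module.End ℂ V) (N : Matrix (Fin 3) (Fin 3) ℂ)
    (hu : A u = N 0 0 • u + N 1 0 • v + N 2 0 • w) (hv : A v = N 0 1 • u + N 1 1 • v + N 2 1 • w)
    (hw : A w = N 0 2 • u + N 1 2 • v + N 2 2 • w) :
    ∃ e : Module.Basis (Fin 3) ℂ V, LinearMap.toMatrix e e A = N := by
  refine ⟨basisOfLinearIndependentOfCardEqFinrank h (by simp), ?_⟩
  set e := basisOfLinearIndependentOfCardEqFinrank h (by simp) with he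
  have hcoe : ⇑e = ![u, v, w] := coe_basisOfLinearIndependentOfCardEqFinrank h (by simp)
  rw [← LinearEquiv.eq_symm_apply, LinearMap.toMatrix_symm]
  refine e.ext fun k => ?_
  rw [Matrix.toLin_self, hcoe, Fin.sum_univ_three]
  fin_cases k
  · exact hu
  · exact hv
  · exact hw

/-- The matrices that represent endomorphisms modulo scalars. -/
def IsNormalForm (N : Matrix (Fin 3) (Fin 3) ℂ) : Prop :=
  (∃ l m : ℂ, l ≠ 0 ∧ m ≠ 0 ∧ l ≠ m ∧ N = !![l, 0, 0; 0, m, 0; 0, 0, 0]) ∨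
  (∃ l : ℂ, l ≠ 0 ∧ N = !![l, 0, 0; 0, 0, 1; 0, 0, 0]) ∨
  N = !![0, 1, 0; 0, 0, 1; 0, 0, 0] ∨
  (∃ l : ℂ, l ≠ 0 ∧ N = !![0, 0, 0; 0, 0, 0; 0, 0, l]) ∨
  N = !![0, 0, 1; 0, 0, 0; 0, 0, 0]

-- An endomorphism of rank one is `x ↦ φ(x) u`. It is diagonalizable if `φ(u) ≠ 0` and has square
-- zero if `φ(u) = 0`; these are the last two normal forms.
open Module LinearMap in
theorem exists_normalForm_of_rank_le_one {M : End ℂ V} (hM : M ≠ 0)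
    (h : finrank ℂ (range M) ≤ 1) :
    ∃ (e : Basis (Fin 3) ℂ V) (N : Matrix (Fin 3) (Fin 3) ℂ),
      toMatrix e e M = N ∧ IsNormalForm N := by
  obtain ⟨⟨u, hu⟩, hspan⟩ := finrank_le_one_iff.1 h
  have hu0 : u ≠ 0 := by
    rintro rfl
    apply hM
    ext1 x
    obtain ⟨c, hc⟩ := hspan ⟨M (Pi.single x 1), mem_range_self _ _⟩
    have := congr_arg Subtype.val hc
    simp only [SetLike.val_smul, smul_zero] at this
    ext1
    simpa using this.symm
  obtain ⟨φ, hφ⟩ : ∃ φ : V →ₗ[ℂ] ℂ, ∀ x, M x = φ x • u := by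
    have hmem : ∀ x, M x ∈ Submodule.span ℂ {u} := by
      intro x
      obtain ⟨c, hc⟩ := hspan ⟨M x, mem_range_self _ _⟩
      exact Submodule.mem_span_singleton.2 ⟨c, congr_arg Subtype.val hc⟩
    refine ⟨(LinearEquiv.coord ℂ V u hu0).toLinearMap ∘ₗ codRestrict _ M hmem, fun x => ?_⟩
    have := LinearEquiv.coord_apply_smul ℂ V u hu0 ⟨M x, hmem x⟩
    exact this.symm
  have hφ0 : φ ≠ 0 := by
    rintro rfl
    apply hM
    ext x
    simp [hφ]
  have hker : finrank ℂ (ker φ) = 2 := by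
    have h1 := finrank_range_add_finrank_ker φ
    rw [range_eq_top.2 (LinearMap.surjective hφ0), finrank_top] at h1
    simp at h1
    omega
  by_cases hφu : φ u = 0
  -- The basis consists of `u`, a second vector of the plane `ker φ`, and a vector `z` with `φ(z) =
  -- 1`, which is sent to `u`.
  · obtain ⟨w, hw, hwu⟩ : ∃ w ∈ ker φ, w ∉ Submodule.span ℂ {u} := by
      by_contra! hle
      have := Submodule.finrank_mono (show ker φ ≤ Submodule.span ℂ {u} from hle)
      rw [hker, finrank_span_singleton hu0] at this
      omega
    obtain ⟨z, hz⟩ := LinearMap.surjective hφ0 1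
    rw [mem_ker] at hw
    have hli : LinearIndependent ℂ ![u, w, z] := by
      refine linearIndependent_triple fun a b c habc => ?_
      have hc : c = 0 := by simpa [hφu, hw, hz] using congr_arg φ habc
      subst hc
      have hb : b = 0 := by
        by_contra hb
        apply hwu
        refine Submodule.mem_span_singleton.2 ⟨- (b⁻¹ * a), ?_⟩
        have : b⁻¹ • (a • u + b • w + (0 : ℂ) • z) = 0 := by rw [habc, smul_zero]
        rw [zero_smul, add_zero, smul_add, smul_smul, smul_smul, inv_mul_cancel₀ hb,
          one_smul] at this
        rw [neg_smul, neg_eq_iff_add_eq_zero]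
        exact this
      subst hb
      simpa [hu0] using habc
    obtain ⟨e, he⟩ := exists_basis_toMatrix hli M !![0, 0, 1; 0, 0, 0; 0, 0, 0]
      (by simp [hφ, hφu]) (by simp [hφ, hw]) (by simp [hφ, hz])
    exact ⟨e, _, he, .inr (.inr (.inr (.inr rfl)))⟩
  -- Now `V` is the direct sum of `ker φ` and the eigenline spanned by `u`.
  · let v := finBasisOfFinrankEq ℂ (ker φ) hker
    have hli : LinearIndependent ℂ ![(v 0 : V), (v 1 : V), u] := by
      refine linearIndependent_triple fun a b c habc => ?_
      have h0 : φ (v 0 : V) = 0 := (v 0).2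
      have h1 : φ (v 1 : V) = 0 := (v 1).2
      have hc : c = 0 := by simpa [hφu, h0, h1] using congr_arg φ habc
      subst hc
      have hv := Fintype.linearIndependent_iff.1 v.linearIndependent ![a, b] (by
        rw [Fin.sum_univ_two]
        ext1
        simpa using habc)
      exact ⟨hv 0, hv 1, rfl⟩
    have h0 : φ (v 0 : V) = 0 := (v 0).2
    have h1 : φ (v 1 : V) = 0 := (v 1).2
    obtain ⟨e, he⟩ := exists_basis_toMatrix hli M !![0, 0, 0; 0, 0, 0; 0, 0, φ u]
      (by simp [hφ, h0]) (by simp [hφ, h1]) (by simp [hφ])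
    exact ⟨e, _, he, .inr (.inr (.inr (.inl ⟨_, hφu, rfl⟩)))⟩

-- If the product were zero, the kernel of `M` would contain the range of `M'`, and the rank and
-- nullity of `M` would add up to at least four.
open Module LinearMap in
theorem mul_self_ne_zero_of_rank {M : End ℂ V} {M' : End ℂ V} (h : 2 ≤ finrank ℂ (range M))
    (h' : 2 ≤ finrank ℂ (range M')) : M * M' ≠ 0 := by
  intro h0
  have hle : range M' ≤ ker M := by
    rintro _ ⟨x, rfl⟩
    exact congr($h0 x)
  have h1 := Submodule.finrank_mono hle
  have h2 := finrank_range_add_finrank_ker M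
  simp at h2
  omega

-- The rank condition excludes a smaller annihilating polynomial than `t² (t - d)`, so some `z` has
-- `M (M - d) z ≠ 0`. For `d = 0` it generates a Jordan chain of length three. For `d ≠ 0` the
-- vector `w = (M - d) z` generates a chain of length two for the eigenvalue zero, completed by an
-- eigenvector for `d`.
open Module LinearMap in
theorem exists_normalForm_of_double {M : End ℂ V}
    (hrank : ∀ r : ℂ, 2 ≤ finrank ℂ (range (M - r • 1))) {d : ℂ} (hd : M.HasEigenvalue d) (hM : M * (M * (M - d • 1)) = 0) :
    ∃ (e : Basis (Fin 3) ℂ V) (N : Matrix (Fin 3) (Fin 3) ℂ),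
      toMatrix e e M = N ∧ IsNormalForm N := by
  have hM0 : 2 ≤ finrank ℂ (range M) := by
    have := hrank 0
    rwa [zero_smul, sub_zero] at this
  obtain ⟨z, hz⟩ : ∃ z, (M * (M - d • 1)) z ≠ 0 := by
    by_contra! h
    exact mul_self_ne_zero_of_rank hM0 (hrank d) (LinearMap.ext h)
  have h0 : M (M ((M - d • 1) z)) = 0 := congr($hM z)
  change M ((M - d • 1) z) ≠ 0 at hz
  by_cases hd0 : d = 0
  · subst hd0
    simp only [zero_smul, sub_zero] at hz h0
    have hli : LinearIndependent ℂ ![M (M z), M z, z] := by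
      refine linearIndependent_triple fun a b c habc => ?_
      have h1 := congr_arg (fun t => M (M t)) habc
      simp only [map_add, map_smul, h0, map_zero, smul_zero, zero_add] at h1
      obtain rfl : c = 0 := (smul_eq_zero.1 h1).resolve_right hz
      have h2 := congr_arg M habc
      simp only [map_add, map_smul, h0, map_zero, smul_zero, zero_add, zero_smul, add_zero] at h2
      obtain rfl : b = 0 := (smul_eq_zero.1 h2).resolve_right hz
      simpa [hz] using habc
    obtain ⟨e, he⟩ := exists_basis_toMatrix hli M !![0, 1, 0; 0, 0, 1; 0, 0, 0]
      (by simp [h0]) (by simp) (by simp)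
    exact ⟨e, _, he, .inr (.inr (.inl rfl))⟩
  · obtain ⟨u, hu⟩ := hd.exists_hasEigenvector
    have hMu : M u = d • u := hu.apply_eq_smul
    set w := (M - d • 1) z
    have hli : LinearIndependent ℂ ![u, M w, w] := by
      refine linearIndependent_triple fun a b c habc => ?_
      have h1 := congr_arg (fun t => M (M t)) habc
      simp only [map_add, map_smul, h0, map_zero, smul_zero, hMu, add_zero, smul_smul] at h1
      obtain rfl : a = 0 := by simpa [hd0, hu.2] using h1
      have h2 := congr_arg M habc
      simp only [map_add, map_smul, h0, map_zero, smul_zero, zero_smul, zero_add] at h2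
      obtain rfl : c = 0 := (smul_eq_zero.1 h2).resolve_right hz
      simpa [hz] using habc
    obtain ⟨e, he⟩ := exists_basis_toMatrix hli M !![d, 0, 0; 0, 0, 1; 0, 0, 0]
      (by simp [hMu]) (by simp [h0]) (by simp)
    exact ⟨e, _, he, .inr (.inl ⟨d, hd0, rfl⟩)⟩

open Module LinearMap in
theorem hasEigenvalue_sub {A : End ℂ V} {c : ℂ} (h : A.HasEigenvalue c) (r : ℂ) :
    (A - r • 1).HasEigenvalue (c - r) := by
  obtain ⟨u, hu⟩ := h.exists_hasEigenvector
  refine End.hasEigenvalue_of_hasEigenvector (x := u) ⟨End.mem_eigenspace_iff.2 ?_, hu.2⟩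
  simp [hu.apply_eq_smul, sub_smul]

-- Unless some `A - r` has rank at most one, the three roots of the characteristic polynomial
-- decide: distinct roots diagonalize `A`, and a repeated root leads to Jordan blocks.
open Module LinearMap in
theorem exists_normalForm {A : End ℂ V} (hA : ∀ r : ℂ, A ≠ r • 1) :
    ∃ (e : Basis (Fin 3) ℂ V) (N : Matrix (Fin 3) (Fin 3) ℂ) (r : ℂ),
      toMatrix e e A = N + r • 1 ∧ IsNormalForm N := by
  have hadd : ∀ (r : ℂ), (∃ (e : Basis (Fin 3) ℂ V) (N : Matrix (Fin 3) (Fin 3) ℂ),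
      toMatrix e e (A - r • 1) = N ∧ IsNormalForm N) →
      ∃ (e : Basis (Fin 3) ℂ V) (N : Matrix (Fin 3) (Fin 3) ℂ) (r : ℂ),
      toMatrix e e A = N + r • 1 ∧ IsNormalForm N := by
    rintro r ⟨e, N, hN, hN'⟩
    refine ⟨e, N, r, ?_, hN'⟩
    rw [← hN, map_sub, map_smul, toMatrix_one, sub_add_cancel]
  by_cases hrank : ∃ r : ℂ, finrank ℂ (range (A - r • 1)) ≤ 1
  · obtain ⟨r, hr⟩ := hrank
    exact hadd r (exists_normalForm_of_rank_le_one (sub_ne_zero.2 (hA r)) hr)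
  push Not at hrank
  have hrank' : ∀ r s : ℂ, 2 ≤ finrank ℂ (range (A - r • 1 - s • 1)) := by
    intro r s
    rw [sub_sub, ← add_smul]
    exact hrank _
  have hsplit := IsAlgClosed.splits A.charpoly
  have hmonic := A.charpoly_monic
  obtain ⟨a, b, c, habc⟩ : ∃ a b c, A.charpoly.roots = {a, b, c} := by
    rw [← Multiset.card_eq_three, ← hsplit.natDegree_eq_card_roots, A.charpoly_natDegree]
    simp
  have hroot : ∀ t ∈ ({a, b, c} : Multiset ℂ), A.HasEigenvalue t := by
    intro t ht
    rw [← habc, Polynomial.mem_roots hmonic.ne_zero] at ht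
    exact (End.hasEigenvalue_iff_isRoot_charpoly A t).2 ht
  have hCH : (A - a • 1) * ((A - b • 1) * (A - c • 1)) = 0 := by
    have h := A.aeval_self_charpoly
    rw [hsplit.eq_prod_roots_of_monic hmonic, habc] at h
    simpa [Algebra.algebraMap_eq_smul_one] using h
  have hcomm : ∀ r s : ℂ, (A - r • 1) * (A - s • 1) = (A - s • 1) * (A - r • 1) := by
    intro r s
    simp only [sub_mul, mul_sub, smul_mul_assoc, one_mul, mul_smul_comm, mul_one]
    rw [smul_sub, smul_sub, smul_comm r s]
    abel
  -- Here `r` is a repeated root and `t` the remaining one; subtracting `r` moves the repeated root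
  -- to zero.
  have key : ∀ r t : ℂ, A.HasEigenvalue t →
      (A - r • 1) * ((A - r • 1) * (A - t • 1)) = 0 →
      ∃ (e : Basis (Fin 3) ℂ V) (N : Matrix (Fin 3) (Fin 3) ℂ) (r : ℂ),
      toMatrix e e A = N + r • 1 ∧ IsNormalForm N := by
    intro r t ht h
    refine hadd r (exists_normalForm_of_double (hrank' r) (hasEigenvalue_sub ht r) ?_)
    rwa [sub_sub, ← add_smul, add_sub_cancel]
  by_cases hab : a = b
  · subst hab
    exact key a c (hroot c (by simp)) hCH
  by_cases hac : a = c
  · subst hac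
    refine key a b (hroot b (by simp)) ?_
    rwa [hcomm a b]
  by_cases hbc : b = c
  · subst hbc
    refine key b a (hroot a (by simp)) ?_
    rwa [hcomm b a, ← mul_assoc, hcomm b a, mul_assoc]
  obtain ⟨u, hu⟩ := (hroot a (by simp)).exists_hasEigenvector
  obtain ⟨v, hv⟩ := (hroot b (by simp)).exists_hasEigenvector
  obtain ⟨w, hw⟩ := (hroot c (by simp)).exists_hasEigenvector
  have hli : LinearIndependent ℂ ![u, v, w] := by
    refine End.eigenvectors_linearIndependent' A ![a, b, c] ?_ _ ?_
    · intro i j hij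
      fin_cases i <;> fin_cases j <;> simp_all
    · intro i
      fin_cases i
      · exact hu
      · exact hv
      · exact hw
  -- Subtracting the third eigenvalue makes the last diagonal entry zero.
  obtain ⟨e, he⟩ := exists_basis_toMatrix hli (A - c • 1)
    !![a - c, 0, 0; 0, b - c, 0; 0, 0, 0]
    (by simp [hu.apply_eq_smul, sub_smul]) (by simp [hv.apply_eq_smul, sub_smul])
    (by simp [hw.apply_eq_smul])
  exact hadd c ⟨e, _, he, .inl ⟨_, _, sub_ne_zero.2 hac, sub_ne_zero.2 hbc,
    fun h => hab (sub_left_injective h), rfl⟩⟩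

end TangentPlane

end

noncomputable section

namespace TangentPlane

open MvPolynomial

/-! ### The equations of the embedded projectivized tangent bundle -/

/-- A representative of a section. -/
def liftSection (s : Sections) : Module.End ℂ V := (Submodule.Quotient.mk_surjective _ s).choose

theorem mk_liftSection (s : Sections) : Submodule.Quotient.mk (liftSection s) = s :=
  (Submodule.Quotient.mk_surjective _ s).choose_spec

theorem evalSection_apply (p : ℙ ℂ V) (s : Sections) :
    evalSection p s = evalEnd p (liftSection s) := by
  conv_lhs => rw [← mk_liftSection s]
  rfl

variable (b : Module.Basis (Fin 8) ℂ Sections) (e : Module.Basis (Fin 3) ℂ V)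

/-- The matrices of representatives of the sections in a basis. -/
def sectionMatrix (i : Fin 8) : Matrix (Fin 3) (Fin 3) ℂ :=
  LinearMap.toMatrix e e (liftSection (b i))

theorem spansModOne_sectionMatrix : SpansModOne (sectionMatrix b e) := by
  intro M
  have h := b.sum_repr (Submodule.Quotient.mk (Matrix.toLin e e M))
  have h2 : (Submodule.Quotient.mk (Matrix.toLin e e M) : Sections) =
      Submodule.Quotient.mk (∑ i, b.repr (Submodule.Quotient.mk (Matrix.toLin e e M)) i •
        liftSection (b i)) := by
    conv_lhs => rw [← h]
    generalize ⇑(b.repr (Submodule.Quotient.mk (Matrix.toLin e e M))) = c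
    have := map_sum (Submodule.span ℂ {(1 : Module.End ℂ V)}).mkQ
      (fun i => c i • liftSection (b i)) Finset.univ
    refine Eq.trans (Finset.sum_congr rfl fun i _ => ?_) this.symm
    rw [map_smul, Submodule.mkQ_apply, mk_liftSection]
  rw [Submodule.Quotient.eq, Submodule.mem_span_singleton] at h2
  obtain ⟨r, hr⟩ := h2
  refine ⟨b.repr (Submodule.Quotient.mk (Matrix.toLin e e M)), r, ?_⟩
  have h3 := congr_arg (LinearMap.toMatrix e e) hr
  rw [map_smul, LinearMap.toMatrix_one, map_sub, LinearMap.toMatrix_toLin, map_sum] at h3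
  rw [h3, add_comm]
  simp only [map_smul, sectionMatrix]
  exact (sub_add_cancel _ _).symm

/-- The coordinates of the point given by a vector and a covector that annihilates it. -/
theorem exists_functional {x y : Fin 3 → ℂ} (hx : x ≠ 0) (hxy : y ⬝ᵥ x = 0) :
    ∃ (p : ℙ ℂ V) (q : Module.Dual ℂ (TangentAt p)), ∀ A : Module.End ℂ V,
      q (evalEnd p A) = y ⬝ᵥ (LinearMap.toMatrix e e A).mulVec x := by
  set v : V := e.equivFun.symm x with hv
  have hv0 : v ≠ 0 := (LinearEquiv.map_ne_zero_iff _).2 hx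
  let φ : V →ₗ[ℂ] ℂ := dotProductBilin ℂ ℂ y ∘ₗ e.equivFun.toLinearMap
  have hφ : ∀ w, φ w = y ⬝ᵥ e.equivFun w := fun w => rfl
  let p : ℙ ℂ V := Projectivization.mk ℂ v hv0
  have hp : p.submodule ≤ LinearMap.ker φ := by
    rw [Projectivization.submodule_mk, Submodule.span_singleton_le_iff_mem, LinearMap.mem_ker, hφ,
      hv, LinearEquiv.apply_symm_apply, hxy]
  have hvp : v ∈ p.submodule := by
    rw [Projectivization.submodule_mk]
    exact Submodule.mem_span_singleton_self v
  refine ⟨p, p.submodule.liftQ φ hp ∘ₗ LinearMap.applyₗ ⟨v, hvp⟩, fun A => ?_⟩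
  change φ (A v) = _
  rw [hφ]
  congr 1
  have := LinearMap.toMatrix_mulVec_repr e e A v
  rw [hv, ← Module.Basis.equivFun_apply, LinearEquiv.apply_symm_apply] at this
  rw [this]
  rfl

theorem exists_covector (p : ℙ ℂ V) (q : Module.Dual ℂ (TangentAt p)) :
    ∃ x y : Fin 3 → ℂ, x ≠ 0 ∧ y ⬝ᵥ x = 0 ∧ ∀ A : Module.End ℂ V,
      q (evalEnd p A) = y ⬝ᵥ (LinearMap.toMatrix e e A).mulVec x := by
  have hv0 := p.rep_nonzero
  set v := p.rep with hv
  have hvp : p.submodule = ℂ ∙ v := Projectivization.submodule_eq p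
  have hmem : v ∈ p.submodule := hvp ▸ Submodule.mem_span_singleton_self v
  obtain ⟨χ, hχ⟩ : ∃ χ : p.submodule →ₗ[ℂ] ℂ, χ ⟨v, hmem⟩ = 1 := by
    refine ⟨(LinearEquiv.coord ℂ V v hv0).toLinearMap ∘ₗ (LinearEquiv.ofEq _ _ hvp).toLinearMap, ?_⟩
    exact LinearEquiv.coord_self ℂ V v hv0
  -- As `χ` is the coordinate of the line dual to `v`, the map `w ↦ χ · [w]` identifies `V / p` with
  -- `Hom(p, V / p)`, and `q` becomes a functional on `V` that kills `p`.
  let φ : V →ₗ[ℂ] ℂ := q ∘ₗ LinearMap.smulRightₗ χ ∘ₗ p.submodule.mkQ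
  have hφ : ∀ A : Module.End ℂ V, q (evalEnd p A) = φ (A v) := by
    intro A
    change q _ = q _
    congr 1
    ext ⟨w, hw⟩
    obtain ⟨c, rfl⟩ := Submodule.mem_span_singleton.1 (hvp ▸ hw)
    have : (⟨c • v, hw⟩ : p.submodule) = c • ⟨v, hmem⟩ := rfl
    rw [this, map_smul, map_smul]
    congr 1
    simp [evalEnd, hχ]
  have hdot : ∀ w : V, φ w = (fun k => φ (e k)) ⬝ᵥ e.equivFun w := by
    intro w
    conv_lhs => rw [← e.sum_equivFun w, map_sum]
    simp [dotProduct, mul_comm]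
  refine ⟨e.equivFun v, fun k => φ (e k), by simpa using hv0, ?_, fun A => ?_⟩
  · rw [← hdot]
    have : p.submodule.mkQ v = 0 := by simpa using hmem
    change q (LinearMap.smulRightₗ χ (p.submodule.mkQ v)) = 0
    rw [this, map_zero, map_zero]
  · rw [hφ, hdot]
    congr 1
    exact (LinearMap.toMatrix_mulVec_repr e e A v).symm

theorem naturalEmbedding_mk (p : ℙ ℂ V) (q : Module.Dual ℂ (TangentAt p)) (hq : q ≠ 0) :
    ∃ hv, naturalEmbedding b ⟨p, Projectivization.mk ℂ q hq⟩ =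
      Projectivization.mk ℂ (fun i => q (evalEnd p (liftSection (b i)))) hv := by
  have h : ((b.constr ℂ (M' := ℂ)).symm.toLinearMap ∘ₗ (evalSection p).dualMap) q =
      fun i => q (evalEnd p (liftSection (b i))) := by
    ext i
    rw [← evalSection_apply]
    simp [Module.Basis.constr]
  have hv : (fun i => q (evalEnd p (liftSection (b i)))) ≠ 0 := by
    rw [← h, LinearMap.comp_apply]
    refine (LinearEquiv.map_ne_zero_iff _).2 ?_
    exact (map_ne_zero_iff _
      (LinearMap.dualMap_injective_of_surjective (evalSection_surjective p))).2 hq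
  refine ⟨hv, ?_⟩
  simp only [naturalEmbedding, Projectivization.map_mk]
  simp only [h]

/-- The points of the image are exactly those given by pairs of a nonzero vector and a nonzero
covector annihilating it, in any basis `e`; the freedom in `e` is what allows normal forms. -/
theorem mem_vanishingIdeal_range_iff (f : MvPolynomial (Fin 8) ℂ) :
    f ∈ vanishingIdeal (Set.range (naturalEmbedding b)) ↔ ∀ x y : Fin 3 → ℂ, x ≠ 0 → y ≠ 0 →
      y ⬝ᵥ x = 0 → eval (fun i => y ⬝ᵥ (sectionMatrix b e i).mulVec x) f = 0 := by
  constructor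
  · intro hf x y hx hy hxy
    obtain ⟨p, q, hq⟩ := exists_functional e hx hxy
    have hne := coordinates_ne_zero (spansModOne_sectionMatrix b e) hx hy hxy
    have hq0 : q ≠ 0 := by
      rintro rfl
      apply hne
      ext i
      simpa [sectionMatrix] using (hq (liftSection (b i))).symm
    obtain ⟨hv, hmk⟩ := naturalEmbedding_mk b p q hq0
    have := hf _ hv ⟨_, hmk⟩
    simp only [hq] at this
    exact this
  · rintro hf v hv ⟨⟨p, q⟩, hpq⟩
    induction q using Projectivization.ind with
    | h q hq =>
      obtain ⟨hv', hmk⟩ := naturalEmbedding_mk b p q hq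
      rw [hmk, Projectivization.mk_eq_mk_iff'] at hpq
      obtain ⟨c, hc⟩ := hpq
      obtain ⟨x, y, hx, hxy, hA⟩ := exists_covector e p q
      have hc0 : c ≠ 0 := by
        rintro rfl
        exact hv' (by rw [← hc, zero_smul])
      have hvx : v = fun i => (c⁻¹ • y) ⬝ᵥ (sectionMatrix b e i).mulVec x := by
        ext i
        have := congr_fun hc i
        rw [hA] at this
        simp only [Pi.smul_apply, smul_eq_mul] at this
        rw [smul_dotProduct, sectionMatrix, ← this, smul_eq_mul, inv_mul_cancel_left₀ hc0]
      have hy : c⁻¹ • y ≠ 0 := by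
        intro h0
        apply hv
        rw [hvx, h0]
        ext i
        simp
      rw [hvx]
      exact hf x _ hx hy (by rw [smul_dotProduct, hxy, smul_zero])

/-- The Nullstellensatz for the prime ideal of the incidence form, with the points where `x = 0` or
`y = 0` removed. -/
theorem mem_span_incidence_iff (f : BiPoly) :
    f ∈ Ideal.span {incidence} ↔ ∀ x y : Fin 3 → ℂ, x ≠ 0 → y ≠ 0 → y ⬝ᵥ x = 0 →
      eval (pt x y) f = 0 := by
  constructor
  · intro hf x y _ _ hxy
    obtain ⟨c, rfl⟩ := Ideal.mem_span_singleton.1 hf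
    rw [map_mul, incidence, eval_bilin, Matrix.one_mulVec, hxy, zero_mul]
  · intro h
    have hprime := (Ideal.span_singleton_prime prime_incidence.ne_zero).2 prime_incidence
    -- The factor `x₀ y₀` vanishes wherever `x = 0` or `y = 0`, so the product vanishes on the whole
    -- affine cone. Primality removes the factor again.
    have key : xv 0 * yv 0 * f ∈ Ideal.span {incidence} := by
      rw [← MvPolynomial.IsPrime.vanishingIdeal_zeroLocus (K := ℂ) (Ideal.span {incidence})]
      rw [mem_vanishingIdeal_iff]
      intro v hv
      rw [zeroLocus_span] at hv
      have hv' := hv _ rfl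
      obtain ⟨x, y, rfl⟩ : ∃ x y, v = pt x y := ⟨v ∘ .inl, v ∘ .inr, by simp [pt]⟩
      change eval (pt x y) _ = 0 at hv'
      change eval (pt x y) _ = 0
      rw [incidence, eval_bilin, Matrix.one_mulVec] at hv'
      rw [map_mul, map_mul, eval_pt_xv, eval_pt_yv]
      by_cases hx : x 0 = 0
      · simp [hx]
      by_cases hy : y 0 = 0
      · simp [hy]
      rw [h x y (fun h => hx (by simp [h])) (fun h => hy (by simp [h])) hv', mul_zero]
    have hX : ∀ p : BiPoly, (∃ x y, eval (pt x y) incidence = 0 ∧ eval (pt x y) p ≠ 0) →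
        p ∉ Ideal.span {incidence} := by
      rintro p ⟨x, y, h1, h2⟩ hp
      obtain ⟨c, rfl⟩ := Ideal.mem_span_singleton.1 hp
      simp [h1] at h2
    refine (hprime.mem_or_mem key).resolve_left fun h0 => ?_
    rcases hprime.mem_or_mem h0 with h1 | h1
    · exact hX _ ⟨![1, 0, 0], 0, by simp [incidence_eq], by simp⟩ h1
    · exact hX _ ⟨0, ![1, 0, 0], by simp [incidence_eq], by simp⟩ h1

theorem vanishingIdeal_range : vanishingIdeal (Set.range (naturalEmbedding b)) =
    (Ideal.span {incidence}).comap (segre (sectionMatrix b e)) := by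
  ext f
  rw [mem_vanishingIdeal_range_iff b e, Ideal.mem_comap, mem_span_incidence_iff]
  simp only [eval_segre]

/-- The endomorphism that corresponds to a linear form. -/
theorem exists_endomorphism {h : MvPolynomial (Fin 8) ℂ} (h_linear : h.IsHomogeneous 1)
    (h_ne : h ≠ 0) : ∃ A : Module.End ℂ V, (∀ r : ℂ, A ≠ r • 1) ∧
      ∀ e : Module.Basis (Fin 3) ℂ V,
        segre (sectionMatrix b e) h = bilin (LinearMap.toMatrix e e A) := by
  obtain ⟨c, hsum⟩ : ∃ c : Fin 8 → ℂ, h = ∑ i, C (c i) * X i := by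
    have := (mem_homogeneousSubmodule 1 h).2 h_linear
    rw [homogeneousSubmodule_one_eq_span_X, Submodule.mem_span_range_iff_exists_fun] at this
    obtain ⟨c, hc⟩ := this
    exact ⟨c, by simp [← hc, smul_eq_C_mul]⟩
  refine ⟨∑ i, c i • liftSection (b i), ?_, ?_⟩
  -- A scalar `A` would be a linear relation between the basis sections.
  · intro r hr
    have h1 := congr_arg (Submodule.span ℂ {(1 : Module.End ℂ V)}).mkQ hr
    have h2 : (Submodule.span ℂ {(1 : Module.End ℂ V)}).mkQ 1 = 0 := by
      simp
    rw [map_smul, h2, smul_zero, map_sum] at h1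
    have h3 : ∑ i, c i • b i = 0 := by
      rw [← h1]
      refine Finset.sum_congr rfl fun i _ => ?_
      rw [map_smul]
      exact congr_arg _ (mk_liftSection (b i)).symm
    have h4 := Fintype.linearIndependent_iff.1 b.linearIndependent c h3
    apply h_ne
    rw [hsum]
    simp [h4]
  · intro e
    conv_lhs => rw [hsum]
    simp only [map_sum, map_mul]
    refine Finset.sum_congr rfl fun i _ => ?_
    simp [segre, sectionMatrix, smul_eq_C_mul]

end TangentPlane

end

noncomputable section

namespace TangentPlane

open MvPolynomial

/-! ### Local rings of projective varieties as localizations of affine coordinate rings -/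

section Chart

variable {ι : Type}

/-- The degree `d` component is multiplied by `l ^ (n - d)`. A single form `F` serves for every
homomorphism that sends `l` to one, which allows two dehomogenizations to be compared. -/
theorem exists_homogenization {l : MvPolynomial ι ℂ} (hl : l.IsHomogeneous 1)
    (f : MvPolynomial ι ℂ) (n : ℕ) (hn : f.totalDegree ≤ n) :
    ∃ F : MvPolynomial ι ℂ, F.IsHomogeneous n ∧
      ∀ (A : Type) [CommRing A] [Algebra ℂ A] (g : MvPolynomial ι ℂ →ₐ[ℂ] A), g l = 1 →
        g F = g f := by
  refine ⟨∑ d ∈ Finset.range (f.totalDegree + 1), homogeneousComponent d f * l ^ (n - d), ?_, ?_⟩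
  · refine IsHomogeneous.sum _ _ _ fun d hd => ?_
    have h := (homogeneousComponent_isHomogeneous d f).mul (hl.pow (n - d))
    rw [Finset.mem_range] at hd
    rwa [show d + 1 * (n - d) = n by omega] at h
  · intro A _ _ g hg
    conv_rhs => rw [← sum_homogeneousComponent f]
    simp [hg]

theorem aeval_const_mul {A : Type*} [CommRing A] [Algebra ℂ A] {n : ℕ} {f : MvPolynomial ι ℂ}
    (hf : f.IsHomogeneous n) (s : A) (g : ι → A) :
    aeval (fun i => s * g i) f = s ^ n * aeval g f := by
  induction hf using IsWeightedHomogeneous.induction_on with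
  | zero => simp
  | add p q hp hq h1 h2 => rw [map_add, h1, h2, map_add]; ring
  | monomial d r hr =>
    have hr' : ∑ i ∈ d.support, d i = n := by
      rw [← hr, Finsupp.weight_apply, Finsupp.sum]
      simp
    rw [aeval_monomial, aeval_monomial, Finsupp.prod, Finsupp.prod]
    simp only [mul_pow, Finset.prod_mul_distrib, Finset.prod_pow_eq_pow_sum, hr']
    ring

theorem mem_vanishingIdeal_singleton {v : ι → ℂ} (hv : v ≠ 0) {f : MvPolynomial ι ℂ} {n : ℕ}
    (hf : f.IsHomogeneous n) :
    f ∈ vanishingIdeal {Projectivization.mk ℂ v hv} ↔ eval v f = 0 := by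
  constructor
  · intro h
    exact h v hv rfl
  · intro h w hw hwv
    obtain ⟨c, rfl⟩ := (Projectivization.mk_eq_mk_iff' _ _ _ _ _).1 hwv
    have h2 := aeval_const_mul hf c v
    change eval (c • v) f = c ^ n * eval v f at h2
    rw [h2, h, mul_zero]

variable (P : Ideal (MvPolynomial ι ℂ)) [P.IsPrime]

theorem toConeField_eq_zero_iff (f : MvPolynomial ι ℂ) : toConeField P f = 0 ↔ f ∈ P := by
  rw [toConeField, FaithfulSMul.algebraMap_eq_zero_iff, Ideal.Quotient.eq_zero_iff_mem]

/-- The map to the field of fractions of the homogeneous coordinate ring, as a homomorphism. -/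
def toConeFieldHom : MvPolynomial ι ℂ →ₐ[ℂ] ConeField P :=
  (IsScalarTower.toAlgHom ℂ (MvPolynomial ι ℂ ⧸ P) (ConeField P)).comp (Ideal.Quotient.mkₐ ℂ P)

theorem toConeFieldHom_apply (f : MvPolynomial ι ℂ) : toConeFieldHom P f = toConeField P f := rfl

theorem incl_injective : Function.Injective (FunctionField.incl P) :=
  (FunctionField.incl P).toRingHom.injective

theorem exists_isFraction {n : ℕ} {f g : MvPolynomial ι ℂ} (hf : f.IsHomogeneous n)
    (hg : g.IsHomogeneous n) (hgP : g ∉ P) : ∃ x : FunctionField P, IsFraction P x f g := by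
  have h : toConeField P f / toConeField P g ∈ functionSubfield P :=
    IntermediateField.subset_adjoin _ _ ⟨n, f, g, hf, hg, hgP, rfl⟩
  exact ⟨(⟨_, h⟩ : functionSubfield P), ⟨n, hf, hg⟩, rfl⟩

/-- The homomorphism `φ` from the homogeneous coordinate ring of projective space is the
dehomogenization with respect to the linear form `l`, onto the affine coordinate ring of
the complement of the hyperplane `l = 0` in the projective variety of `P`. -/
structure IsChart (l : MvPolynomial ι ℂ) {B : Type} [CommRing B] [Algebra ℂ B]
    (φ : MvPolynomial ι ℂ →ₐ[ℂ] B) : Prop where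
  isHomogeneous : l.IsHomogeneous 1
  surjective : Function.Surjective φ
  map_eq_one : φ l = 1
  map_eq_zero_iff : ∀ (n : ℕ) (f : MvPolynomial ι ℂ), f.IsHomogeneous n → (φ f = 0 ↔ f ∈ P)

variable {P}
variable {l : MvPolynomial ι ℂ} {B : Type} [CommRing B] [Algebra ℂ B]
  {φ : MvPolynomial ι ℂ →ₐ[ℂ] B}

theorem IsChart.nontrivial (h : IsChart P l φ) : Nontrivial B := by
  refine ⟨⟨1, 0, fun h0 => ?_⟩⟩
  have := (h.map_eq_zero_iff 0 1 (isHomogeneous_one _ _)).1 (by rw [map_one, h0])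
  exact (inferInstance : P.IsPrime).one_notMem this

theorem IsChart.notMem (h : IsChart P l φ) : l ∉ P := by
  have := h.nontrivial
  intro hl
  have h0 := (h.map_eq_zero_iff 1 l h.isHomogeneous).2 hl
  rw [h.map_eq_one] at h0
  exact one_ne_zero h0

variable (P l) in
/-- The rational function `X i / l`. -/
def coordRatio (hl : l.IsHomogeneous 1) (hlP : l ∉ P) (i : ι) : FunctionField P :=
  (exists_isFraction P (isHomogeneous_X ℂ i) hl hlP).choose

theorem incl_coordRatio (hl : l.IsHomogeneous 1) (hlP : l ∉ P) (i : ι) :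
    FunctionField.incl P (coordRatio P l hl hlP i) = toConeField P (X i) / toConeField P l :=
  (exists_isFraction P (isHomogeneous_X ℂ i) hl hlP).choose_spec.2

variable (P l) in
/-- The dehomogenization, with values in the function field. -/
def dehom (hl : l.IsHomogeneous 1) (hlP : l ∉ P) : MvPolynomial ι ℂ →ₐ[ℂ] FunctionField P :=
  aeval (coordRatio P l hl hlP)

theorem incl_dehom (hl : l.IsHomogeneous 1) (hlP : l ∉ P) {n : ℕ} {f : MvPolynomial ι ℂ}
    (hf : f.IsHomogeneous n) :
    FunctionField.incl P (dehom P l hl hlP f) = toConeField P f / toConeField P l ^ n := by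
  have h : (FunctionField.incl P).comp (dehom P l hl hlP) =
      aeval (fun i => (toConeField P l)⁻¹ * toConeField P (X i)) := by
    ext i
    simp [dehom, incl_coordRatio, div_eq_inv_mul]
  have h2 : aeval (fun i => toConeField P (X i)) = toConeFieldHom P := by
    ext i
    simp [toConeFieldHom_apply]
  have h3 := congr($h f)
  rw [aeval_const_mul hf, h2] at h3
  rw [← AlgHom.comp_apply, h3, toConeFieldHom_apply, inv_pow, div_eq_inv_mul]

theorem dehom_eq_zero_iff (hl : l.IsHomogeneous 1) (hlP : l ∉ P) {n : ℕ} {f : MvPolynomial ι ℂ}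
    (hf : f.IsHomogeneous n) : dehom P l hl hlP f = 0 ↔ f ∈ P := by
  have hl0 : toConeField P l ≠ 0 := mt (toConeField_eq_zero_iff P l).1 hlP
  rw [← map_eq_zero_iff _ (incl_injective P), incl_dehom hl hlP hf, div_eq_zero_iff,
    toConeField_eq_zero_iff]
  simp [hl0]

theorem dehom_self (hl : l.IsHomogeneous 1) (hlP : l ∉ P) : dehom P l hl hlP l = 1 := by
  have hl0 : toConeField P l ≠ 0 := mt (toConeField_eq_zero_iff P l).1 hlP
  apply incl_injective P
  rw [incl_dehom hl hlP hl, map_one, pow_one, div_self hl0]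

/-- Both maps send `l` to one and kill the same forms, namely those in `P`; homogenization extends
this to all polynomials. -/
theorem IsChart.ker_eq (h : IsChart P l φ) :
    RingHom.ker φ = RingHom.ker (dehom P l h.isHomogeneous h.notMem) := by
  ext f
  obtain ⟨F, hF, hF'⟩ := exists_homogenization h.isHomogeneous f _ le_rfl
  rw [RingHom.mem_ker, RingHom.mem_ker, ← hF' _ φ h.map_eq_one,
    ← hF' _ (dehom P l h.isHomogeneous h.notMem) (dehom_self _ _),
    h.map_eq_zero_iff _ _ hF, dehom_eq_zero_iff _ _ hF]

/-- The inclusion of an affine coordinate ring into the function field. -/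
theorem IsChart.exists_embedding (h : IsChart P l φ) :
    ∃ ψ : B →ₐ[ℂ] FunctionField P, Function.Injective ψ ∧
      ∀ f, ψ (φ f) = dehom P l h.isHomogeneous h.notMem f := by
  let ψ : B →ₐ[ℂ] FunctionField P :=
    (Ideal.Quotient.liftₐ (RingHom.ker φ) (dehom P l h.isHomogeneous h.notMem) (fun a ha => by
      rw [h.ker_eq] at ha; exact ha)).comp
      (Ideal.quotientKerAlgEquivOfSurjective h.surjective).symm.toAlgHom
  have hψ : ∀ f, ψ (φ f) = dehom P l h.isHomogeneous h.notMem f := by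
    intro f
    have : (Ideal.quotientKerAlgEquivOfSurjective h.surjective).symm (φ f) =
        Ideal.Quotient.mk _ f := by
      rw [AlgEquiv.symm_apply_eq]
      rfl
    simp only [ψ, AlgHom.comp_apply]
    erw [this]
    rfl
  refine ⟨ψ, ?_, hψ⟩
  rw [injective_iff_map_eq_zero]
  intro a ha
  obtain ⟨f, rfl⟩ := h.surjective a
  rw [hψ] at ha
  have : f ∈ RingHom.ker φ := by rw [h.ker_eq]; exact ha
  exact this

variable {v : ι → ℂ} {ev : B →ₐ[ℂ] ℂ}

theorem IsChart.eval_eq (h : IsChart P l φ) (hev : ∀ f, ev (φ f) = eval v f) : eval v l = 1 := by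
  rw [← hev, h.map_eq_one, map_one]

/-- Fractions `a / s` with `s` nonzero at the point form a subalgebra that contains the generators
of the local ring. Conversely `a` and `s` are homogenized to the same degree, which makes `a / s` a
quotient of forms. -/
theorem IsChart.mem_localRing_iff (h : IsChart P l φ) (hev : ∀ f, ev (φ f) = eval v f)
    (hv : v ≠ 0) {ψ : B →ₐ[ℂ] FunctionField P} (hinj : Function.Injective ψ)
    (hψ : ∀ f, ψ (φ f) = dehom P l h.isHomogeneous h.notMem f) (x : FunctionField P) :
    x ∈ localRing P (Projectivization.mk ℂ v hv) ↔ ∃ a s : B, ev s ≠ 0 ∧ x * ψ s = ψ a := by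
  have hl0 : toConeField P l ≠ 0 := mt (toConeField_eq_zero_iff P l).1 h.notMem
  have hψ0 : ∀ s : B, ev s ≠ 0 → ψ s ≠ 0 := by
    intro s hs h0
    rw [_root_.map_eq_zero_iff _ hinj] at h0
    exact hs (by rw [h0, map_zero])
  constructor
  · intro hx
    induction hx using Algebra.adjoin_induction with
    | mem x hx =>
      obtain ⟨f, g, hg, ⟨n, hf, hg'⟩, hx⟩ := hx
      rw [mem_vanishingIdeal_singleton hv hg'] at hg
      refine ⟨φ f, φ g, by rwa [hev], ?_⟩
      have hgP : toConeField P g ≠ 0 := by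
        intro h0
        rw [toConeField_eq_zero_iff, ← h.map_eq_zero_iff n g hg'] at h0
        apply hg
        rw [← hev, h0, map_zero]
      apply incl_injective P
      rw [hψ, hψ, map_mul, incl_dehom _ _ hf, incl_dehom _ _ hg', hx]
      field_simp
    | algebraMap r => exact ⟨algebraMap ℂ B r, 1, by simp, by simp⟩
    | add x y _ _ hx hy =>
      obtain ⟨a, s, hs, hx⟩ := hx
      obtain ⟨b, t, ht, hy⟩ := hy
      refine ⟨a * t + b * s, s * t, by rw [map_mul]; exact mul_ne_zero hs ht, ?_⟩
      rw [map_mul, map_add, map_mul, map_mul, ← hx, ← hy]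
      ring
    | mul x y _ _ hx hy =>
      obtain ⟨a, s, hs, hx⟩ := hx
      obtain ⟨b, t, ht, hy⟩ := hy
      refine ⟨a * b, s * t, by rw [map_mul]; exact mul_ne_zero hs ht, ?_⟩
      rw [map_mul, map_mul, ← hx, ← hy]
      ring
  · rintro ⟨a, s, hs, hx⟩
    obtain ⟨f, rfl⟩ := h.surjective a
    obtain ⟨g, rfl⟩ := h.surjective s
    obtain ⟨F, hF, hF'⟩ := exists_homogenization h.isHomogeneous f
      (max f.totalDegree g.totalDegree) (le_max_left _ _)
    obtain ⟨G, hG, hG'⟩ := exists_homogenization h.isHomogeneous g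
      (max f.totalDegree g.totalDegree) (le_max_right _ _)
    have hG0 : dehom P l h.isHomogeneous h.notMem G ≠ 0 := by
      rw [hG' _ _ (dehom_self _ _), ← hψ]
      exact hψ0 _ hs
    have hGP : toConeField P G ≠ 0 := by
      intro h0
      rw [toConeField_eq_zero_iff, ← dehom_eq_zero_iff h.isHomogeneous h.notMem hG] at h0
      exact hG0 h0
    refine Algebra.subset_adjoin ⟨F, G, ?_, ⟨_, hF, hG⟩, ?_⟩
    · rw [mem_vanishingIdeal_singleton hv hG]
      have := hG' ℂ (aeval v) (h.eval_eq hev)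
      change eval v G = eval v g at this
      rwa [this, ← hev]
    · have h1 := congr_arg (FunctionField.incl P) hx
      rw [hψ, hψ, ← hF' _ _ (dehom_self h.isHomogeneous h.notMem),
        ← hG' _ _ (dehom_self h.isHomogeneous h.notMem), map_mul, incl_dehom _ _ hF,
        incl_dehom _ _ hG] at h1
      field_simp at h1 ⊢
      exact h1

/-- The local ring at a point of a chart is a localization of the affine coordinate ring. -/
theorem IsChart.exists_isLocalization (h : IsChart P l φ) (hev : ∀ f, ev (φ f) = eval v f)
    (hv : v ≠ 0) : ∃ ρ : B →ₐ[ℂ] localRing P (Projectivization.mk ℂ v hv),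
      letI := ρ.toRingHom.toAlgebra
      haveI := RingHom.ker_isPrime ev
      IsLocalization.AtPrime (localRing P (Projectivization.mk ℂ v hv)) (RingHom.ker ev) := by
  obtain ⟨ψ, hinj, hψ⟩ := h.exists_embedding
  have hmem := h.mem_localRing_iff hev hv hinj hψ
  let ρ : B →ₐ[ℂ] localRing P (Projectivization.mk ℂ v hv) :=
    ψ.codRestrict _ fun a => (hmem _).2 ⟨a, 1, by simp, by simp⟩
  have hρ : ∀ a, (ρ a : FunctionField P) = ψ a := fun a => rfl
  refine ⟨ρ, ?_⟩
  let := ρ.toRingHom.toAlgebra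
  have := RingHom.ker_isPrime ev
  have hψ0 : ∀ s : B, ev s ≠ 0 → ψ s ≠ 0 := by
    intro s hs h0
    rw [_root_.map_eq_zero_iff _ hinj] at h0
    exact hs (by rw [h0, map_zero])
  refine (isLocalization_iff _ _).2 ⟨?_, ?_, ?_⟩
  · rintro ⟨s, hs⟩
    have hs' : ev s ≠ 0 := hs
    refine IsUnit.of_mul_eq_one (b := ⟨(ψ s)⁻¹, (hmem _).2 ⟨1, s, hs', ?_⟩⟩) ?_
    · rw [inv_mul_cancel₀ (hψ0 s hs'), map_one]
    · ext1
      exact mul_inv_cancel₀ (hψ0 s hs')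
  · rintro ⟨z, hz⟩
    obtain ⟨a, s, hs, hx⟩ := (hmem z).1 hz
    exact ⟨⟨a, ⟨s, hs⟩⟩, Subtype.ext hx⟩
  · intro a b hab
    refine ⟨1, ?_⟩
    have : ψ a = ψ b := congr_arg Subtype.val hab
    rw [hinj this]

theorem IsChart.mem_points (h : IsChart P l φ)
    (hP : ∀ f ∈ P, ∀ n, homogeneousComponent n f ∈ P) (hev : ∀ f, ev (φ f) = eval v f)
    (hv : v ≠ 0) : Projectivization.mk ℂ v hv ∈ points P := by
  intro f hf
  rw [← sum_homogeneousComponent f]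
  refine Ideal.sum_mem _ fun n _ => ?_
  have hn := homogeneousComponent_isHomogeneous n f
  rw [mem_vanishingIdeal_singleton hv hn, ← hev, (h.map_eq_zero_iff n _ hn).2 (hP f hf n), map_zero]

end Chart

end TangentPlane

end

noncomputable section

namespace TangentPlane

open MvPolynomial

/-! ### Dimension and the Jacobian criterion -/

section Jacobian

instance isPrime_ker {B : Type} [CommRing B] [Algebra ℂ B] (ev : B →ₐ[ℂ] ℂ) :
    (RingHom.ker ev).IsPrime := RingHom.ker_isPrime ev

variable {σ : Type} [Finite σ]

/-- Some maximal ideal has height equal to the dimension of the ring, and a translation of affine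
space carries its point to the given one. -/
theorem height_ker (e : MvPolynomial σ ℂ →ₐ[ℂ] ℂ) :
    (RingHom.ker e).height = Nat.card σ := by
  have hdim : ringKrullDim (MvPolynomial σ ℂ) = Nat.card σ := by
    rw [MvPolynomial.ringKrullDim_of_isNoetherianRing, ringKrullDim_eq_zero_of_field, zero_add]
  have : FiniteRingKrullDim (MvPolynomial σ ℂ) := by
    rw [finiteRingKrullDim_iff_ne_bot_and_top, hdim]
    exact ⟨WithBot.coe_ne_bot, fun h => ENat.natCast_ne_top (Nat.card σ) (WithBot.coe_injective h)⟩
  obtain ⟨p, hp, hh⟩ := Ideal.exists_isMaximal_height (R := MvPolynomial σ ℂ)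
  obtain ⟨v, rfl⟩ := isMaximal_iff_eq_vanishingIdeal_singleton.1 hp
  let c : σ → ℂ := fun s => e (X s) - v s
  let τ : MvPolynomial σ ℂ ≃ₐ[ℂ] MvPolynomial σ ℂ :=
    AlgEquiv.ofAlgHom (aeval fun s => X s + C (c s)) (aeval fun s => X s - C (c s))
      (by ext s; simp [algHom_C]) (by ext s; simp [algHom_C])
  have hτ : ∀ f, aeval v (τ f) = e f := by
    intro f
    have : (aeval v).comp τ.toAlgHom = e := by
      ext s
      simp [τ, c]
    exact congr($this f)
  have h : RingHom.ker e = Ideal.comap τ.toRingEquiv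
      (MvPolynomial.vanishingIdeal ℂ {v}) := by
    ext f
    rw [Ideal.mem_comap, MvPolynomial.mem_vanishingIdeal_singleton_iff, RingHom.mem_ker, ← hτ]
    rfl
  rw [hdim] at hh
  rw [h, RingEquiv.height_comap]
  exact_mod_cast hh

variable {B : Type} [CommRing B] [Algebra ℂ B] {ψ : MvPolynomial σ ℂ →ₐ[ℂ] B}

/-- Krull's height theorem: passing to the quotient by the ideal of `s` lowers the height of a point
by at most the number of equations. -/
theorem card_le_height_ker_add (hψ : Function.Surjective ψ) {s : Set (MvPolynomial σ ℂ)}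
    (hs : RingHom.ker ψ = Ideal.span s) (ev : B →ₐ[ℂ] ℂ) :
    (Nat.card σ : ℕ∞) ≤ (RingHom.ker ev).height + s.encard := by
  have hle : Ideal.span s ≤ RingHom.ker (ev.comp ψ) := by
    rw [← hs]
    intro f hf
    rw [RingHom.mem_ker] at hf ⊢
    rw [AlgHom.comp_apply, hf, map_zero]
  rw [← height_ker (ev.comp ψ)]
  refine (Ideal.height_le_height_add_encard_of_subset s (Ideal.span_le.1 hle)).trans_eq ?_
  congr 1
  let e : (MvPolynomial σ ℂ ⧸ Ideal.span s) ≃+* B :=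
    (Ideal.quotEquivOfEq hs.symm).trans (RingHom.quotientKerEquivOfSurjective hψ)
  rw [← RingEquiv.height_comap e (RingHom.ker ev)]
  congr 1
  apply Ideal.comap_injective_of_surjective _ Ideal.Quotient.mk_surjective
  rw [Ideal.comap_map_mk hle]
  ext f
  rfl

/-- The linear Taylor expansion at a point. -/
theorem sub_linear_mem_ker_sq {σ : Type} [Fintype σ] (e : MvPolynomial σ ℂ →ₐ[ℂ] ℂ) (f : MvPolynomial σ ℂ) :
    f - C (e f) - ∑ t, C (e (pderiv t f)) * (X t - C (e (X t))) ∈ RingHom.ker e ^ 2 := by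
  classical
  have hX : ∀ t, X t - C (e (X t)) ∈ RingHom.ker e := fun t => by
    rw [RingHom.mem_ker, map_sub, algHom_C]; simp
  have hf0 : ∀ g, g - C (e g) ∈ RingHom.ker e := fun g => by
    rw [RingHom.mem_ker, map_sub, algHom_C]; simp
  induction f using MvPolynomial.induction_on with
  | C a => simp [algHom_C]
  | add p q hp hq =>
    convert add_mem hp hq using 1
    simp only [map_add, add_mul, Finset.sum_add_distrib]
    ring
  | mul_X p s hp =>
    have h1 := Ideal.mul_mem_left _ (X s) hp
    have hlin : ∑ t, C (e (pderiv t p)) * (X t - C (e (X t))) ∈ RingHom.ker e :=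
      Ideal.sum_mem _ fun t _ => Ideal.mul_mem_left _ _ (hX t)
    have h2 := Ideal.mul_mem_mul (hX s) hlin
    rw [← pow_two] at h2
    convert add_mem h1 h2 using 1
    have h3 : ∀ t, C (e (pderiv t (p * X s))) * (X t - C (e (X t))) =
        C (e (X s)) * (C (e (pderiv t p)) * (X t - C (e (X t)))) +
          if t = s then C (e p) * (X s - C (e (X s))) else 0 := by
      intro t
      rw [Derivation.leibniz, pderiv_X]
      by_cases h : t = s
      · subst h; simp; ring
      · simp [h]; ring
    simp only [h3, Finset.sum_add_distrib, ← Finset.mul_sum, Finset.sum_ite_eq', Finset.mem_univ,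
      if_true, map_mul]
    ring

variable {R : Type} [CommRing R] [Algebra B R]

/-- The Jacobian criterion. -/
theorem isRegularLocalRing_of_linearIndependent (hψ : Function.Surjective ψ) {k : ℕ}
    {s : Fin k → MvPolynomial σ ℂ} (hs : RingHom.ker ψ = Ideal.span (Set.range s))
    (ev : B →ₐ[ℂ] ℂ) [IsLocalization.AtPrime R (RingHom.ker ev)]
    (hind : LinearIndependent ℂ fun i t => ev (ψ (pderiv t (s i)))) : IsRegularLocalRing R := by
  have := Fintype.ofFinite σ
  have hlocal : IsLocalRing R := IsLocalization.AtPrime.isLocalRing R (RingHom.ker ev)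
  have hnoethB : IsNoetherianRing B := isNoetherianRing_of_surjective _ _ ψ.toRingHom hψ
  have hnoeth : IsNoetherianRing R :=
    IsLocalization.isNoetherianRing (RingHom.ker ev).primeCompl R hnoethB
  apply IsRegularLocalRing.of_spanFinrank_maximalIdeal_le
  let a : σ → B := fun t => ψ (X t) - algebraMap ℂ B (ev (ψ (X t)))
  have ha : ∀ t, a t = ψ (X t - C (ev (ψ (X t)))) := fun t => by rw [map_sub, algHom_C]
  have hamem : ∀ t, a t ∈ RingHom.ker ev := fun t => by simp [a, RingHom.mem_ker]
  let W : Submodule ℂ (σ → ℂ) := Submodule.span ℂ (Set.range fun i t => ev (ψ (pderiv t (s i))))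
  have hWdim : Module.finrank ℂ W = k := by
    rw [finrank_span_eq_card hind, Fintype.card_fin]
  have hmap : ∀ f, f ∈ RingHom.ker (ev.comp ψ) ^ 2 → ψ f ∈ RingHom.ker ev ^ 2 := by
    intro f hf
    have := Ideal.mem_map_of_mem ψ hf
    rw [Ideal.map_pow] at this
    refine Ideal.pow_right_mono (Ideal.map_le_iff_le_comap.2 fun g hg => ?_) 2 this
    exact hg
  let T : (σ → ℂ) →ₗ[ℂ] B := Fintype.linearCombination ℂ a
  have hT : ∀ c, T c = ∑ t, c t • a t := fun c => Fintype.linearCombination_apply ℂ a c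
  -- The Taylor expansion of an equation shows that its gradient, read as a combination of the local
  -- parameters `a t`, lies in the square of the maximal ideal. Hence the cotangent space is a
  -- quotient of `(σ → ℂ) ⧸ W`, of dimension `n = card σ - k`.
  have hW : ∀ c ∈ W, T c ∈ RingHom.ker ev ^ 2 := by
    intro c hc
    induction hc using Submodule.span_induction with
    | mem c hc =>
      obtain ⟨i, rfl⟩ := hc
      have h1 := hmap _ (sub_linear_mem_ker_sq (ev.comp ψ) (s i))
      have h2 : ψ (s i) = 0 := by
        rw [← RingHom.mem_ker, hs]
        exact Ideal.subset_span ⟨i, rfl⟩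
      rw [map_sub, map_sub, AlgHom.comp_apply, h2, map_zero, map_zero, map_zero, sub_zero,
        zero_sub, neg_mem_iff, map_sum] at h1
      convert h1 using 1
      rw [hT]
      refine Finset.sum_congr rfl fun t _ => ?_
      rw [map_mul, algHom_C, AlgHom.comp_apply, AlgHom.comp_apply, ← ha, Algebra.smul_def]
    | zero => simp
    | add c d _ _ h1 h2 => rw [map_add]; exact add_mem h1 h2
    | smul r c _ h1 => rw [map_smul, Algebra.smul_def]; exact Ideal.mul_mem_left _ _ h1
  let n := Module.finrank ℂ ((σ → ℂ) ⧸ W)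
  have hn : n + k = Nat.card σ := by
    have := W.finrank_quotient_add_finrank
    rw [hWdim] at this
    simpa using this
  let bas := Module.finBasis ℂ ((σ → ℂ) ⧸ W)
  choose u hu using fun i => W.mkQ_surjective (bas i)
  let t : Fin n → R := fun i => algebraMap B R (T (u i))
  have hmaxB : ∀ x ∈ RingHom.ker ev, x ∈ Ideal.span (Set.range a) := by
    intro x hx
    obtain ⟨f, rfl⟩ := hψ x
    have h4 : RingHom.ker (ev.comp ψ) ≤ Ideal.span (Set.range fun t => X t - C (ev (ψ (X t)))) := by
      intro g hg
      rw [RingHom.mem_ker] at hg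
      have h5 : Ideal.Quotient.mkₐ ℂ (Ideal.span (Set.range fun t => X t - C (ev (ψ (X t))))) =
          (Algebra.ofId ℂ _).comp (ev.comp ψ) := by
        ext t
        rw [AlgHom.comp_apply, Ideal.Quotient.mkₐ_eq_mk]
        rw [Algebra.ofId_apply, ← Ideal.Quotient.mk_algebraMap, Ideal.Quotient.eq]
        exact Ideal.subset_span ⟨t, rfl⟩
      have h6 := congr($h5 g)
      rw [AlgHom.comp_apply, hg, map_zero] at h6
      exact Ideal.Quotient.eq_zero_iff_mem.1 h6
    have h7 := Ideal.mem_map_of_mem ψ (h4 (show f ∈ RingHom.ker (ev.comp ψ) from hx))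
    rw [Ideal.map_span, ← Set.range_comp] at h7
    convert h7 using 3
    funext t
    exact ha t
  have hmax : IsLocalRing.maximalIdeal R = (RingHom.ker ev).map (algebraMap B R) :=
    (IsLocalization.AtPrime.map_eq_maximalIdeal (RingHom.ker ev) R).symm
  have hspan : IsLocalRing.maximalIdeal R = Ideal.span (Set.range t) := by
    apply le_antisymm
    -- Lifts of a basis of the quotient by `W` generate the maximal ideal modulo its square, hence
    -- generate it by Nakayama's lemma.
    · have key : IsLocalRing.maximalIdeal R ≤ Ideal.span (Set.range t) ⊔
          IsLocalRing.maximalIdeal R * IsLocalRing.maximalIdeal R := by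
        conv_lhs => rw [hmax]
        rw [Ideal.map_le_iff_le_comap]
        intro x hx
        have := hmaxB x hx
        refine (Ideal.span_le.2 ?_ : Ideal.span (Set.range a) ≤ _) this
        rintro _ ⟨j, rfl⟩
        classical
        rw [SetLike.mem_coe, Ideal.mem_comap]
        have h1 : T (Pi.single j 1) = a j := by
          rw [hT, Finset.sum_eq_single j] <;> simp +contextual
        have h2 := bas.sum_repr (W.mkQ (Pi.single j 1))
        have h3 : Pi.single j 1 - ∑ i, bas.repr (W.mkQ (Pi.single j 1)) i • u i ∈ W := by
          rw [← Submodule.Quotient.mk_eq_zero, ← Submodule.mkQ_apply, map_sub, map_sum]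
          simp only [map_smul, hu]
          rw [h2, sub_self]
        have h4 := hW _ h3
        rw [map_sub, h1, map_sum] at h4
        have h5 := Ideal.mem_map_of_mem (algebraMap B R) h4
        rw [Ideal.map_pow, ← hmax, pow_two] at h5
        rw [map_sub, map_sum] at h5
        rw [← sub_add_cancel (algebraMap B R (a j))
          (∑ i, algebraMap B R (T (bas.repr (W.mkQ (Pi.single j 1)) i • u i)))]
        refine add_mem (Ideal.mem_sup_right h5) (Ideal.mem_sup_left ?_)
        refine Ideal.sum_mem _ fun i _ => ?_
        rw [map_smul, Algebra.smul_def, map_mul]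
        exact Ideal.mul_mem_left _ _ (Ideal.subset_span ⟨i, rfl⟩)
      exact Submodule.le_of_le_smul_of_le_jacobson_bot (IsNoetherian.noetherian _)
        (IsLocalRing.maximalIdeal_le_jacobson _) key
    · rw [Ideal.span_le, hmax]
      rintro _ ⟨i, rfl⟩
      refine Ideal.mem_map_of_mem _ ?_
      rw [hT]
      refine Ideal.sum_mem _ fun j _ => ?_
      rw [Algebra.smul_def]
      exact Ideal.mul_mem_left _ _ (hamem j)
  have h1 : (IsLocalRing.maximalIdeal R).spanFinrank ≤ n := by
    rw [hspan]
    refine (Submodule.spanFinrank_span_le_ncard_of_finite (Set.finite_range t)).trans ?_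
    rw [← Nat.card_coe_set_eq]
    exact (Finite.card_range_le t).trans (by simp)
  -- The height bound makes the dimension at least `n`, which is an upper bound for the number of
  -- generators.
  have h2 := card_le_height_ker_add hψ hs ev
  rw [IsLocalization.AtPrime.ringKrullDim_eq_height (RingHom.ker ev) R]
  have h3 : (Set.range s).encard ≤ k := by
    rw [← Set.image_univ]
    refine (Set.encard_image_le _ _).trans ?_
    simp
  have h4 : ((n : ℕ∞) + k) ≤ (RingHom.ker ev).height + k := by
    refine le_trans ?_ (h2.trans (by gcongr))
    rw [← hn]; norm_cast
  have h5 : (n : ℕ∞) ≤ (RingHom.ker ev).height :=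
    (ENat.add_le_add_iff_right (ENat.natCast_ne_top k)).1 h4
  have h6 : ((IsLocalRing.maximalIdeal R).spanFinrank : ℕ∞) ≤ (RingHom.ker ev).height :=
    le_trans (by exact_mod_cast h1) h5
  exact_mod_cast h6

end Jacobian

end TangentPlane

end

noncomputable section

namespace TangentPlane

open MvPolynomial

/-! ### Double points of surfaces in affine space -/

section Multiplicity

theorem degree_eq_sum (d : Fin 3 →₀ ℕ) : d.degree = ∑ k, d k := Finsupp.degree_eq_sum d

/-- The exponents of degree less than `k`. -/
def exponentsLtEquiv (k : ℕ) : {d : Fin 3 →₀ ℕ // d.degree < k} ≃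
    Σ j : Fin k, {d : Fin 3 →₀ ℕ // ∑ i, d i = j} where
  toFun d := ⟨⟨d.1.degree, d.2⟩, d.1, (degree_eq_sum d.1).symm⟩
  invFun d := ⟨d.2.1, by rw [degree_eq_sum, d.2.2]; exact d.1.2⟩
  left_inv d := rfl
  right_inv := by
    rintro ⟨⟨j, hj⟩, d, hd⟩
    obtain rfl : d.degree = j := by rw [degree_eq_sum]; exact hd
    rfl

instance (k : ℕ) : Finite {d : Fin 3 →₀ ℕ // d.degree < k} :=
  Finite.of_equiv _ (exponentsLtEquiv k).symm

theorem card_degree_lt (k : ℕ) :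
    Nat.card {d : Fin 3 →₀ ℕ // d.degree < k} = (k + 2).choose 3 := by
  rw [Nat.card_congr (exponentsLtEquiv k), Nat.card_sigma]
  simp only [card_sum_eq]
  rw [Fin.sum_univ_eq_sum_range (fun j => (j + 2).choose 2) k]
  induction k with
  | zero => rfl
  | succ k ih => rw [Finset.sum_range_succ, ih, Nat.choose_succ_succ (k + 2) 2, add_comm]

/-- The truncation of a polynomial, as the family of its coefficients. -/
def truncation (k : ℕ) :
    MvPolynomial (Fin 3) ℂ →ₗ[ℂ] ({d : Fin 3 →₀ ℕ // d.degree < k} → ℂ) :=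
  LinearMap.pi fun d => lcoeff ℂ d.1

theorem truncation_surjective (k : ℕ) : Function.Surjective (truncation k) := by
  classical
  have := Fintype.ofFinite {d : Fin 3 →₀ ℕ // d.degree < k}
  intro c
  refine ⟨∑ d, monomial d.1 (c d), ?_⟩
  ext e
  simp only [truncation, LinearMap.pi_apply, lcoeff_apply, coeff_sum, coeff_monomial]
  rw [Finset.sum_eq_single e]
  · simp
  · intro d _ hd
    rw [if_neg fun h => hd (Subtype.ext h)]
  · simp

theorem ker_truncation (k : ℕ) :
    LinearMap.ker (truncation k) = (idealOfVars (Fin 3) ℂ ^ k).restrictScalars ℂ := by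
  ext f
  rw [Submodule.restrictScalars_mem, mem_pow_idealOfVars_iff', LinearMap.mem_ker]
  constructor
  · intro h d hd
    exact congr_fun h ⟨d, hd⟩
  · intro h
    ext d
    exact h d.1 d.2

/-- The ring of polynomials modulo a power of the ideal of the variables. -/
def quotientPowEquiv (k : ℕ) : (MvPolynomial (Fin 3) ℂ ⧸ idealOfVars (Fin 3) ℂ ^ k) ≃ₗ[ℂ]
    ({d : Fin 3 →₀ ℕ // d.degree < k} → ℂ) :=
  (Submodule.Quotient.restrictScalarsEquiv ℂ (idealOfVars (Fin 3) ℂ ^ k)).symm.trans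
    ((Submodule.quotEquivOfEq _ _ (ker_truncation k).symm).trans
      ((truncation k).quotKerEquivOfSurjective (truncation_surjective k)))

instance (k : ℕ) : FiniteDimensional ℂ (MvPolynomial (Fin 3) ℂ ⧸ idealOfVars (Fin 3) ℂ ^ k) :=
  Module.Finite.equiv (quotientPowEquiv k).symm

theorem finrank_quotient_pow (k : ℕ) :
    Module.finrank ℂ (MvPolynomial (Fin 3) ℂ ⧸ idealOfVars (Fin 3) ℂ ^ k) =
      (k + 2).choose 3 := by
  have := Fintype.ofFinite {d : Fin 3 →₀ ℕ // d.degree < k}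
  rw [(quotientPowEquiv k).finrank_eq, Module.finrank_fintype_fun_eq_card, ← card_degree_lt,
    Nat.card_eq_fintype_card]

theorem mem_pow_iff_order (k : ℕ) (f : MvPolynomial (Fin 3) ℂ) :
    f ∈ idealOfVars (Fin 3) ℂ ^ k ↔ (k : ℕ∞) ≤ (f : MvPowerSeries (Fin 3) ℂ).order := by
  rw [mem_pow_idealOfVars_iff']
  constructor
  · intro h
    exact MvPowerSeries.nat_le_order fun d hd => by rw [coeff_coe]; exact h d hd
  · intro h d hd
    rw [← coeff_coe]
    exact MvPowerSeries.coeff_of_lt_order (lt_of_lt_of_le (by exact_mod_cast hd) h)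

variable {G : MvPolynomial (Fin 3) ℂ} {B : Type} [CommRing B] [Algebra ℂ B]
  {ψ : MvPolynomial (Fin 3) ℂ →ₐ[ℂ] B} {ev : B →ₐ[ℂ] ℂ}

/-- Orders of power series over a field add under multiplication. -/
theorem mul_mem_pow_iff (hG : (G : MvPowerSeries (Fin 3) ℂ).order = 2) (k : ℕ)
    (f : MvPolynomial (Fin 3) ℂ) :
    G * f ∈ idealOfVars (Fin 3) ℂ ^ (k + 2) ↔ f ∈ idealOfVars (Fin 3) ℂ ^ k := by
  rw [mem_pow_iff_order, mem_pow_iff_order, coe_mul, MvPowerSeries.order_mul, hG, add_comm 2]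
  push_cast
  exact ENat.add_le_add_iff_right (by exact ENat.natCast_ne_top 2)

theorem ker_comp_eq_idealOfVars (hev : ∀ i, ev (ψ (X i)) = 0) :
    RingHom.ker (ev.comp ψ) = idealOfVars (Fin 3) ℂ := by
  have h : ev.comp ψ = aeval (0 : Fin 3 → ℂ) := by ext i; simp [hev]
  ext f
  rw [h, ← pow_one (idealOfVars (Fin 3) ℂ), mem_pow_idealOfVars_iff', RingHom.mem_ker,
    aeval_zero]
  simp [Finsupp.degree_eq_zero_iff, constantCoeff_eq]

theorem ker_eq_map (hψ : Function.Surjective ψ) (hev : ∀ i, ev (ψ (X i)) = 0) :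
    RingHom.ker ev = (idealOfVars (Fin 3) ℂ).map ψ := by
  rw [← ker_comp_eq_idealOfVars hev]
  apply le_antisymm
  · intro x hx
    obtain ⟨f, rfl⟩ := hψ x
    exact Ideal.mem_map_of_mem _ hx
  · rw [Ideal.map_le_iff_le_comap]
    exact fun f hf => hf

theorem map_mem_ker_pow_iff (hψ : Function.Surjective ψ) (hker : RingHom.ker ψ = Ideal.span {G})
    (hev : ∀ i, ev (ψ (X i)) = 0) (k : ℕ) (f : MvPolynomial (Fin 3) ℂ) :
    ψ f ∈ RingHom.ker ev ^ k ↔ ∃ g, f - G * g ∈ idealOfVars (Fin 3) ℂ ^ k := by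
  rw [ker_eq_map hψ hev, ← Ideal.map_pow, ← Ideal.mem_comap, Ideal.comap_map_of_surjective' _ hψ,
    hker]
  constructor
  · intro h
    obtain ⟨a, ha, b, hb, rfl⟩ := Submodule.mem_sup.1 h
    obtain ⟨g, rfl⟩ := Ideal.mem_span_singleton'.1 hb
    exact ⟨g, by convert ha using 1; ring⟩
  · rintro ⟨g, hg⟩
    rw [← sub_add_cancel f (G * g)]
    exact add_mem (Ideal.mem_sup_left hg)
      (Ideal.mem_sup_right (Ideal.mul_mem_right _ _ (Ideal.mem_span_singleton_self G)))

/-- The projection of the truncated polynomials to the truncations of the quotient ring. -/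
def truncationMap (hψ : Function.Surjective ψ) (hev : ∀ i, ev (ψ (X i)) = 0) (k : ℕ) :
    (MvPolynomial (Fin 3) ℂ ⧸ idealOfVars (Fin 3) ℂ ^ k) →ₐ[ℂ] (B ⧸ RingHom.ker ev ^ k) :=
  Ideal.Quotient.liftₐ _ ((Ideal.Quotient.mkₐ ℂ _).comp ψ) fun f hf => by
    rw [AlgHom.comp_apply, Ideal.Quotient.mkₐ_eq_mk, Ideal.Quotient.eq_zero_iff_mem,
      ker_eq_map hψ hev, ← Ideal.map_pow]
    exact Ideal.mem_map_of_mem _ hf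

theorem truncationMap_mk (hψ : Function.Surjective ψ) (hev : ∀ i, ev (ψ (X i)) = 0) (k : ℕ)
    (f : MvPolynomial (Fin 3) ℂ) : truncationMap hψ hev k (Ideal.Quotient.mk _ f) =
      Ideal.Quotient.mk _ (ψ f) := rfl

theorem truncationMap_surjective (hψ : Function.Surjective ψ) (hev : ∀ i, ev (ψ (X i)) = 0)
    (k : ℕ) : Function.Surjective (truncationMap hψ hev k) := by
  intro x
  obtain ⟨b, rfl⟩ := Ideal.Quotient.mk_surjective x
  obtain ⟨f, rfl⟩ := hψ b
  exact ⟨Ideal.Quotient.mk _ f, rfl⟩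

theorem finite_quotient_ker_pow (hψ : Function.Surjective ψ) (hev : ∀ i, ev (ψ (X i)) = 0)
    (k : ℕ) : FiniteDimensional ℂ (B ⧸ RingHom.ker ev ^ k) :=
  Module.Finite.of_surjective (truncationMap hψ hev k).toLinearMap
    (truncationMap_surjective hψ hev k)

/-- Multiplication by `G` gives an exact sequence `0 → S/𝔪ᵏ → S/𝔪ᵏ⁺² → B/𝔫ᵏ⁺² → 0`, where `𝔪` is the
ideal of the variables and `𝔫` the kernel of `ev`. The dimension is therefore `C(k+4,3) - C(k+2,3) =
(k+2)²`. -/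
theorem finrank_quotient_ker_pow (hG : (G : MvPowerSeries (Fin 3) ℂ).order = 2)
    (hψ : Function.Surjective ψ) (hker : RingHom.ker ψ = Ideal.span {G})
    (hev : ∀ i, ev (ψ (X i)) = 0) (k : ℕ) :
    Module.finrank ℂ (B ⧸ RingHom.ker ev ^ (k + 2)) = (k + 2) ^ 2 := by
  let m : (MvPolynomial (Fin 3) ℂ ⧸ idealOfVars (Fin 3) ℂ ^ k) →ₗ[ℂ]
      (MvPolynomial (Fin 3) ℂ ⧸ idealOfVars (Fin 3) ℂ ^ (k + 2)) :=
    (Submodule.mapQ (idealOfVars (Fin 3) ℂ ^ k) (idealOfVars (Fin 3) ℂ ^ (k + 2))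
      (LinearMap.mulLeft (MvPolynomial (Fin 3) ℂ) G)
      (fun f hf => (mul_mem_pow_iff hG k f).2 hf)).restrictScalars ℂ
  have hm : ∀ f, m (Ideal.Quotient.mk _ f) = Ideal.Quotient.mk _ (G * f) := fun f => rfl
  have hinj : Function.Injective m := by
    rw [injective_iff_map_eq_zero]
    intro x hx
    obtain ⟨f, rfl⟩ := Ideal.Quotient.mk_surjective x
    rw [hm, Ideal.Quotient.eq_zero_iff_mem, mul_mem_pow_iff hG] at hx
    rwa [Ideal.Quotient.eq_zero_iff_mem]
  have hexact : LinearMap.range m = LinearMap.ker (truncationMap hψ hev (k + 2)).toLinearMap := by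
    ext x
    obtain ⟨f, rfl⟩ := Ideal.Quotient.mk_surjective x
    rw [LinearMap.mem_ker, AlgHom.toLinearMap_apply, truncationMap_mk,
      Ideal.Quotient.eq_zero_iff_mem, map_mem_ker_pow_iff hψ hker hev, LinearMap.mem_range]
    constructor
    · rintro ⟨y, hy⟩
      obtain ⟨g, rfl⟩ := Ideal.Quotient.mk_surjective y
      rw [hm, eq_comm, Ideal.Quotient.eq] at hy
      exact ⟨g, hy⟩
    · rintro ⟨g, hg⟩
      exact ⟨Ideal.Quotient.mk _ g, by rw [hm, eq_comm, Ideal.Quotient.eq]; exact hg⟩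
  have h1 := LinearMap.finrank_range_add_finrank_ker (truncationMap hψ hev (k + 2)).toLinearMap
  rw [LinearMap.range_eq_top.2 (truncationMap_surjective hψ hev (k + 2)), finrank_top, ← hexact,
    LinearMap.finrank_range_of_inj hinj, finrank_quotient_pow, finrank_quotient_pow] at h1
  have h2 : (k + 2 + 2).choose 3 = (k + 2) ^ 2 + (k + 2).choose 3 := by
    clear * -
    induction k with
    | zero => rfl
    | succ k ih =>
      have e1 := Nat.choose_succ_succ (k + 2 + 2) 2
      have e2 := Nat.choose_succ_succ (k + 2) 2
      have e3 : (k + 2 + 2).choose 2 = (k + 2).choose 2 + (2 * k + 5) := by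
        have a1 : (k + 2 + 2).choose 2 = (k + 3).choose 1 + (k + 3).choose 2 :=
          Nat.choose_succ_succ (k + 3) 1
        have a2 : (k + 3).choose 2 = (k + 2).choose 1 + (k + 2).choose 2 :=
          Nat.choose_succ_succ (k + 2) 1
        rw [Nat.choose_one_right] at a1 a2
        omega
      simp only [Nat.succ_eq_add_one, Nat.reduceAdd] at e1 e2
      rw [show k + 1 + 2 + 2 = k + 2 + 2 + 1 by ring, show k + 1 + 2 = k + 2 + 1 by ring, e1, e2,
        e3, ih]
      ring
  omega

variable {R : Type} [CommRing R] [Algebra B R]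

/-- Krull's height theorem gives the lower bound; the upper bound holds because a nonzero element of
the domain `ℂ[X₀, X₁, X₂]` is killed. -/
theorem ringKrullDim_eq_two (ev : B →ₐ[ℂ] ℂ) [IsLocalization.AtPrime R (RingHom.ker ev)]
    (hG : (G : MvPowerSeries (Fin 3) ℂ).order = 2) (hψ : Function.Surjective ψ)
    (hker : RingHom.ker ψ = Ideal.span {G}) : ringKrullDim R = 2 := by
  rw [IsLocalization.AtPrime.ringKrullDim_eq_height (RingHom.ker ev) R]
  have h1 := card_le_height_ker_add hψ hker ev
  rw [Set.encard_singleton, Nat.card_eq_fintype_card, Fintype.card_fin] at h1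
  have hG0 : G ≠ 0 := by
    rintro rfl
    rw [coe_zero, MvPowerSeries.order_zero] at hG
    exact ENat.natCast_ne_top 2 hG.symm
  have h2 := ringKrullDim_succ_le_of_surjective ψ.toRingHom hψ (mem_nonZeroDivisors_of_ne_zero hG0)
    (by
      change ψ G = 0
      rw [← RingHom.mem_ker, hker]
      exact Ideal.mem_span_singleton_self G)
  have h3 := Ideal.height_le_ringKrullDim_of_ne_top (isPrime_ker ev).ne_top
  rw [MvPolynomial.ringKrullDim_of_isNoetherianRing, ringKrullDim_eq_zero_of_field, zero_add,
    Nat.card_eq_fintype_card, Fintype.card_fin] at h2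
  have h4 : (((RingHom.ker ev).height + 1 : ℕ∞) : WithBot ℕ∞) ≤ ((2 + 1 : ℕ∞) : WithBot ℕ∞) := by
    refine le_trans ?_ h2
    push_cast
    gcongr
  have h5 : (RingHom.ker ev).height ≤ 2 :=
    (ENat.add_le_add_iff_right (by exact ENat.natCast_ne_top 1)).1 (WithBot.coe_le_coe.1 h4)
  have h6 : 2 ≤ (RingHom.ker ev).height :=
    (ENat.add_le_add_iff_right (by exact ENat.natCast_ne_top 1)).1 (le_trans (by norm_num) h1)
  rw [le_antisymm h5 h6]
  rfl

variable [Algebra ℂ R] [IsScalarTower ℂ B R]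

/-- The residue field of the local ring at a point is `ℂ`. -/
theorem exists_sub_mem_maximalIdeal (ev : B →ₐ[ℂ] ℂ)
    [IsLocalization.AtPrime R (RingHom.ker ev)] [IsLocalRing R] (x : R) :
    ∃ c : ℂ, x - algebraMap ℂ R c ∈ IsLocalRing.maximalIdeal R := by
  obtain ⟨b, s, rfl⟩ := IsLocalization.exists_mk'_eq (RingHom.ker ev).primeCompl x
  have hs : ev s ≠ 0 := s.2
  refine ⟨ev b / ev s, ?_⟩
  have h : IsLocalization.mk' R b s - algebraMap ℂ R (ev b / ev s) =
      IsLocalization.mk' R (b - algebraMap ℂ B (ev b / ev s) * s) s := by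
    rw [IsScalarTower.algebraMap_apply ℂ B R, eq_comm, IsLocalization.mk'_eq_iff_eq_mul, sub_mul,
      IsLocalization.mk'_spec, map_sub, map_mul]
  rw [h, IsLocalization.AtPrime.mk'_mem_maximal_iff R (RingHom.ker ev)]
  simp [RingHom.mem_ker, hs]

/-- The residue field is `ℂ`, so each composition factor contributes one dimension. -/
theorem length_eq_finrank (ev : B →ₐ[ℂ] ℂ) [IsLocalization.AtPrime R (RingHom.ker ev)]
    [IsLocalRing R] (M : Type) [AddCommGroup M] [Module R M] [Module ℂ M]
    [IsScalarTower ℂ R M] [FiniteDimensional ℂ M] : Module.length R M = Module.finrank ℂ M := by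
  have hloc : IsLocalHom (algebraMap ℂ R) := inferInstance
  have h := IsLocalRing.length_restrictScalars ℂ R M
  have hsurj : Function.Surjective
      (algebraMap (IsLocalRing.ResidueField ℂ) (IsLocalRing.ResidueField R)) := by
    intro y
    obtain ⟨x, rfl⟩ := IsLocalRing.residue_surjective y
    obtain ⟨c, hc⟩ := exists_sub_mem_maximalIdeal ev x
    refine ⟨IsLocalRing.residue ℂ c, ?_⟩
    rw [← sub_eq_zero, IsLocalRing.ResidueField.algebraMap_residue, ← map_sub,
      IsLocalRing.residue_eq_zero_iff, ← neg_sub, neg_mem_iff]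
    exact hc
  rw [Module.length_eq_of_surjective (M := IsLocalRing.ResidueField R) hsurj,
    Module.length_eq_one (IsLocalRing.ResidueField R) (IsLocalRing.ResidueField R), mul_one] at h
  rw [← h, Module.length_eq_finrank]

/-- The truncations of a local ring are those of the affine coordinate ring. -/
def quotientPowLocalEquiv (ev : B →ₐ[ℂ] ℂ) [IsLocalization.AtPrime R (RingHom.ker ev)]
    [IsLocalRing R] (hmax : (RingHom.ker ev).IsMaximal) (k : ℕ) :
    (B ⧸ RingHom.ker ev ^ k) ≃ₐ[ℂ] R ⧸ IsLocalRing.maximalIdeal R ^ k :=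
  (IsLocalization.AtPrime.equivQuotMaximalIdealPow (RingHom.ker ev) R k).restrictScalars ℂ

theorem isMaximal_ker (ev : B →ₐ[ℂ] ℂ) : (RingHom.ker ev).IsMaximal :=
  RingHom.ker_isMaximal_of_surjective ev fun c => ⟨algebraMap ℂ B c, by simp⟩

theorem finite_quotient_maximalIdeal_pow [IsLocalization.AtPrime R (RingHom.ker ev)] [IsLocalRing R]
    (hψ : Function.Surjective ψ)
    (hev : ∀ i, ev (ψ (X i)) = 0) (k : ℕ) :
    FiniteDimensional ℂ (R ⧸ IsLocalRing.maximalIdeal R ^ k) := by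
  have := finite_quotient_ker_pow hψ hev k
  exact Module.Finite.equiv (quotientPowLocalEquiv ev (isMaximal_ker ev) k).toLinearEquiv

theorem finrank_quotient_maximalIdeal_pow [IsLocalization.AtPrime R (RingHom.ker ev)] [IsLocalRing R]
   
    (hG : (G : MvPowerSeries (Fin 3) ℂ).order = 2) (hψ : Function.Surjective ψ)
    (hker : RingHom.ker ψ = Ideal.span {G}) (hev : ∀ i, ev (ψ (X i)) = 0) (k : ℕ) :
    Module.finrank ℂ (R ⧸ IsLocalRing.maximalIdeal R ^ (k + 2)) = (k + 2) ^ 2 := by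
  rw [← (quotientPowLocalEquiv ev (isMaximal_ker ev) (k + 2)).toLinearEquiv.finrank_eq,
    finrank_quotient_ker_pow hG hψ hker hev]

theorem hasMultiplicity_two [IsLocalization.AtPrime R (RingHom.ker ev)]
    (hG : (G : MvPowerSeries (Fin 3) ℂ).order = 2) (hψ : Function.Surjective ψ)
    (hker : RingHom.ker ψ = Ideal.span {G}) (hev : ∀ i, ev (ψ (X i)) = 0) :
    HasMultiplicity R 2 2 := by
  have hloc : IsLocalRing R := IsLocalization.AtPrime.isLocalRing R (RingHom.ker ev)
  refine ⟨hloc, ringKrullDim_eq_two ev hG hψ hker, (Polynomial.X + 1) ^ 2, ?_, ?_, ?_⟩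
  -- The length of `R / 𝔪ⁿ⁺¹` is `(n + 1)²`, whose leading coefficient is `1 = 2 / 2!`.
  · filter_upwards [Filter.eventually_ge_atTop 1] with n hn
    obtain ⟨k, rfl⟩ := Nat.exists_eq_add_of_le' hn
    have := finite_quotient_maximalIdeal_pow (R := R) hψ hev (k + 1 + 1)
    rw [length_eq_finrank ev, finrank_quotient_maximalIdeal_pow hG hψ hker hev k, ENat.toNat_natCast]
    simp
    ring
  · rw [show (Polynomial.X + 1 : Polynomial ℚ) = Polynomial.X + Polynomial.C 1 by simp,
      Polynomial.natDegree_pow, Polynomial.natDegree_X_add_C]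
  · rw [show (Polynomial.X + 1 : Polynomial ℚ) = Polynomial.X + Polynomial.C 1 by simp,
      Polynomial.leadingCoeff_pow, Polynomial.leadingCoeff_X_add_C]
    norm_num

/-- In a regular local ring of dimension two the maximal ideal has two generators, so `R / 𝔪²` has
dimension at most three; here it has dimension four. -/
theorem not_isRegularLocalRing [IsLocalization.AtPrime R (RingHom.ker ev)]
    (hG : (G : MvPowerSeries (Fin 3) ℂ).order = 2) (hψ : Function.Surjective ψ)
    (hker : RingHom.ker ψ = Ideal.span {G}) (hev : ∀ i, ev (ψ (X i)) = 0) :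
    ¬ IsRegularLocalRing R := by
  intro hreg
  have h1 := hreg.spanFinrank_maximalIdeal
  rw [ringKrullDim_eq_two ev hG hψ hker] at h1
  have h2 : (IsLocalRing.maximalIdeal R).spanFinrank = 2 := by exact_mod_cast h1
  have hfg : Submodule.FG (IsLocalRing.maximalIdeal R) := IsNoetherian.noetherian _
  rw [← hfg.generators_ncard] at h2
  obtain ⟨a, b, -, hab⟩ := Set.ncard_eq_two.1 h2
  have hspan : IsLocalRing.maximalIdeal R = Ideal.span {a, b} := by
    rw [← hab]; exact (Submodule.span_generators _).symm
  have := finite_quotient_maximalIdeal_pow (R := R) hψ hev 2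
  have h4 := finrank_quotient_maximalIdeal_pow (R := R) hG hψ hker hev 0
  rw [zero_add] at h4
  let T : (Fin 3 → ℂ) →ₗ[ℂ] R ⧸ IsLocalRing.maximalIdeal R ^ 2 :=
    Fintype.linearCombination ℂ ![1, Ideal.Quotient.mk _ a, Ideal.Quotient.mk _ b]
  have hT : Function.Surjective T := by
    intro y
    obtain ⟨x, rfl⟩ := Ideal.Quotient.mk_surjective y
    obtain ⟨c, hc⟩ := exists_sub_mem_maximalIdeal ev x
    have hc' := hc
    rw [hspan, Ideal.mem_span_pair] at hc'
    obtain ⟨u, v, huv⟩ := hc'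
    obtain ⟨c1, hu⟩ := exists_sub_mem_maximalIdeal ev u
    obtain ⟨c2, hv⟩ := exists_sub_mem_maximalIdeal ev v
    have ha : a ∈ IsLocalRing.maximalIdeal R := by rw [hspan]; exact Ideal.subset_span (by simp)
    have hb : b ∈ IsLocalRing.maximalIdeal R := by rw [hspan]; exact Ideal.subset_span (by simp)
    refine ⟨![c, c1, c2], ?_⟩
    have : T ![c, c1, c2] = Ideal.Quotient.mk _
        (algebraMap ℂ R c + algebraMap ℂ R c1 * a + algebraMap ℂ R c2 * b) := by
      simp only [T, Fintype.linearCombination_apply, Fin.sum_univ_three, Algebra.smul_def, map_add,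
        map_mul]
      simp
    rw [this, eq_comm, Ideal.Quotient.eq, pow_two]
    convert add_mem (Ideal.mul_mem_mul hu ha) (Ideal.mul_mem_mul hv hb) using 1
    linear_combination -huv
  have h5 := LinearMap.finrank_le_finrank_of_surjective hT
  rw [h4] at h5
  simp at h5

end Multiplicity

end TangentPlane

end

noncomputable section

namespace TangentPlane

open MvPolynomial

/-! ### Affine charts of sections of the flag variety -/

/-- The generators of the ideal of a section of the flag variety in the affine space
`xᵢ = 1`, `yⱼ = 1`. -/
def chartEquations (q : BiPoly) (i j : Fin 3) : Fin 4 → BiPoly :=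
  ![incidence, q, xv i - 1, yv j - 1]

/-- The ideal of a section of the flag variety in the affine space `xᵢ = 1`, `yⱼ = 1`. -/
def chartIdeal (q : BiPoly) (i j : Fin 3) : Ideal BiPoly :=
  Ideal.span (Set.range (chartEquations q i j))

theorem chartEquations_mem (q : BiPoly) (i j : Fin 3) (a : Fin 4) :
    chartEquations q i j a ∈ chartIdeal q i j := Ideal.subset_span ⟨a, rfl⟩

theorem chartIdeal_le {q : BiPoly} {i j : Fin 3} {I : Ideal BiPoly} (h₁ : incidence ∈ I)
    (h₂ : q ∈ I) (h₃ : xv i - 1 ∈ I) (h₄ : yv j - 1 ∈ I) : chartIdeal q i j ≤ I := by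
  rw [chartIdeal, Ideal.span_le]
  rintro _ ⟨a, rfl⟩
  fin_cases a
  exacts [h₁, h₂, h₃, h₄]

theorem span_le_chartIdeal (q : BiPoly) (i j : Fin 3) :
    Ideal.span {incidence, q} ≤ chartIdeal q i j := by
  rw [Ideal.span_le, Set.pair_subset_iff]
  exact ⟨chartEquations_mem q i j 0, chartEquations_mem q i j 1⟩

/-- Dividing the vector by `τ xᵢ` and the covector by `τ yⱼ` turns `τ` into a homomorphism `θ` that
kills the chart ideal. On a bihomogeneous polynomial `θ` and `τ` differ by a nonzero factor. -/
theorem map_eq_zero_of_mem_chartIdeal {K : Type} [Field K] [Algebra ℂ K] (τ : BiPoly →ₐ[ℂ] K)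
    {q : BiPoly} (hq : q ∈ biPart (1, 1)) (hF0 : τ incidence = 0) (hq0 : τ q = 0) {i j : Fin 3}
    (hi0 : τ (xv i) ≠ 0) (hj0 : τ (yv j) ≠ 0) {m n : ℕ} {g : BiPoly} (hg : g ∈ biPart (m, n))
    (hmem : g ∈ chartIdeal q i j) : τ g = 0 := by
  let θ : BiPoly →ₐ[ℂ] K := aeval (Sum.elim (fun k => (τ (xv i))⁻¹ * τ (X (.inl k)))
    (fun k => (τ (yv j))⁻¹ * τ (X (.inr k))))
  have hθ : ∀ {m n : ℕ} {f : BiPoly}, f ∈ biPart (m, n) →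
      θ f = (τ (xv i))⁻¹ ^ m * (τ (yv j))⁻¹ ^ n * τ f := by
    intro m n f hf
    have h := aeval_scale hf (fun s => τ (X s)) (τ (xv i))⁻¹ (τ (yv j))⁻¹
    have h2 : aeval (fun s => τ (X s)) = τ := by ext s; simp
    rwa [h2] at h
  have hker : chartIdeal q i j ≤ RingHom.ker θ := by
    refine chartIdeal_le ?_ ?_ ?_ ?_
    · rw [RingHom.mem_ker, hθ incidence_mem, hF0, mul_zero]
    · rw [RingHom.mem_ker, hθ hq, hq0, mul_zero]
    · rw [RingHom.mem_ker, map_sub, hθ (xv_mem i), map_one]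
      simp [hi0]
    · rw [RingHom.mem_ker, map_sub, hθ (yv_mem j), map_one]
      simp [hj0]
  have h0 := hker hmem
  rw [RingHom.mem_ker, hθ hg, mul_eq_zero] at h0
  refine h0.resolve_left ?_
  exact mul_ne_zero (pow_ne_zero _ (inv_ne_zero hi0)) (pow_ne_zero _ (inv_ne_zero hj0))

/-- Dehomogenizing creates no new bihomogeneous relations: the map to the fraction field of the
quotient ring is rescaled to the chart. -/
theorem mem_of_mem_chartIdeal {q : BiPoly} (hq : q ∈ biPart (1, 1))
    (hJ : (Ideal.span {incidence, q}).IsPrime) {i j : Fin 3}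
    (hi : xv i ∉ Ideal.span {incidence, q}) (hj : yv j ∉ Ideal.span {incidence, q})
    {m n : ℕ} {g : BiPoly} (hg : g ∈ biPart (m, n)) (hmem : g ∈ chartIdeal q i j) :
    g ∈ Ideal.span {incidence, q} := by
  have hτ : ∀ f, toConeFieldHom (Ideal.span {incidence, q}) f = 0 ↔
      f ∈ Ideal.span {incidence, q} := fun f => toConeField_eq_zero_iff _ f
  rw [← hτ]
  exact map_eq_zero_of_mem_chartIdeal _ hq ((hτ _).2 (Ideal.subset_span (by simp)))
    ((hτ _).2 (Ideal.subset_span (by simp))) (mt (hτ _).1 hi) (mt (hτ _).1 hj) hg hmem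

variable {B : Fin 8 → Matrix (Fin 3) (Fin 3) ℂ}

/-- The linear form `l` lifts `yⱼ xᵢ`. In the chart `xₖ = yⱼ xₖ` and `yₖ = yₖ xᵢ`, so every affine
coordinate comes from a linear form on `ℙ⁷`. -/
theorem exists_isChart (hB : SpansModOne B) {q : BiPoly} (hq : q ∈ biPart (1, 1))
    (hJ : (Ideal.span {incidence, q}).IsPrime) {i j : Fin 3}
    (hi : xv i ∉ Ideal.span {incidence, q}) (hj : yv j ∉ Ideal.span {incidence, q})
    {A : Type} [CommRing A] [Algebra ℂ A] {ψ : BiPoly →ₐ[ℂ] A} (hψ : Function.Surjective ψ)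
    (hker : RingHom.ker ψ = chartIdeal q i j) :
    ∃ l, IsChart ((Ideal.span {incidence, q}).comap (segre B)) l (ψ.comp (segre B)) := by
  have h0 : ∀ f ∈ chartIdeal q i j, ψ f = 0 := fun f hf => by rwa [← RingHom.mem_ker, hker]
  have hx : ψ (xv i) = 1 := by
    have := h0 _ (chartEquations_mem q i j 2)
    rwa [show chartEquations q i j 2 = xv i - 1 from rfl, map_sub, map_one, sub_eq_zero] at this
  have hy : ψ (yv j) = 1 := by
    have := h0 _ (chartEquations_mem q i j 3)
    rwa [show chartEquations q i j 3 = yv j - 1 from rfl, map_sub, map_one, sub_eq_zero] at this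
  have hF : Ideal.span {incidence} ≤ chartIdeal q i j :=
    (Ideal.span_mono (by simp)).trans (span_le_chartIdeal q i j)
  have key : ∀ a b, ∃ l : MvPolynomial (Fin 8) ℂ, l.IsHomogeneous 1 ∧
      ψ (segre B l) = ψ (yv a) * ψ (xv b) := by
    intro a b
    obtain ⟨l, hl, hl'⟩ := exists_linear hB (Matrix.single a b 1)
    refine ⟨l, hl, ?_⟩
    have := h0 _ (hF hl')
    rw [bilin_single, map_sub, sub_eq_zero] at this
    rw [← this, map_mul]
  obtain ⟨l, hl, hl'⟩ := key j i
  refine ⟨l, hl, ?_, ?_, ?_⟩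
  · intro a
    obtain ⟨f, rfl⟩ := hψ a
    change ψ f ∈ (ψ.comp (segre B)).range
    induction f using MvPolynomial.induction_on with
    | C c => exact ⟨C c, by simp [algHom_C]⟩
    | add f g hf hg => rw [map_add]; exact add_mem hf hg
    | mul_X f s hf =>
      rw [map_mul]
      refine mul_mem hf ?_
      rcases s with k | k
      · obtain ⟨l, -, h⟩ := key j k
        exact ⟨l, by rw [hy, one_mul] at h; exact h⟩
      · obtain ⟨l, -, h⟩ := key k i
        exact ⟨l, by rw [hx, mul_one] at h; exact h⟩
  · rw [AlgHom.comp_apply, hl', hx, hy, one_mul]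
  · intro n f hf
    rw [AlgHom.comp_apply, Ideal.mem_comap, ← RingHom.mem_ker, hker]
    exact ⟨mem_of_mem_chartIdeal hq hJ hi hj (segre_mem hf),
      fun h => span_le_chartIdeal q i j h⟩

variable (B) in
/-- The image of a pair of a vector and a covector, in homogeneous coordinates. -/
def segrePoint (x y : Fin 3 → ℂ) : Fin 8 → ℂ := fun i => y ⬝ᵥ (B i).mulVec x

theorem IsZeroOf.dotProduct_eq {q : BiPoly} {x y : Fin 3 → ℂ}
    (h : IsZeroOf (Ideal.span {incidence, q}) x y) : y ⬝ᵥ x = 0 := by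
  have := h.eval_eq_zero _ (Ideal.subset_span (Set.mem_insert _ _))
  rwa [incidence, eval_bilin, Matrix.one_mulVec] at this

theorem IsZeroOf.segrePoint_ne_zero (hB : SpansModOne B) {q : BiPoly} {x y : Fin 3 → ℂ}
    (h : IsZeroOf (Ideal.span {incidence, q}) x y) : segrePoint B x y ≠ 0 :=
  coordinates_ne_zero hB h.vec_ne_zero h.covec_ne_zero h.dotProduct_eq

theorem IsZeroOf.xv_notMem {J : Ideal BiPoly} {x y : Fin 3 → ℂ} (h : IsZeroOf J x y) {i : Fin 3}
    (hi : x i = 1) : xv i ∉ J := fun hJ => by simpa [hi] using h.eval_eq_zero _ hJ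

theorem IsZeroOf.yv_notMem {J : Ideal BiPoly} {x y : Fin 3 → ℂ} (h : IsZeroOf J x y) {j : Fin 3}
    (hj : y j = 1) : yv j ∉ J := fun hJ => by simpa [hj] using h.eval_eq_zero _ hJ

/-- The closed points of a section of the flag variety. -/
theorem exists_isZeroOf_of_mem_points (hB : SpansModOne B) {q : BiPoly} (hq : q ∈ biPart (1, 1))
    {p : ℙ ℂ (Fin 8 → ℂ)} (hp : p ∈ points ((Ideal.span {incidence, q}).comap (segre B))) :
    ∃ x y, ∃ h : IsZeroOf (Ideal.span {incidence, q}) x y, (∃ i, x i = 1) ∧ (∃ j, y j = 1) ∧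
      p = Projectivization.mk ℂ (segrePoint B x y) (h.segrePoint_ne_zero hB) := by
  induction p using Projectivization.ind with | h w hw => ?_
  have hF : Ideal.span {incidence} ≤ Ideal.span {incidence, q} := Ideal.span_mono (by simp)
  have hP : ∀ f, segre B f ∈ Ideal.span {incidence, q} → eval w f = 0 :=
    fun f hf => hp hf w hw rfl
  choose L hL hL' using fun a b => exists_linear hB (Matrix.single a b 1)
  simp only [bilin_single] at hL'
  have hmk : ∀ a b, Ideal.Quotient.mk (Ideal.span {incidence, q}) (segre B (L a b)) =
      Ideal.Quotient.mk _ (yv a * xv b) := fun a b => by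
    rw [eq_comm, Ideal.Quotient.eq]; exact hF (hL' a b)
  let W : Fin 3 → Fin 3 → ℂ := fun a b => eval w (L a b)
  have hwW : ∀ i, w i = ∑ a, ∑ b, B i a b * W a b := by
    intro i
    have := hP (X i - ∑ a, ∑ b, C (B i a b) * L a b) (by
      rw [← Ideal.Quotient.eq_zero_iff_mem, map_sub, map_sub, sub_eq_zero]
      simp only [map_sum, map_mul, hmk, algHom_C]
      rw [segre, aeval_X]
      simp only [bilin, LinearMap.coe_mk, AddHom.coe_mk, map_sum, map_mul]
      rfl)
    rw [map_sub, sub_eq_zero, eval_X] at this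
    rw [this]
    simp [W]
  -- The 2 × 2 minors vanish, so the matrix `W` is the product of a column `y` and a row `x`, read
  -- off from a nonzero entry.
  have hrank : ∀ a b c d, W a b * W c d = W a d * W c b := by
    intro a b c d
    have := hP (L a b * L c d - L a d * L c b) (by
      rw [← Ideal.Quotient.eq_zero_iff_mem]
      simp only [map_sub, map_mul, hmk]
      ring)
    rwa [map_sub, sub_eq_zero, map_mul, map_mul] at this
  obtain ⟨a, b, hab⟩ : ∃ a b, W a b ≠ 0 := by
    by_contra! h0
    exact hw (funext fun i => by rw [hwW]; simp [h0])
  let x : Fin 3 → ℂ := fun k => W a k / W a b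
  let y : Fin 3 → ℂ := fun k => W k b / W a b
  have hxb : x b = 1 := div_self hab
  have hya : y a = 1 := div_self hab
  have hWxy : ∀ c d, W c d = W a b * (y c * x d) := by
    intro c d
    simp only [x, y]
    field_simp
    linear_combination hrank a b c d
  have hwv : w = W a b • segrePoint B x y := by
    ext i
    rw [hwW]
    simp only [segrePoint, Pi.smul_apply, smul_eq_mul, dotProduct, Matrix.mulVec, Finset.mul_sum]
    refine Finset.sum_congr rfl fun c _ => Finset.sum_congr rfl fun d _ => ?_
    rw [hWxy c d]; ring
  have hx0 : x ≠ 0 := fun h0 => by rw [h0] at hxb; simp at hxb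
  have hy0 : y ≠ 0 := fun h0 => by rw [h0] at hya; simp at hya
  have hxy : y ⬝ᵥ x = 0 := by
    have := hP (∑ k, L k k) (by
      rw [← Ideal.Quotient.eq_zero_iff_mem]
      simp only [map_sum, hmk]
      rw [← map_sum, Ideal.Quotient.eq_zero_iff_mem]
      have h1 : ∑ k, yv k * xv k = incidence := by
        rw [incidence_eq, Fin.sum_univ_three]; ring
      rw [h1]
      exact Ideal.subset_span (Set.mem_insert _ _))
    rw [map_sum] at this
    change ∑ k, W k k = 0 at this
    rw [Finset.sum_congr rfl fun k _ => hWxy k k, ← Finset.mul_sum] at this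
    exact (mul_eq_zero.1 this).resolve_left hab
  have hFxy : eval (pt x y) incidence = 0 := by
    rw [incidence, eval_bilin, Matrix.one_mulVec, hxy]
  have hqxy : eval (pt x y) q = 0 := by
    obtain ⟨f, hf, hf'⟩ := exists_segre hB hq
    have h1 := hP f (by
      rw [← sub_sub_cancel q (segre B f)]
      exact sub_mem (Ideal.subset_span (by simp)) (hF hf'))
    rw [hwv] at h1
    have h2 := aeval_const_mul hf (W a b) (segrePoint B x y)
    change eval (W a b • segrePoint B x y) f = W a b ^ 1 * eval (segrePoint B x y) f at h2
    rw [h1, pow_one, eq_comm, mul_eq_zero] at h2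
    have h3 := h2.resolve_left hab
    rw [show segrePoint B x y = fun i => y ⬝ᵥ (B i).mulVec x from rfl, ← eval_segre] at h3
    obtain ⟨c, hc⟩ := Ideal.mem_span_singleton.1 hf'
    have h4 := congr(eval (pt x y) $hc)
    rw [map_sub, map_mul, hFxy, h3] at h4
    simpa using h4
  refine ⟨x, y, isZeroOf_span_pair hx0 hy0 hFxy hqxy, ⟨b, hxb⟩, ⟨a, hya⟩, ?_⟩
  rw [Projectivization.mk_eq_mk_iff']
  exact ⟨W a b, hwv.symm⟩

theorem pderiv_bilin_inl (M : Matrix (Fin 3) (Fin 3) ℂ) (x y : Fin 3 → ℂ) (k : Fin 3) :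
    eval (pt x y) (pderiv (.inl k) (bilin M)) = (M.vecMul y) k := by
  simp [bilin, xv, yv, pderiv_X, Pi.single_apply, Matrix.vecMul, dotProduct, pt, mul_comm]

theorem pderiv_bilin_inr (M : Matrix (Fin 3) (Fin 3) ℂ) (x y : Fin 3 → ℂ) (k : Fin 3) :
    eval (pt x y) (pderiv (.inr k) (bilin M)) = (M.mulVec x) k := by
  simp [bilin, xv, yv, pderiv_X, Pi.single_apply, Matrix.mulVec, dotProduct, pt, mul_comm]

/-- The gradients of the equations of a chart are independent at a point, unless the vector and the
covector are eigenvectors for the same eigenvalue. -/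
theorem linearIndependent_gradient {N : Matrix (Fin 3) (Fin 3) ℂ} {x y : Fin 3 → ℂ}
    (hxy : y ⬝ᵥ x = 0) (hN : y ⬝ᵥ N.mulVec x = 0) {i j : Fin 3} (hi : x i = 1) (hj : y j = 1)
    (hne : ∀ r : ℂ, ¬ (N.mulVec x = r • x ∧ N.vecMul y = r • y)) :
    LinearIndependent ℂ fun a t => eval (pt x y) (pderiv t (chartEquations (bilin N) i j a)) := by
  rw [Fintype.linearIndependent_iff]
  intro c hc
  have hl : ∀ k, c 0 * y k + c 1 * (N.vecMul y) k + c 2 * (if k = i then 1 else 0) = 0 := by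
    intro k
    have := congr_fun hc (.inl k)
    simp [Fin.sum_univ_four, chartEquations, incidence, pderiv_bilin_inl, xv, yv, pderiv_X,
      Pi.single_apply] at this
    simpa [apply_ite, eq_comm] using this
  have hr : ∀ k, c 0 * x k + c 1 * (N.mulVec x) k + c 3 * (if k = j then 1 else 0) = 0 := by
    intro k
    have := congr_fun hc (.inr k)
    simp [Fin.sum_univ_four, chartEquations, incidence, pderiv_bilin_inr, xv, yv, pderiv_X,
      Pi.single_apply] at this
    simpa [apply_ite, eq_comm] using this
  have hN' : N.vecMul y ⬝ᵥ x = 0 := by rw [← Matrix.dotProduct_mulVec]; exact hN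
  -- By Euler's relation, contracting with `x` kills the gradients of both bilinear equations at a
  -- point of the section, and only the equation `xᵢ = 1` contributes. The contraction with `y` does
  -- the same for `c 3`.
  have h2 : c 2 = 0 := by
    have h : ∑ k, (c 0 * y k + c 1 * (N.vecMul y) k + c 2 * (if k = i then 1 else 0)) * x k = 0 :=
      Finset.sum_eq_zero fun k _ => by rw [hl, zero_mul]
    have h' : c 0 * (y ⬝ᵥ x) + c 1 * (N.vecMul y ⬝ᵥ x) + c 2 * x i = 0 := by
      rw [← h]
      simp [dotProduct, add_mul, Finset.sum_add_distrib, Finset.mul_sum, mul_assoc]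
    simpa [hxy, hN', hi] using h'
  have h3 : c 3 = 0 := by
    have h : ∑ k, y k * (c 0 * x k + c 1 * (N.mulVec x) k + c 3 * (if k = j then 1 else 0)) = 0 :=
      Finset.sum_eq_zero fun k _ => by rw [hr, mul_zero]
    have h' : c 0 * (y ⬝ᵥ x) + c 1 * (y ⬝ᵥ N.mulVec x) + c 3 * y j = 0 := by
      rw [← h]
      simp only [dotProduct, mul_add, Finset.sum_add_distrib, Finset.mul_sum]
      congr 1
      · congr 1 <;> exact Finset.sum_congr rfl fun k _ => by ring
      · simp [mul_comm]
    simpa [hxy, hN, hj] using h'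
  -- What remains is `c₀ x + c₁ N x = 0` and `c₀ y + c₁ y N = 0`, a common eigenvalue if `c₁ ≠ 0`.
  have h1 : c 1 = 0 := by
    by_contra h1
    refine hne (-(c 0 / c 1)) ⟨funext fun k => ?_, funext fun k => ?_⟩
    · have := hr k
      rw [h3] at this
      simp only [Pi.smul_apply, smul_eq_mul]
      field_simp
      linear_combination this
    · have := hl k
      rw [h2] at this
      simp only [Pi.smul_apply, smul_eq_mul]
      field_simp
      linear_combination this
  have h0 : c 0 = 0 := by simpa [hi, h1, h3] using hr i
  intro a
  fin_cases a
  exacts [h0, h1, h2, h3]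

theorem IsZeroOf.chartIdeal_le_ker {q : BiPoly} {x y : Fin 3 → ℂ}
    (h : IsZeroOf (Ideal.span {incidence, q}) x y) {i j : Fin 3} (hi : x i = 1) (hj : y j = 1) :
    chartIdeal q i j ≤ RingHom.ker (aeval (R := ℂ) (pt x y)) := by
  refine chartIdeal_le (h.eval_eq_zero _ (Ideal.subset_span (by simp)))
    (h.eval_eq_zero _ (Ideal.subset_span (by simp))) ?_ ?_
  · change eval (pt x y) _ = 0
    simp [hi]
  · change eval (pt x y) _ = 0
    simp [hj]

theorem isRegularLocalRing_localRing (hB : SpansModOne B) {N : Matrix (Fin 3) (Fin 3) ℂ}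
    [hJ : (Ideal.span {incidence, bilin N}).IsPrime] {x y : Fin 3 → ℂ}
    (h : IsZeroOf (Ideal.span {incidence, bilin N}) x y) {i j : Fin 3} (hi : x i = 1)
    (hj : y j = 1) (hne : ∀ r : ℂ, ¬ (N.mulVec x = r • x ∧ N.vecMul y = r • y)) :
    IsRegularLocalRing (localRing ((Ideal.span {incidence, bilin N}).comap (segre B))
      (Projectivization.mk ℂ (segrePoint B x y) (h.segrePoint_ne_zero hB))) := by
  let ψ := Ideal.Quotient.mkₐ ℂ (chartIdeal (bilin N) i j)
  have hψ : Function.Surjective ψ := Ideal.Quotient.mkₐ_surjective ℂ _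
  have hker : RingHom.ker ψ = chartIdeal (bilin N) i j := Ideal.Quotient.mkₐ_ker ℂ _
  let ev : (BiPoly ⧸ chartIdeal (bilin N) i j) →ₐ[ℂ] ℂ :=
    Ideal.Quotient.liftₐ _ (aeval (pt x y)) (h.chartIdeal_le_ker hi hj)
  have hev : ∀ f, ev (ψ f) = eval (pt x y) f := fun f => rfl
  obtain ⟨l, hchart⟩ := exists_isChart hB (bilin_mem N) hJ (h.xv_notMem hi) (h.yv_notMem hj) hψ hker
  obtain ⟨ρ, hρ⟩ := hchart.exists_isLocalization (ev := ev) (v := segrePoint B x y)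
    (fun f => by rw [AlgHom.comp_apply, hev, eval_segre]; rfl) (h.segrePoint_ne_zero hB)
  let := ρ.toRingHom.toAlgebra
  refine isRegularLocalRing_of_linearIndependent hψ (s := chartEquations (bilin N) i j) hker ev ?_
  have h1 := h.eval_eq_zero _ (Ideal.subset_span (Set.mem_insert_of_mem _ rfl))
  rw [eval_bilin] at h1
  exact linearIndependent_gradient h.dotProduct_eq h1 hi hj hne

/-- The singular points of a section of the flag variety are pairs of eigenvectors for the same
eigenvalue. -/
theorem exists_eigenvectors_of_mem_singularLocus (hB : SpansModOne B)
    {N : Matrix (Fin 3) (Fin 3) ℂ} [hJ : (Ideal.span {incidence, bilin N}).IsPrime]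
    {p : ℙ ℂ (Fin 8 → ℂ)}
    (hp : p ∈ singularLocus ((Ideal.span {incidence, bilin N}).comap (segre B))) :
    ∃ x y, ∃ h : IsZeroOf (Ideal.span {incidence, bilin N}) x y,
      (∃ r : ℂ, N.mulVec x = r • x ∧ N.vecMul y = r • y) ∧ (∃ i, x i = 1) ∧ (∃ j, y j = 1) ∧
      p = Projectivization.mk ℂ (segrePoint B x y) (h.segrePoint_ne_zero hB) := by
  obtain ⟨x, y, h, ⟨i, hi⟩, ⟨j, hj⟩, rfl⟩ := exists_isZeroOf_of_mem_points hB (bilin_mem N) hp.1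
  refine ⟨x, y, h, ?_, ⟨i, hi⟩, ⟨j, hj⟩, rfl⟩
  by_contra! hne
  exact hp.2 (isRegularLocalRing_localRing hB h hi hj fun r hr => hne r hr.1 hr.2)

/-- The affine ring `A` is presented twice: by `ψ` as a chart of the section, and by `π` as a
hypersurface in 3-space with an equation of order two. -/
theorem singular_of_surjective (hB : SpansModOne B) {N : Matrix (Fin 3) (Fin 3) ℂ}
    [hJ : (Ideal.span {incidence, bilin N}).IsPrime] {x y : Fin 3 → ℂ}
    (h : IsZeroOf (Ideal.span {incidence, bilin N}) x y) {i j : Fin 3} (hi : x i = 1)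
    (hj : y j = 1) {G : MvPolynomial (Fin 3) ℂ} (hG : (G : MvPowerSeries (Fin 3) ℂ).order = 2)
    {A : Type} [CommRing A] [Algebra ℂ A] {π : MvPolynomial (Fin 3) ℂ →ₐ[ℂ] A}
    (hπ : Function.Surjective π) (hπker : RingHom.ker π = Ideal.span {G}) {ev : A →ₐ[ℂ] ℂ}
    (hevX : ∀ k, ev (π (X k)) = 0) {ψ : BiPoly →ₐ[ℂ] A} (hψ : Function.Surjective ψ)
    (hker : RingHom.ker ψ = chartIdeal (bilin N) i j) (hev : ∀ f, ev (ψ f) = eval (pt x y) f) :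
    Projectivization.mk ℂ (segrePoint B x y) (h.segrePoint_ne_zero hB) ∈
        singularLocus ((Ideal.span {incidence, bilin N}).comap (segre B)) ∧
      HasMultiplicityAt ((Ideal.span {incidence, bilin N}).comap (segre B))
        (Projectivization.mk ℂ (segrePoint B x y) (h.segrePoint_ne_zero hB)) 2 := by
  obtain ⟨l, hchart⟩ := exists_isChart hB (bilin_mem N) hJ (h.xv_notMem hi) (h.yv_notMem hj) hψ hker
  have hev' : ∀ f, ev (ψ.comp (segre B) f) = eval (segrePoint B x y) f :=
    fun f => by rw [AlgHom.comp_apply, hev, eval_segre]; rfl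
  obtain ⟨ρ, hρ⟩ := hchart.exists_isLocalization hev' (h.segrePoint_ne_zero hB)
  let := ρ.toRingHom.toAlgebra
  have htower : IsScalarTower ℂ A (localRing ((Ideal.span {incidence, bilin N}).comap (segre B))
      (Projectivization.mk ℂ (segrePoint B x y) (h.segrePoint_ne_zero hB))) :=
    IsScalarTower.of_algebraMap_eq fun c => (ρ.commutes c).symm
  refine ⟨⟨hchart.mem_points ?_ hev' _, not_isRegularLocalRing hG hπ hπker hevX⟩,
    hasMultiplicity_two hG hπ hπker hevX⟩
  exact fun f hf n => homogeneousComponent_mem_comap (bilin_mem N) hf n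

/-- A chart of a section of the flag variety that embeds it into affine space as a surface with a
double point. -/
theorem singular_of_chart (hB : SpansModOne B) {N : Matrix (Fin 3) (Fin 3) ℂ}
    [hJ : (Ideal.span {incidence, bilin N}).IsPrime] {x y : Fin 3 → ℂ}
    (h : IsZeroOf (Ideal.span {incidence, bilin N}) x y) {i j : Fin 3} (hi : x i = 1)
    (hj : y j = 1) {G : MvPolynomial (Fin 3) ℂ}
    (hG : (G : MvPowerSeries (Fin 3) ℂ).order = 2) (θ : BiPoly →ₐ[ℂ] MvPolynomial (Fin 3) ℂ)
    (ζ : MvPolynomial (Fin 3) ℂ →ₐ[ℂ] BiPoly) (hθζ : ∀ k, θ (ζ (X k)) = X k)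
    (hζθ : ∀ s, X s - ζ (θ (X s)) ∈ chartIdeal (bilin N) i j)
    (hζG : ζ G ∈ chartIdeal (bilin N) i j)
    (hθ : chartIdeal (bilin N) i j ≤ (Ideal.span {G}).comap θ)
    (h0 : ∀ s, eval 0 (θ (X s)) = pt x y s) :
    Projectivization.mk ℂ (segrePoint B x y) (h.segrePoint_ne_zero hB) ∈
        singularLocus ((Ideal.span {incidence, bilin N}).comap (segre B)) ∧
      HasMultiplicityAt ((Ideal.span {incidence, bilin N}).comap (segre B))
        (Projectivization.mk ℂ (segrePoint B x y) (h.segrePoint_ne_zero hB)) 2 := by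
  let π := Ideal.Quotient.mkₐ ℂ (Ideal.span {G})
  have hπ : Function.Surjective π := Ideal.Quotient.mkₐ_surjective ℂ _
  have hπker : RingHom.ker π = Ideal.span {G} := Ideal.Quotient.mkₐ_ker ℂ _
  have hθζ' : ∀ f, θ (ζ f) = f := by
    have : θ.comp ζ = AlgHom.id ℂ _ := by ext k : 1; exact hθζ k
    exact fun f => congr($this f)
  have hζθ' : ∀ f, f - ζ (θ f) ∈ chartIdeal (bilin N) i j := by
    have : (Ideal.Quotient.mkₐ ℂ (chartIdeal (bilin N) i j)) =
        (Ideal.Quotient.mkₐ ℂ (chartIdeal (bilin N) i j)).comp (ζ.comp θ) := by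
      ext s : 1
      exact Ideal.Quotient.eq.2 (hζθ s)
    exact fun f => Ideal.Quotient.eq.1 congr($this f)
  -- The maps `θ` and `ζ` induce inverse isomorphisms between the chart and the hypersurface `G =
  -- 0`.
  let ψ := π.comp θ
  have hψ : Function.Surjective ψ := hπ.comp fun f => ⟨ζ f, hθζ' f⟩
  have hker : RingHom.ker ψ = chartIdeal (bilin N) i j := by
    apply le_antisymm
    · intro f hf
      have hf' : θ f ∈ RingHom.ker π := hf
      rw [hπker] at hf'
      obtain ⟨a, ha⟩ := Ideal.mem_span_singleton.1 hf'
      rw [← sub_add_cancel f (ζ (θ f))]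
      refine add_mem (hζθ' f) ?_
      rw [ha, map_mul]
      exact Ideal.mul_mem_right _ _ hζG
    · intro f hf
      change θ f ∈ RingHom.ker π
      rw [hπker]
      exact hθ hf
  have hG0 : ∀ f ∈ Ideal.span {G}, aeval (R := ℂ) (0 : Fin 3 → ℂ) f = 0 := by
    intro f hf
    obtain ⟨a, rfl⟩ := Ideal.mem_span_singleton.1 hf
    have : aeval (R := ℂ) (0 : Fin 3 → ℂ) G = 0 := by
      rw [aeval_zero, constantCoeff_eq, ← coeff_coe, MvPowerSeries.coeff_of_lt_order]
      · simp
      · rw [hG]; simp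
    rw [map_mul, this, zero_mul]
  let ev : (MvPolynomial (Fin 3) ℂ ⧸ Ideal.span {G}) →ₐ[ℂ] ℂ :=
    Ideal.Quotient.liftₐ _ (aeval (R := ℂ) (0 : Fin 3 → ℂ)) hG0
  have hev : ∀ f, ev (ψ f) = eval (pt x y) f := by
    have : ev.comp ψ = aeval (pt x y) := by
      ext s
      rw [aeval_X, ← h0]
      rfl
    exact fun f => congr($this f)
  refine singular_of_surjective hB h hi hj hG hπ hπker (ev := ev) (fun k => ?_) hψ hker hev
  change aeval (R := ℂ) (0 : Fin 3 → ℂ) (X k) = 0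
  simp

end TangentPlane

end

noncomputable section

namespace TangentPlane

open MvPolynomial

variable {B : Fin 8 → Matrix (Fin 3) (Fin 3) ℂ}

/-! ### Sections with a double point -/

theorem order_eq_two {G : MvPolynomial (Fin 3) ℂ} (h : G ∈ idealOfVars (Fin 3) ℂ ^ 2)
    {d : Fin 3 →₀ ℕ} (hd : d.degree = 2) (hG : coeff d G ≠ 0) :
    (G : MvPowerSeries (Fin 3) ℂ).order = 2 := by
  refine le_antisymm ?_ (by simpa using (mem_pow_iff_order 2 G).1 h)
  have := MvPowerSeries.order_le (f := (G : MvPowerSeries (Fin 3) ℂ)) (d := d)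
    (by rwa [coeff_coe])
  rwa [hd] at this

theorem X_mul_X_mem (a b : Fin 3) :
    (X a * X b : MvPolynomial (Fin 3) ℂ) ∈ idealOfVars (Fin 3) ℂ ^ 2 := by
  rw [pow_two]
  exact Ideal.mul_mem_mul (Ideal.subset_span ⟨a, rfl⟩) (Ideal.subset_span ⟨b, rfl⟩)

theorem coeff_X_mul_X {d : Fin 3 →₀ ℕ} (a b : Fin 3) :
    coeff d (X a * X b : MvPolynomial (Fin 3) ℂ) =
      if Finsupp.single a 1 + Finsupp.single b 1 = d then 1 else 0 := by
  rw [X, X, monomial_mul, coeff_monomial, one_mul]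

theorem coeff_X_mul_X_mul_X {d : Fin 3 →₀ ℕ} (a b c : Fin 3) :
    coeff d (X a * X b * X c : MvPolynomial (Fin 3) ℂ) =
      if Finsupp.single a 1 + Finsupp.single b 1 + Finsupp.single c 1 = d then 1 else 0 := by
  rw [X, X, X, monomial_mul, monomial_mul, coeff_monomial, one_mul, one_mul]

theorem bilin_two_blocks (l : ℂ) :
    bilin !![l, 0, 0; 0, 0, 1; 0, 0, 0] = C l * (xv 0 * yv 0) + xv 2 * yv 1 := by
  simp [bilin, Fin.sum_univ_three]
  ring

theorem bilin_one_block :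
    bilin !![0, 1, 0; 0, 0, 1; 0, 0, 0] = xv 1 * yv 0 + xv 2 * yv 1 := by
  simp [bilin, Fin.sum_univ_three]
  ring

theorem isZeroOf_two_blocks (l : ℂ) :
    IsZeroOf (Ideal.span {incidence, bilin !![l, 0, 0; 0, 0, 1; 0, 0, 0]}) ![0, 1, 0] ![0, 0, 1] := by
  refine isZeroOf_span_pair (fun h => ?_) (fun h => ?_) ?_ ?_
  · simpa using congr_fun h 1
  · simpa using congr_fun h 2
  · simp [incidence_eq]
  · simp [bilin_two_blocks]

theorem isZeroOf_one_block :
    IsZeroOf (Ideal.span {incidence, bilin !![0, 1, 0; 0, 0, 1; 0, 0, 0]})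
      ![1, 0, 0] ![0, 0, 1] := by
  refine isZeroOf_span_pair (fun h => ?_) (fun h => ?_) ?_ ?_
  · simpa using congr_fun h 0
  · simpa using congr_fun h 2
  · simp [incidence_eq]
  · simp [bilin_one_block]

/-- In the chart `x₁ = y₂ = 1` the incidence equation gives `y₁ = -x₂ - x₀ y₀`. Substituting into `l
x₀ y₀ + x₂ y₁` yields the equation `G` in the coordinates `x₀, y₀, x₂`, with quadratic part `l x₀ y₀
- x₂²`. -/
theorem singular_two_blocks (hB : SpansModOne B) {l : ℂ} (hl : l ≠ 0)
    [hJ : (Ideal.span {incidence, bilin !![l, 0, 0; 0, 0, 1; 0, 0, 0]}).IsPrime] :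
    Projectivization.mk ℂ _ ((isZeroOf_two_blocks l).segrePoint_ne_zero hB) ∈
        singularLocus ((Ideal.span {incidence, bilin !![l, 0, 0; 0, 0, 1; 0, 0, 0]}).comap
          (segre B)) ∧
      HasMultiplicityAt ((Ideal.span {incidence, bilin !![l, 0, 0; 0, 0, 1; 0, 0, 0]}).comap
        (segre B)) (Projectivization.mk ℂ _ ((isZeroOf_two_blocks l).segrePoint_ne_zero hB)) 2 := by
  set q := bilin !![l, 0, 0; 0, 0, 1; 0, 0, 0] with hq
  have e := chartEquations_mem q 1 2
  have e0 : incidence ∈ chartIdeal q 1 2 := e 0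
  have e1 : q ∈ chartIdeal q 1 2 := e 1
  have e2 : xv 1 - 1 ∈ chartIdeal q 1 2 := e 2
  have e3 : yv 2 - 1 ∈ chartIdeal q 1 2 := e 3
  have hy1 : yv 1 + xv 2 + xv 0 * yv 0 ∈ chartIdeal q 1 2 := by
    have : yv 1 + xv 2 + xv 0 * yv 0 =
        incidence - yv 1 * (xv 1 - 1) - xv 2 * (yv 2 - 1) := by rw [incidence_eq]; ring
    rw [this]
    exact sub_mem (sub_mem e0 (Ideal.mul_mem_left _ _ e2)) (Ideal.mul_mem_left _ _ e3)
  refine singular_of_chart hB (isZeroOf_two_blocks l) (i := 1) (j := 2) rfl rfl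
    (G := C l * (X 0 * X 1) - X 2 * X 2 - X 0 * X 1 * X 2) ?_
    (aeval (Sum.elim ![X 0, 1, X 2] ![X 1, - X 2 - X 0 * X 1, 1])) (aeval ![xv 0, yv 0, xv 2])
    ?_ ?_ ?_ ?_ ?_
  · refine order_eq_two (d := Finsupp.single 0 1 + Finsupp.single 1 1) ?_ (by simp) ?_
    · exact sub_mem (sub_mem (Ideal.mul_mem_left _ _ (X_mul_X_mem 0 1)) (X_mul_X_mem 2 2))
        (Ideal.mul_mem_right _ _ (X_mul_X_mem 0 1))
    · rw [coeff_sub, coeff_sub, coeff_C_mul, coeff_X_mul_X, coeff_X_mul_X, coeff_X_mul_X_mul_X,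
        if_pos rfl, if_neg, if_neg]
      · simpa using hl
      · exact fun h => by simpa using DFunLike.congr_fun h 2
      · exact fun h => by simpa using DFunLike.congr_fun h 2
  · intro k
    fin_cases k <;> simp [xv, yv]
  · rintro (s | s) <;> fin_cases s
    · simp [xv]
    · simp
      exact e2
    · simp [xv]
    · simp [yv]
    · simp
      convert hy1 using 1
      simp [xv, yv]; ring
    · simp
      exact e3
  · have : aeval ![xv 0, yv 0, xv 2] (C l * (X 0 * X 1) - X 2 * X 2 - X 0 * X 1 * X 2 :
        MvPolynomial (Fin 3) ℂ) = q - xv 2 * (yv 1 + xv 2 + xv 0 * yv 0) := by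
      rw [hq, bilin_two_blocks]
      simp [algHom_C]
      ring
    rw [this]
    exact sub_mem e1 (Ideal.mul_mem_left _ _ hy1)
  · refine chartIdeal_le ?_ ?_ ?_ ?_
    · rw [Ideal.mem_comap, incidence_eq]
      simp [xv, yv]
    · rw [Ideal.mem_comap, bilin_two_blocks, Ideal.mem_span_singleton]
      simp [xv, yv, algHom_C]
      apply dvd_of_eq
      ring
    · simp [Ideal.mem_comap, xv]
    · simp [Ideal.mem_comap, yv]
  · rintro (s | s) <;> fin_cases s <;> simp [pt]

/-- In the chart `x₀ = y₂ = 1` the incidence equation gives `x₂ = -y₀ - x₁ y₁`. Substituting into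
`x₁ y₀ + x₂ y₁` yields the equation `G` in the coordinates `x₁, y₁, y₀`, with quadratic part `y₀ (x₁
- y₁)`. -/
theorem singular_one_block (hB : SpansModOne B)
    [hJ : (Ideal.span {incidence, bilin !![0, 1, 0; 0, 0, 1; 0, 0, 0]}).IsPrime] :
    Projectivization.mk ℂ _ (isZeroOf_one_block.segrePoint_ne_zero hB) ∈
        singularLocus ((Ideal.span {incidence, bilin !![0, 1, 0; 0, 0, 1; 0, 0, 0]}).comap
          (segre B)) ∧
      HasMultiplicityAt ((Ideal.span {incidence, bilin !![0, 1, 0; 0, 0, 1; 0, 0, 0]}).comap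
        (segre B)) (Projectivization.mk ℂ _ (isZeroOf_one_block.segrePoint_ne_zero hB)) 2 := by
  set q := bilin !![0, 1, 0; 0, 0, 1; 0, 0, 0] with hq
  have e := chartEquations_mem q 0 2
  have e0 : incidence ∈ chartIdeal q 0 2 := e 0
  have e1 : q ∈ chartIdeal q 0 2 := e 1
  have e2 : xv 0 - 1 ∈ chartIdeal q 0 2 := e 2
  have e3 : yv 2 - 1 ∈ chartIdeal q 0 2 := e 3
  have hx2 : xv 2 + yv 0 + xv 1 * yv 1 ∈ chartIdeal q 0 2 := by
    have : xv 2 + yv 0 + xv 1 * yv 1 =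
        incidence - yv 0 * (xv 0 - 1) - xv 2 * (yv 2 - 1) := by rw [incidence_eq]; ring
    rw [this]
    exact sub_mem (sub_mem e0 (Ideal.mul_mem_left _ _ e2)) (Ideal.mul_mem_left _ _ e3)
  refine singular_of_chart hB isZeroOf_one_block (i := 0) (j := 2) rfl rfl
    (G := X 0 * X 2 - X 2 * X 1 - X 0 * X 1 * X 1) ?_
    (aeval (Sum.elim ![1, X 0, - X 2 - X 0 * X 1] ![X 2, X 1, 1])) (aeval ![xv 1, yv 1, yv 0])
    ?_ ?_ ?_ ?_ ?_
  · refine order_eq_two (d := Finsupp.single 0 1 + Finsupp.single 2 1) ?_ (by simp) ?_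
    · exact sub_mem (sub_mem (X_mul_X_mem 0 2) (X_mul_X_mem 2 1))
        (Ideal.mul_mem_right _ _ (X_mul_X_mem 0 1))
    · rw [coeff_sub, coeff_sub, coeff_X_mul_X, coeff_X_mul_X, coeff_X_mul_X_mul_X,
        if_pos rfl, if_neg, if_neg]
      · simp
      · exact fun h => by simpa using DFunLike.congr_fun h 1
      · exact fun h => by simpa using DFunLike.congr_fun h 1
  · intro k
    fin_cases k <;> simp [xv, yv]
  · rintro (s | s) <;> fin_cases s
    · simp
      exact e2
    · simp [xv]
    · simp
      convert hx2 using 1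
      simp [xv, yv]; ring
    · simp [yv]
    · simp [yv]
    · simp
      exact e3
  · have : aeval ![xv 1, yv 1, yv 0] (X 0 * X 2 - X 2 * X 1 - X 0 * X 1 * X 1 :
        MvPolynomial (Fin 3) ℂ) = q - yv 1 * (xv 2 + yv 0 + xv 1 * yv 1) := by
      rw [hq, bilin_one_block]
      simp
      ring
    rw [this]
    exact sub_mem e1 (Ideal.mul_mem_left _ _ hx2)
  · refine chartIdeal_le ?_ ?_ ?_ ?_
    · rw [Ideal.mem_comap, incidence_eq]
      simp [xv, yv]
    · rw [Ideal.mem_comap, bilin_one_block, Ideal.mem_span_singleton]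
      simp [xv, yv]
      apply dvd_of_eq
      ring
    · simp [Ideal.mem_comap, xv]
    · simp [Ideal.mem_comap, yv]
  · rintro (s | s) <;> fin_cases s <;> simp [pt]

theorem singularLocus_two_blocks (hB : SpansModOne B) {l : ℂ} (hl : l ≠ 0)
    [hJ : (Ideal.span {incidence, bilin !![l, 0, 0; 0, 0, 1; 0, 0, 0]}).IsPrime] :
    singularLocus ((Ideal.span {incidence, bilin !![l, 0, 0; 0, 0, 1; 0, 0, 0]}).comap
      (segre B)) =
      {Projectivization.mk ℂ _ ((isZeroOf_two_blocks l).segrePoint_ne_zero hB)} := by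
  refine Set.Subset.antisymm (fun p hp => ?_) (Set.singleton_subset_iff.2 (singular_two_blocks hB hl).1)
  obtain ⟨x, y, h, ⟨r, hx, hy⟩, ⟨i, hi⟩, ⟨j, hj⟩, rfl⟩ :=
    exists_eigenvectors_of_mem_singularLocus hB hp
  have hxy := h.dotProduct_eq
  simp [funext_iff, Fin.forall_fin_succ, dotProduct, Fin.sum_univ_three, Matrix.vecHead,
    Matrix.vecTail] at hx hy hxy
  obtain ⟨hx0, hx1, hx2⟩ := hx
  obtain ⟨hy0, hy1, hy2⟩ := hy
  -- For a nonzero eigenvalue both eigenvectors are multiples of the first unit vector, and their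
  -- pairing is not zero.
  have hr : r = 0 := by
    by_contra hr
    have a2 : x 2 = 0 := hx2.resolve_left hr
    have a1 : x 1 = 0 := by rw [a2] at hx1; exact (mul_eq_zero.1 hx1.symm).resolve_left hr
    have b1 : y 1 = 0 := hy1.resolve_left hr
    have b2 : y 2 = 0 := by rw [b1] at hy2; exact (mul_eq_zero.1 hy2.symm).resolve_left hr
    rw [a1, a2] at hxy
    simp at hxy
    rcases hxy with b0 | a0
    · apply h.covec_ne_zero
      funext k; fin_cases k <;> simp [*]
    · apply h.vec_ne_zero
      funext k; fin_cases k <;> simp [*]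
  subst hr
  simp [hl] at hx0 hx1 hy0 hy2
  have hxe : x = ![0, 1, 0] := by
    have : x 1 = 1 := by
      fin_cases i
      · simp [hx0] at hi
      · exact hi
      · simp [hx1] at hi
    funext k; fin_cases k <;> simp [*]
  have hye : y = ![0, 0, 1] := by
    have : y 2 = 1 := by
      fin_cases j
      · simp [hy0] at hj
      · simp [hy2] at hj
      · exact hj
    funext k; fin_cases k <;> simp [*]
  subst hxe hye
  rfl

theorem singularLocus_one_block (hB : SpansModOne B)
    [hJ : (Ideal.span {incidence, bilin !![0, 1, 0; 0, 0, 1; 0, 0, 0]}).IsPrime] :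
    singularLocus ((Ideal.span {incidence, bilin !![0, 1, 0; 0, 0, 1; 0, 0, 0]}).comap
      (segre B)) =
      {Projectivization.mk ℂ _ (isZeroOf_one_block.segrePoint_ne_zero hB)} := by
  refine Set.Subset.antisymm (fun p hp => ?_) (Set.singleton_subset_iff.2 (singular_one_block hB).1)
  obtain ⟨x, y, h, ⟨r, hx, hy⟩, ⟨i, hi⟩, ⟨j, hj⟩, rfl⟩ :=
    exists_eigenvectors_of_mem_singularLocus hB hp
  simp [funext_iff, Fin.forall_fin_succ, dotProduct, Fin.sum_univ_three, Matrix.vecHead,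
    Matrix.vecTail] at hx hy
  obtain ⟨hx0, hx1, hx2⟩ := hx
  obtain ⟨hy0, hy1, hy2⟩ := hy
  have hr : r = 0 := by
    by_contra hr
    have a2 : x 2 = 0 := hx2.resolve_left hr
    have a1 : x 1 = 0 := by rw [a2] at hx1; exact (mul_eq_zero.1 hx1.symm).resolve_left hr
    have a0 : x 0 = 0 := by rw [a1] at hx0; exact (mul_eq_zero.1 hx0.symm).resolve_left hr
    apply h.vec_ne_zero
    funext k; fin_cases k <;> simp [*]
  subst hr
  simp at hx0 hx1 hy1 hy2
  have hxe : x = ![1, 0, 0] := by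
    have : x 0 = 1 := by
      fin_cases i
      · exact hi
      · simp [hx0] at hi
      · simp [hx1] at hi
    funext k; fin_cases k <;> simp [*]
  have hye : y = ![0, 0, 1] := by
    have : y 2 = 1 := by
      fin_cases j
      · simp [hy1] at hj
      · simp [hy2] at hj
      · exact hj
    funext k; fin_cases k <;> simp [*]
  subst hxe hye
  rfl

/-- For three distinct eigenvalues, right and left eigenvectors with the same eigenvalue are
multiples of the same unit vector, so their pairing is not zero. -/
theorem singularLocus_diagonal (hB : SpansModOne B) {l m : ℂ} (hl : l ≠ 0) (hm : m ≠ 0)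
    (hlm : l ≠ m) [hJ : (Ideal.span {incidence, bilin !![l, 0, 0; 0, m, 0; 0, 0, 0]}).IsPrime] :
    singularLocus ((Ideal.span {incidence, bilin !![l, 0, 0; 0, m, 0; 0, 0, 0]}).comap
      (segre B)) = ∅ := by
  rw [Set.eq_empty_iff_forall_notMem]
  intro p hp
  obtain ⟨x, y, h, ⟨r, hx, hy⟩, -⟩ := exists_eigenvectors_of_mem_singularLocus hB hp
  have hxy := h.dotProduct_eq
  have key : ∀ z : Fin 3 → ℂ, z ≠ 0 → l * z 0 = r * z 0 → m * z 1 = r * z 1 → r = 0 ∨ z 2 = 0 →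
      (r = l ∧ z 0 ≠ 0 ∧ z 1 = 0 ∧ z 2 = 0) ∨ (r = m ∧ z 0 = 0 ∧ z 1 ≠ 0 ∧ z 2 = 0) ∨
        (r = 0 ∧ z 0 = 0 ∧ z 1 = 0 ∧ z 2 ≠ 0) := by
    intro z hz h0 h1 h2
    have hz' : z 0 ≠ 0 ∨ z 1 ≠ 0 ∨ z 2 ≠ 0 := by
      by_contra! h
      exact hz (funext fun k => by fin_cases k <;> simp [h.1, h.2.1, h.2.2])
    have h0' : l = r ∨ z 0 = 0 := mul_eq_mul_right_iff.1 h0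
    have h1' : m = r ∨ z 1 = 0 := mul_eq_mul_right_iff.1 h1
    grind
  simp [funext_iff, Fin.forall_fin_succ, dotProduct, Fin.sum_univ_three, Matrix.vecHead,
    Matrix.vecTail] at hx hy hxy
  have k1 := key x h.vec_ne_zero (mul_eq_mul_right_iff.2 hx.1) (mul_eq_mul_right_iff.2 hx.2.1)
    hx.2.2
  have k2 := key y h.covec_ne_zero (by linear_combination hy.1) (by linear_combination hy.2.1)
    (by tauto)
  have : y 0 * x 0 ≠ 0 ∨ y 1 * x 1 ≠ 0 ∨ y 2 * x 2 ≠ 0 := by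
    grind
  grind

/-! ### Reducible sections -/

theorem span_inf_span_le {s t : Fin 3 ⊕ Fin 3}
    (hst : (X s : BiPoly) ∉ Ideal.span {incidence, (X t : BiPoly)}) :
    Ideal.span {incidence, (X s : BiPoly)} ⊓ Ideal.span {incidence, (X t : BiPoly)} ≤
      Ideal.span {incidence, (X t * X s : BiPoly)} := by
  rintro g ⟨hs, ht⟩
  obtain ⟨a, b, rfl⟩ := Ideal.mem_span_pair.1 hs
  have hF : incidence ∈ Ideal.span {incidence, (X t : BiPoly)} := Ideal.subset_span (by simp)
  have h1 := (Submodule.add_mem_iff_right _ (Ideal.mul_mem_left _ a hF)).1 ht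
  have h2 := ((isPrime_span_incidence_X t).mem_or_mem h1).resolve_right hst
  obtain ⟨c, d, rfl⟩ := Ideal.mem_span_pair.1 h2
  exact Ideal.mem_span_pair.2 ⟨a + c * X s, d, by ring⟩

theorem isZeroOf_X {s : Fin 3 ⊕ Fin 3} {a b : Fin 3} (hab : a ≠ b) (ha : s ≠ .inl a)
    (hb : s ≠ .inr b) :
    IsZeroOf (Ideal.span {incidence, (X s : BiPoly)}) (Pi.single a 1) (Pi.single b 1) := by
  refine isZeroOf_span_pair (by simp) (by simp) ?_ ?_
  · rw [incidence, eval_bilin, Matrix.one_mulVec, single_dotProduct, Pi.single_eq_of_ne hab.symm,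
      mul_zero]
  · rcases s with s | s
    · have : s ≠ a := fun h => ha (by rw [h])
      simp [pt, this]
    · have : s ≠ b := fun h => hb (by rw [h])
      simp [pt, this]

/-- The section by a hyperplane `yⱼ x₂ = 0` is a union of two cubic surfaces. -/
theorem saturation_reducible (hB : SpansModOne B) {i j k : Fin 3} (hi2 : i ≠ 2) (hij : i ≠ j)
    (hk2 : k ≠ 2) (hkj : k ≠ j) :
    saturation ((Ideal.span {incidence, (X (.inr j) * X (.inl 2) : BiPoly)}).comap (segre B)) =
        (Ideal.span {incidence, (X (.inl 2) : BiPoly)}).comap (segre B) ⊓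
          (Ideal.span {incidence, (X (.inr j) : BiPoly)}).comap (segre B) ∧
      ¬ (Ideal.span {incidence, (X (.inl 2) : BiPoly)}).comap (segre B) ≤
          (Ideal.span {incidence, (X (.inr j) : BiPoly)}).comap (segre B) ∧
      ¬ (Ideal.span {incidence, (X (.inr j) : BiPoly)}).comap (segre B) ≤
          (Ideal.span {incidence, (X (.inl 2) : BiPoly)}).comap (segre B) := by
  -- Each point lies on one component. It shows that the prime of this component omits a coordinate,
  -- and also that the other component does not contain it.
  have z1 : IsZeroOf (Ideal.span {incidence, (X (.inl 2) : BiPoly)}) (Pi.single k 1)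
      (Pi.single j 1) := isZeroOf_X hkj (by simpa using hk2.symm) (by simp)
  have z2 : IsZeroOf (Ideal.span {incidence, (X (.inr j) : BiPoly)}) (Pi.single 2 1)
      (Pi.single i 1) := isZeroOf_X hi2.symm (by simp) (by simpa using hij.symm)
  have p1 := isPrime_span_incidence_X (.inl 2)
  have p2 := isPrime_span_incidence_X (.inr j)
  have hF : ∀ s, incidence ∈ Ideal.span {incidence, (X s : BiPoly)} :=
    fun s => Ideal.subset_span (by simp)
  have hF' : ∀ s, Ideal.span {incidence} ≤ Ideal.span {incidence, (X s : BiPoly)} :=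
    fun s => Ideal.span_mono (by simp)
  have hs : ∀ s, (X s : BiPoly) ∈ Ideal.span {incidence, (X s : BiPoly)} :=
    fun s => Ideal.subset_span (by simp)
  -- Only diagonal bidegrees come from `ℙ⁷`, so the linear equation of a component is multiplied by
  -- a coordinate of the other kind that is nonzero at the point.
  have sep : ∀ (a b : Fin 3) (s t : Fin 3 ⊕ Fin 3) (x y : Fin 3 → ℂ),
      IsZeroOf (Ideal.span {incidence, (X t : BiPoly)}) x y → y a * x b ≠ 0 →
      yv a * xv b ∈ Ideal.span {incidence, (X s : BiPoly)} →
      ¬ (Ideal.span {incidence, (X s : BiPoly)}).comap (segre B) ≤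
          (Ideal.span {incidence, (X t : BiPoly)}).comap (segre B) := by
    intro a b s t x y hz hab hmem hle
    obtain ⟨l, -, hl⟩ := exists_linear hB (Matrix.single a b 1)
    rw [bilin_single] at hl
    have h1 : segre B l ∈ Ideal.span {incidence, (X s : BiPoly)} := by
      rw [← sub_sub_cancel (yv a * xv b) (segre B l)]
      exact sub_mem hmem (hF' s hl)
    have h2 : segre B l ∈ Ideal.span {incidence, (X t : BiPoly)} := hle h1
    have h3 := add_mem (hF' t hl) h2
    rw [sub_add_cancel] at h3
    apply hab
    simpa using hz.eval_eq_zero _ h3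
  refine ⟨le_antisymm (le_inf ?_ ?_) ?_, ?_, ?_⟩
  · obtain ⟨n, hn⟩ := exists_X_notMem hB (hF _) z1
    refine saturation_le (Ideal.comap_isPrime _ _) (Ideal.comap_mono ?_) hn
    rw [Ideal.span_le, Set.pair_subset_iff]
    exact ⟨hF _, Ideal.mul_mem_left _ _ (hs _)⟩
  · obtain ⟨n, hn⟩ := exists_X_notMem hB (hF _) z2
    refine saturation_le (Ideal.comap_isPrime _ _) (Ideal.comap_mono ?_) hn
    rw [Ideal.span_le, Set.pair_subset_iff]
    exact ⟨hF _, Ideal.mul_mem_right _ _ (hs _)⟩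
  · refine le_trans ?_ (le_saturation _)
    rw [← Ideal.comap_inf]
    refine Ideal.comap_mono (span_inf_span_le fun h => ?_)
    simpa [pt] using z2.eval_eq_zero _ h
  · exact sep i 2 _ _ _ _ z2 (by simp) (Ideal.mul_mem_left _ _ (hs _))
  · exact sep j k _ _ _ _ z1 (by simp) (Ideal.mul_mem_right _ _ (hs _))

end TangentPlane

end

noncomputable section

namespace TangentPlane

open MvPolynomial

/-! ### Differential forms of degree two on a field -/

section Forms

variable {K : Type} [Field K] [Algebra ℂ K]

/-- The exterior product of two differential forms of degree one. -/
def wedge (a b : Ω[K⁄ℂ]) : TwoForms K := exteriorPower.ιMulti K 2 ![a, b]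

theorem wedgeD_eq (a b : K) :
    wedgeD a b = wedge (KaehlerDifferential.D ℂ K a) (KaehlerDifferential.D ℂ K b) := rfl

theorem wedge_add_left (a a' b : Ω[K⁄ℂ]) : wedge (a + a') b = wedge a b + wedge a' b :=
  (exteriorPower.ιMulti K 2 (M := Ω[K⁄ℂ])).toMultilinearMap.cons_add ![b] a a'

theorem wedge_smul_left (c : K) (a b : Ω[K⁄ℂ]) : wedge (c • a) b = c • wedge a b :=
  (exteriorPower.ιMulti K 2 (M := Ω[K⁄ℂ])).toMultilinearMap.cons_smul ![b] c a

theorem wedge_self (a : Ω[K⁄ℂ]) : wedge a a = 0 :=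
  (exteriorPower.ιMulti K 2).map_eq_zero_of_eq ![a, a] (i := 0) (j := 1) rfl (by decide)

theorem wedge_swap (a b : Ω[K⁄ℂ]) : wedge a b = - wedge b a := by
  have h := (exteriorPower.ιMulti K 2).map_swap ![b, a] (i := 0) (j := 1) (by decide)
  rw [wedge, wedge, ← h]
  congr 1
  funext k
  fin_cases k <;> rfl

theorem wedge_add_right (a b b' : Ω[K⁄ℂ]) : wedge a (b + b') = wedge a b + wedge a b' := by
  rw [wedge_swap, wedge_add_left, neg_add, ← wedge_swap, ← wedge_swap]

theorem wedge_smul_right (c : K) (a b : Ω[K⁄ℂ]) : wedge a (c • b) = c • wedge a b := by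
  rw [wedge_swap, wedge_smul_left, wedge_swap a b]
  module

theorem wedge_neg_left (a b : Ω[K⁄ℂ]) : wedge (- a) b = - wedge a b := by
  rw [← neg_one_smul K a, wedge_smul_left]
  module

theorem wedge_neg_right (a b : Ω[K⁄ℂ]) : wedge a (- b) = - wedge a b := by
  rw [wedge_swap, wedge_neg_left, ← wedge_swap]

/-- If the elements of `R` are fractions of polynomials in `u` and `v`, then the regular 2-forms
are the multiples of `du ∧ dv`. -/
theorem regularTwoForms_eq_span {R : Subalgebra ℂ K} {u v : K} (hu : u ∈ R) (hv : v ∈ R)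
    (hR : ∀ z ∈ R, ∃ a ∈ Algebra.adjoin ℂ {u, v}, ∃ s ∈ Algebra.adjoin ℂ {u, v},
      s ≠ 0 ∧ s⁻¹ ∈ R ∧ z * s = a) :
    regularTwoForms R = Submodule.span R {wedgeD u v} := by
  have hle : Algebra.adjoin ℂ {u, v} ≤ R := by
    rw [Algebra.adjoin_le_iff, Set.pair_subset_iff]
    exact ⟨hu, hv⟩
  have hpoly : ∀ a ∈ Algebra.adjoin ℂ {u, v}, ∃ α ∈ R, ∃ β ∈ R,
      KaehlerDifferential.D ℂ K a =
        α • KaehlerDifferential.D ℂ K u + β • KaehlerDifferential.D ℂ K v := by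
    intro a ha
    induction ha using Algebra.adjoin_induction with
    | mem x hx =>
      rcases hx with rfl | rfl
      · exact ⟨1, one_mem _, 0, zero_mem _, by simp⟩
      · exact ⟨0, zero_mem _, 1, one_mem _, by simp⟩
    | algebraMap r => exact ⟨0, zero_mem _, 0, zero_mem _, by simp⟩
    | add x y _ _ hx hy =>
      obtain ⟨α, hα, β, hβ, h⟩ := hx
      obtain ⟨γ, hγ, δ, hδ, h'⟩ := hy
      refine ⟨α + γ, add_mem hα hγ, β + δ, add_mem hβ hδ, ?_⟩
      rw [map_add, h, h']
      module
    | mul x y hx' hy' hx hy =>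
      obtain ⟨α, hα, β, hβ, h⟩ := hx
      obtain ⟨γ, hγ, δ, hδ, h'⟩ := hy
      refine ⟨x * γ + y * α, add_mem (mul_mem (hle hx') hγ) (mul_mem (hle hy') hα),
        x * δ + y * β, add_mem (mul_mem (hle hx') hδ) (mul_mem (hle hy') hβ), ?_⟩
      rw [Derivation.leibniz, h, h']
      module
  -- The quotient rule: `s dz = da - z ds`, and `s` is a unit of `R`.
  have hall : ∀ z ∈ R, ∃ α ∈ R, ∃ β ∈ R,
      KaehlerDifferential.D ℂ K z =
        α • KaehlerDifferential.D ℂ K u + β • KaehlerDifferential.D ℂ K v := by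
    intro z hz
    obtain ⟨a, ha, s, hs, hs0, hsR, h⟩ := hR z hz
    obtain ⟨α, hα, β, hβ, h1⟩ := hpoly a ha
    obtain ⟨γ, hγ, δ, hδ, h2⟩ := hpoly s hs
    refine ⟨s⁻¹ * (α - z * γ), mul_mem hsR (sub_mem hα (mul_mem hz hγ)),
      s⁻¹ * (β - z * δ), mul_mem hsR (sub_mem hβ (mul_mem hz hδ)), ?_⟩
    have h3 := Derivation.leibniz (KaehlerDifferential.D ℂ K) z s
    rw [h, h1, h2] at h3
    have h4 : s • KaehlerDifferential.D ℂ K z =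
        (α - z * γ) • KaehlerDifferential.D ℂ K u + (β - z * δ) • KaehlerDifferential.D ℂ K v := by
      rw [← sub_eq_iff_eq_add'] at h3
      rw [← h3]
      module
    rw [← inv_smul_smul₀ hs0 (KaehlerDifferential.D ℂ K z), h4]
    module
  apply le_antisymm
  · rw [regularTwoForms, Submodule.span_le]
    rintro _ ⟨a, ha, b, hb, rfl⟩
    obtain ⟨α, hα, β, hβ, h1⟩ := hall a ha
    obtain ⟨γ, hγ, δ, hδ, h2⟩ := hall b hb
    rw [SetLike.mem_coe, Submodule.mem_span_singleton]
    refine ⟨⟨α * δ - β * γ, sub_mem (mul_mem hα hδ) (mul_mem hβ hγ)⟩, ?_⟩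
    change (α * δ - β * γ) • wedgeD u v = wedgeD a b
    rw [wedgeD_eq a b, h1, h2]
    simp only [wedge_add_left, wedge_add_right, wedge_smul_left, wedge_smul_right, wedge_self,
      smul_zero, zero_add, add_zero]
    rw [wedge_swap (KaehlerDifferential.D ℂ K v), wedgeD_eq]
    module
  · rw [Submodule.span_singleton_le_iff_mem]
    exact Submodule.subset_span ⟨u, hu, v, hv, rfl⟩

/-- The logarithmic derivative. -/
def dlog (a : K) : Ω[K⁄ℂ] := a⁻¹ • KaehlerDifferential.D ℂ K a

theorem dlog_mul {a b : K} (ha : a ≠ 0) (hb : b ≠ 0) : dlog (a * b) = dlog a + dlog b := by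
  rw [dlog, dlog, dlog, Derivation.leibniz, smul_add, smul_smul, smul_smul, add_comm]
  congr 2 <;> field_simp

theorem dlog_algebraMap (c : ℂ) : dlog (algebraMap ℂ K c) = 0 := by simp [dlog]

theorem D_eq_smul_dlog {a : K} (ha : a ≠ 0) : KaehlerDifferential.D ℂ K a = a • dlog a := by
  rw [dlog, smul_inv_smul₀ ha]

theorem wedgeD_eq_smul {a b : K} (ha : a ≠ 0) (hb : b ≠ 0) :
    wedgeD a b = (a * b) • wedge (dlog a) (dlog b) := by
  rw [wedgeD_eq, D_eq_smul_dlog ha, D_eq_smul_dlog hb, wedge_smul_left, wedge_smul_right,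
    smul_smul]

/-- The form `dlog (x₁ / x₀) ∧ dlog (x₂ / x₀)` is up to sign independent of the numbering of the
coordinates. -/
theorem wedge_sub_sub (ω : Fin 3 → Ω[K⁄ℂ]) {i j k : Fin 3} (hij : i ≠ j) (hik : i ≠ k)
    (hjk : j ≠ k) : ∃ e : ℤˣ, wedge (ω k - ω i) (ω j - ω k) =
      (e : ℤ) • wedge (ω 1 - ω 0) (ω 2 - ω 0) := by
  have h10 := wedge_swap (ω 1) (ω 0)
  have h20 := wedge_swap (ω 2) (ω 0)
  have h21 := wedge_swap (ω 2) (ω 1)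
  fin_cases i <;> fin_cases j <;> fin_cases k <;>
    first | exact absurd rfl hij | exact absurd rfl hik | exact absurd rfl hjk | skip
  all_goals
    simp only [sub_eq_add_neg, wedge_add_left, wedge_add_right, wedge_neg_left, wedge_neg_right,
      wedge_self, Fin.zero_eta, Fin.mk_one, Fin.reduceFinMk, h10, h20, h21]
    first
      | (refine ⟨1, ?_⟩; simp only [Units.val_one]; module)
      | (refine ⟨-1, ?_⟩; simp only [Units.val_neg, Units.val_one]; module)

end Forms

end TangentPlane

end

noncomputable section

namespace TangentPlane

open MvPolynomial

variable {B : Fin 8 → Matrix (Fin 3) (Fin 3) ℂ}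

/-! ### The canonical sheaf of the nonsingular sections -/

/-- The affine coordinates of a chart, as rational functions. -/
theorem exists_chartCoordinates (hB : SpansModOne B) {q : BiPoly} (hq : q ∈ biPart (1, 1))
    [hJ : (Ideal.span {incidence, q}).IsPrime] {x y : Fin 3 → ℂ}
    (h : IsZeroOf (Ideal.span {incidence, q}) x y) {i j : Fin 3} (hi : x i = 1) (hj : y j = 1) :
    ∃ χ : BiPoly →ₐ[ℂ] FunctionField ((Ideal.span {incidence, q}).comap (segre B)),
      (∀ f ∈ chartIdeal q i j, χ f = 0) ∧ (∀ s, eval (pt x y) s ≠ 0 → χ s ≠ 0) ∧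
      (∀ z, z ∈ localRing ((Ideal.span {incidence, q}).comap (segre B))
          (Projectivization.mk ℂ (segrePoint B x y) (h.segrePoint_ne_zero hB)) ↔
        ∃ a s, eval (pt x y) s ≠ 0 ∧ z * χ s = χ a) ∧
      ∀ (n : ℕ) (f g : MvPolynomial (Fin 8) ℂ), f.IsHomogeneous n → g.IsHomogeneous n →
        g ∉ (Ideal.span {incidence, q}).comap (segre B) →
        ∀ c, IsFraction ((Ideal.span {incidence, q}).comap (segre B)) c f g →
          χ (segre B g) ≠ 0 ∧ c * χ (segre B g) = χ (segre B f) := by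
  let ψ := Ideal.Quotient.mkₐ ℂ (chartIdeal q i j)
  have hψ : Function.Surjective ψ := Ideal.Quotient.mkₐ_surjective ℂ _
  have hker : RingHom.ker ψ = chartIdeal q i j := Ideal.Quotient.mkₐ_ker ℂ _
  let ev : (BiPoly ⧸ chartIdeal q i j) →ₐ[ℂ] ℂ :=
    Ideal.Quotient.liftₐ _ (aeval (pt x y)) (h.chartIdeal_le_ker hi hj)
  have hev : ∀ f, ev (ψ f) = eval (pt x y) f := fun f => rfl
  obtain ⟨l, hchart⟩ := exists_isChart hB hq hJ (h.xv_notMem hi) (h.yv_notMem hj) hψ hker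
  obtain ⟨κ, hκ, hκ'⟩ := hchart.exists_embedding
  have hmem := hchart.mem_localRing_iff (ev := ev) (v := segrePoint B x y)
    (fun f => by rw [AlgHom.comp_apply, hev, eval_segre]; rfl) (h.segrePoint_ne_zero hB) hκ hκ'
  refine ⟨κ.comp ψ, ?_, ?_, ?_, ?_⟩
  · intro f hf
    rw [← hker, RingHom.mem_ker] at hf
    rw [AlgHom.comp_apply, hf, map_zero]
  · intro s hs h0
    rw [AlgHom.comp_apply, map_eq_zero_iff κ hκ] at h0
    rw [← hev, h0, map_zero] at hs
    exact hs rfl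
  · intro z
    rw [hmem]
    constructor
    · rintro ⟨a, s, hs, hz⟩
      obtain ⟨a, rfl⟩ := hψ a
      obtain ⟨s, rfl⟩ := hψ s
      exact ⟨a, s, hs, hz⟩
    · rintro ⟨a, s, hs, hz⟩
      exact ⟨ψ a, ψ s, hs, hz⟩
  · intro n f g hf hg hgP c hc
    have hg0 : toConeField _ g ≠ 0 := mt (toConeField_eq_zero_iff _ g).1 hgP
    have hl0 := mt (toConeField_eq_zero_iff _ l).1 hchart.notMem
    have e : ∀ f, (κ.comp ψ) (segre B f) =
        dehom _ l hchart.isHomogeneous hchart.notMem f := fun f => hκ' f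
    rw [e, e]
    constructor
    · rwa [Ne, dehom_eq_zero_iff _ _ hg]
    · apply incl_injective
      rw [map_mul, incl_dehom _ _ hg, incl_dehom _ _ hf, hc.2]
      field_simp

/-- The constants `xₖ yₖ / (x₀ y₀)` of a nonsingular section. -/
def ratios (l m : ℂ) : Fin 3 → ℂ := ![1, -(l / m), l / m - 1]

theorem ratios_ne_zero {l m : ℂ} (hl : l ≠ 0) (hm : m ≠ 0) (hlm : l ≠ m) (k : Fin 3) :
    ratios l m k ≠ 0 := by
  fin_cases k
  · exact one_ne_zero
  · exact neg_ne_zero.2 (div_ne_zero hl hm)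
  · refine sub_ne_zero.2 fun h => hlm ?_
    rwa [div_eq_one_iff_eq hm] at h

theorem bilin_diagonal (l m : ℂ) : bilin !![l, 0, 0; 0, m, 0; 0, 0, 0] =
    C l * (xv 0 * yv 0) + C m * (xv 1 * yv 1) := by
  simp [bilin, Fin.sum_univ_three]
  ring

/-- The two equations of the section are linear in the three products `xₖ yₖ`, which are therefore
determined by `x₀ y₀`. -/
theorem map_xv_mul_yv {A : Type} [CommRing A] [Algebra ℂ A] {l m : ℂ} (hm : m ≠ 0)
    (χ : BiPoly →ₐ[ℂ] A) (h₁ : χ incidence = 0)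
    (h₂ : χ (bilin !![l, 0, 0; 0, m, 0; 0, 0, 0]) = 0) (k : Fin 3) :
    χ (xv k) * χ (yv k) = algebraMap ℂ A (ratios l m k) * (χ (xv 0) * χ (yv 0)) := by
  rw [bilin_diagonal, map_add, map_mul, map_mul, map_mul, map_mul, algHom_C, algHom_C] at h₂
  rw [incidence_eq] at h₁
  simp only [map_add, map_mul] at h₁
  have h₃ : χ (xv 1) * χ (yv 1) = algebraMap ℂ A (-(l / m)) * (χ (xv 0) * χ (yv 0)) := by
    have e : algebraMap ℂ A m⁻¹ * algebraMap ℂ A m = 1 := by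
      rw [← map_mul, inv_mul_cancel₀ hm, map_one]
    rw [div_eq_mul_inv, map_neg, map_mul]
    linear_combination algebraMap ℂ A m⁻¹ * h₂ - (χ (xv 1) * χ (yv 1)) * e
  fin_cases k
  · simp [ratios]
  · exact h₃
  · change χ (xv 2) * χ (yv 2) = algebraMap ℂ A (l / m - 1) * (χ (xv 0) * χ (yv 0))
    rw [map_neg] at h₃
    rw [map_sub, map_one]
    linear_combination h₁ - h₃

/-- The charts with `i ≠ j` suffice: if `xᵢ yᵢ ≠ 0`, all products `xₖ yₖ` are nonzero, and `y` can
be rescaled to have the entry one at another index. -/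
theorem exists_distinct_indices (hB : SpansModOne B) {l m : ℂ} (hl : l ≠ 0) (hm : m ≠ 0)
    (hlm : l ≠ m) {p : ℙ ℂ (Fin 8 → ℂ)}
    (hp : p ∈ points ((Ideal.span {incidence, bilin !![l, 0, 0; 0, m, 0; 0, 0, 0]}).comap
      (segre B))) :
    ∃ x y, ∃ h : IsZeroOf (Ideal.span {incidence, bilin !![l, 0, 0; 0, m, 0; 0, 0, 0]}) x y,
      (∃ i j, i ≠ j ∧ x i = 1 ∧ y j = 1) ∧
      p = Projectivization.mk ℂ (segrePoint B x y) (h.segrePoint_ne_zero hB) := by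
  obtain ⟨x, y, h, ⟨i, hi⟩, ⟨j, hj⟩, rfl⟩ := exists_isZeroOf_of_mem_points hB (bilin_mem _) hp
  by_cases hij : i = j
  · subst hij
    have hF : eval (pt x y) incidence = 0 := h.eval_eq_zero _ (Ideal.subset_span (by simp))
    have hq : eval (pt x y) (bilin !![l, 0, 0; 0, m, 0; 0, 0, 0]) = 0 :=
      h.eval_eq_zero _ (Ideal.subset_span (by simp))
    have hk : ∀ k, x k * y k = ratios l m k * (x 0 * y 0) := fun k => by
      have := map_xv_mul_yv hm (aeval (R := ℂ) (pt x y)) hF hq k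
      change eval (pt x y) _ * eval (pt x y) _ = _ * (eval (pt x y) _ * eval (pt x y) _) at this
      simpa using this
    have h0 : x 0 * y 0 ≠ 0 := by
      intro h0
      have := hk i
      rw [h0, hi, hj] at this
      simp at this
    obtain ⟨j, hij⟩ : ∃ j, i ≠ j := ⟨i + 1, by fin_cases i <;> decide⟩
    have hyj : y j ≠ 0 := by
      intro hy
      have := hk j
      rw [hy, mul_zero, eq_comm, mul_eq_zero] at this
      exact this.elim (ratios_ne_zero hl hm hlm j) h0
    have hF' : eval (pt x ((y j)⁻¹ • y)) incidence = 0 := by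
      rw [incidence, eval_bilin] at hF ⊢
      rw [smul_dotProduct, hF, smul_zero]
    have hq' : eval (pt x ((y j)⁻¹ • y)) (bilin !![l, 0, 0; 0, m, 0; 0, 0, 0]) = 0 := by
      rw [eval_bilin] at hq ⊢
      rw [smul_dotProduct, hq, smul_zero]
    refine ⟨x, (y j)⁻¹ • y, isZeroOf_span_pair h.vec_ne_zero
      (smul_ne_zero (inv_ne_zero hyj) h.covec_ne_zero) hF' hq', ⟨i, j, hij, hi, ?_⟩, ?_⟩
    · simp [hyj]
    · rw [Projectivization.mk_eq_mk_iff']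
      refine ⟨y j, ?_⟩
      funext a
      simp [segrePoint, hyj]
  · exact ⟨x, y, h, ⟨i, j, hij, hi, hj⟩, rfl⟩

theorem isZeroOf_diagonal {l m : ℂ} (hm : m ≠ 0) :
    IsZeroOf (Ideal.span {incidence, bilin !![l, 0, 0; 0, m, 0; 0, 0, 0]}) 1 (ratios l m) := by
  refine isZeroOf_span_pair one_ne_zero (fun h => one_ne_zero (congr_fun h 0)) ?_ ?_
  · simp [incidence_eq, ratios]
    ring
  · simp [bilin_diagonal, ratios]
    field_simp
    ring

/-- The regular 2-forms in a chart of a nonsingular section are generated by a multiple of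
`dlog (x₁ / x₀) ∧ dlog (x₂ / x₀)`. -/
theorem regularTwoForms_eq_span_wedge_dlog {K : Type} [Field K] [Algebra ℂ K] {l m : ℂ}
    (hl : l ≠ 0) (hm : m ≠ 0) (hlm : l ≠ m) (χ : BiPoly →ₐ[ℂ] K) (h₁ : χ incidence = 0)
    (h₂ : χ (bilin !![l, 0, 0; 0, m, 0; 0, 0, 0]) = 0) {i j : Fin 3} (hij : i ≠ j)
    (hxi : χ (xv i) = 1) (hyj : χ (yv j) = 1) {S : BiPoly → Prop} (hS1 : S 1)
    (hχ0 : ∀ s, S s → χ s ≠ 0) {R : Subalgebra ℂ K}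
    (hloc : ∀ z, z ∈ R ↔ ∃ a s, S s ∧ z * χ s = χ a) (h00 : χ (yv 0) * χ (xv 0) ≠ 0)
    {ξ : Fin 3 → K} (hξx : ∀ k, ξ k * χ (xv 0) = χ (xv k)) {g : BiPoly} (hgs : S g) {c : K}
    (hcg : c * χ g = χ (yv 0) * χ (xv 0)) :
    regularTwoForms R =
      Submodule.span R {c • wedge (dlog (ξ 1) - dlog (ξ 0)) (dlog (ξ 2) - dlog (ξ 0))} := by
  have hprod := map_xv_mul_yv hm χ h₁ h₂
  obtain ⟨hy0, hx0⟩ := mul_ne_zero_iff.1 h00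
  have hxy0 : ∀ k, χ (xv k) * χ (yv k) ≠ 0 := by
    intro k
    rw [hprod]
    refine mul_ne_zero ?_ (mul_ne_zero hx0 hy0)
    rw [Ne, FaithfulSMul.algebraMap_eq_zero_iff]
    exact ratios_ne_zero hl hm hlm k
  have hx : ∀ k, χ (xv k) ≠ 0 := fun k => left_ne_zero_of_mul (hxy0 k)
  have hy : ∀ k, χ (yv k) ≠ 0 := fun k => right_ne_zero_of_mul (hxy0 k)
  have hξ0 : ∀ k, ξ k ≠ 0 := by
    intro k h0
    apply hx k
    rw [← hξx, h0, zero_mul]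
  have hω : ∀ a b, dlog (χ (xv a)) - dlog (χ (xv b)) = dlog (ξ a) - dlog (ξ b) := by
    intro a b
    rw [← hξx a, ← hξx b, dlog_mul (hξ0 a) hx0, dlog_mul (hξ0 b) hx0]
    abel
  have hdy : ∀ k, dlog (χ (xv k)) + dlog (χ (yv k)) = dlog (χ (xv 0) * χ (yv 0)) := by
    intro k
    rw [← dlog_mul (hx k) (hy k), hprod, dlog_mul _ (mul_ne_zero hx0 hy0), dlog_algebraMap,
      zero_add]
    rw [Ne, FaithfulSMul.algebraMap_eq_zero_iff]
    exact ratios_ne_zero hl hm hlm k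
  obtain ⟨k, hik, hjk⟩ : ∃ k, i ≠ k ∧ j ≠ k := by
    clear * - hij
    revert i j
    decide
  have hdlog1 : dlog (1 : K) = 0 := by
    rw [← map_one (algebraMap ℂ (K)), dlog_algebraMap]
  have hu : dlog (χ (xv k)) = dlog (ξ k) - dlog (ξ i) := by
    rw [← hω, hxi, hdlog1, sub_zero]
  have hv : dlog (χ (yv k)) = dlog (ξ j) - dlog (ξ k) := by
    have h1 := hdy k
    rw [← hdy j, hyj, hdlog1, add_zero] at h1
    rw [← hω, ← h1]
    abel
  obtain ⟨e, he⟩ := wedge_sub_sub (fun k => dlog (ξ k)) hij hik hjk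
  have hmemR : ∀ a, χ a ∈ R :=
    fun a => (hloc _).2 ⟨a, 1, hS1, by simp⟩
  have hinvR : ∀ s, S s → (χ s)⁻¹ ∈ R :=
    fun s hs => (hloc _).2 ⟨1, s, hs, by rw [inv_mul_cancel₀ (hχ0 s hs), map_one]⟩
  -- The chart is an affine plane with coordinates `xₖ, yₖ`: the remaining coordinates `xⱼ = xⱼ yⱼ`
  -- and `yᵢ = xᵢ yᵢ` are constant multiples of `xₖ yₖ`.
  have hadj : ∀ a, χ a ∈ Algebra.adjoin ℂ {χ (xv k), χ (yv k)} := by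
    have huv : χ (xv k) * χ (yv k) ∈ Algebra.adjoin ℂ {χ (xv k), χ (yv k)} :=
      mul_mem (Algebra.subset_adjoin (by simp)) (Algebra.subset_adjoin (by simp))
    have hab : ∀ a, χ (xv a) * χ (yv a) ∈ Algebra.adjoin ℂ {χ (xv k), χ (yv k)} := by
      intro a
      have h1 : χ (xv a) * χ (yv a) = algebraMap ℂ _ (ratios l m a * (ratios l m k)⁻¹) *
          (χ (xv k) * χ (yv k)) := by
        have h3 := inv_mul_cancel_right₀ (ratios_ne_zero hl hm hlm k) (ratios l m a)
        have h4 := congr(algebraMap ℂ K $h3)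
        rw [map_mul _ _ (ratios l m k)] at h4
        rw [hprod a, hprod k, ← h4, mul_assoc]
      rw [h1]
      exact mul_mem (Subalgebra.algebraMap_mem _ _) huv
    have hX : ∀ a, χ (xv a) ∈ Algebra.adjoin ℂ {χ (xv k), χ (yv k)} := by
      intro a
      by_cases ha : a = k
      · subst ha; exact Algebra.subset_adjoin (by simp)
      · by_cases hai : a = i
        · subst hai; rw [hxi]; exact one_mem _
        · obtain rfl : a = j := by
            clear * - ha hai hij hik hjk
            revert a i j k
            decide
          have := hab a
          rwa [hyj, mul_one] at this
    have hY : ∀ a, χ (yv a) ∈ Algebra.adjoin ℂ {χ (xv k), χ (yv k)} := by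
      intro a
      by_cases ha : a = k
      · subst ha; exact Algebra.subset_adjoin (by simp)
      · by_cases haj : a = j
        · subst haj; rw [hyj]; exact one_mem _
        · obtain rfl : a = i := by
            clear * - ha haj hij hik hjk
            revert a i j k
            decide
          have := hab a
          rwa [hxi, one_mul] at this
    intro a
    induction a using MvPolynomial.induction_on with
    | C r => rw [algHom_C]; exact Subalgebra.algebraMap_mem _ _
    | add f g hf hg => rw [map_add]; exact add_mem hf hg
    | mul_X f s hf =>
      rw [map_mul]
      refine mul_mem hf ?_
      rcases s with s | s
      exacts [hX s, hY s]
  rw [regularTwoForms_eq_span (hmemR (xv k)) (hmemR (yv k)) fun z hz => by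
    obtain ⟨a, s, hs, hz⟩ := (hloc z).1 hz
    exact ⟨χ a, hadj a, χ s, hadj s, hχ0 s hs, hinvR s hs, hz⟩]
  -- Up to sign, `dxₖ ∧ dyₖ` is `xₖ yₖ` times the logarithmic form, and `xₖ yₖ` is a constant times
  -- `x₀ y₀ = c g`. The factor `r` is a unit because `g` does not vanish at the point.
  let r : K := algebraMap ℂ _ (ratios l m k * (e : ℤ)) * χ (g)
  have hr : r ∈ R :=
    mul_mem (Subalgebra.algebraMap_mem _ _) (hmemR _)
  have he2 : ((e : ℤ) : ℂ) ≠ 0 := by exact_mod_cast e.ne_zero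
  have hre : ratios l m k * (e : ℤ) ≠ 0 := mul_ne_zero (ratios_ne_zero hl hm hlm k) he2
  have hunit : IsUnit (⟨r, hr⟩ : R) := by
    refine IsUnit.of_mul_eq_one (b := ⟨algebraMap ℂ _ (ratios l m k * (e : ℤ))⁻¹ *
      (χ (g))⁻¹, mul_mem (Subalgebra.algebraMap_mem _ _) (hinvR _ hgs)⟩) ?_
    ext1
    change r * (algebraMap ℂ _ (ratios l m k * (e : ℤ))⁻¹ * (χ (g))⁻¹) = 1
    rw [mul_mul_mul_comm, ← map_mul, mul_inv_cancel₀ hre, map_one,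
      mul_inv_cancel₀ (hχ0 _ hgs), one_mul]
  have key : wedgeD (χ (xv k)) (χ (yv k)) = (⟨r, hr⟩ : R) •
        c • wedge (dlog (ξ 1) - dlog (ξ 0)) (dlog (ξ 2) - dlog (ξ 0)) := by
    change _ = r • c • wedge (dlog (ξ 1) - dlog (ξ 0)) (dlog (ξ 2) - dlog (ξ 0))
    rw [wedgeD_eq_smul (hx k) (hy k), hu, hv, he, smul_smul, ← Int.cast_smul_eq_zsmul (K),
      smul_smul]
    congr 1
    rw [hprod k, show r * c = algebraMap ℂ _ (ratios l m k * (e : ℤ)) * (c * χ (g)) by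
      simp only [r]; ring, hcg, map_mul, map_intCast]
    ring
  rw [key, Submodule.span_singleton_smul_eq hunit]

/-- The form `η` is the invariant form of the torus on which no coordinate vanishes, and `l₀` is a
lift of `y₀ x₀`, which vanishes exactly on the boundary of this torus. -/
theorem canonicalIsMinusOne_diagonal (hB : SpansModOne B) {l m : ℂ} (hl : l ≠ 0) (hm : m ≠ 0)
    (hlm : l ≠ m) [hJ : (Ideal.span {incidence, bilin !![l, 0, 0; 0, m, 0; 0, 0, 0]}).IsPrime] :
    CanonicalIsMinusOne ((Ideal.span {incidence, bilin !![l, 0, 0; 0, m, 0; 0, 0, 0]}).comap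
      (segre B)) := by
  set P := (Ideal.span {incidence, bilin !![l, 0, 0; 0, m, 0; 0, 0, 0]}).comap (segre B) with hP
  have hF : Ideal.span {incidence} ≤
      Ideal.span {incidence, bilin !![l, 0, 0; 0, m, 0; 0, 0, 0]} := Ideal.span_mono (by simp)
  -- The forms `L k` lift `y₀ xₖ`, so that their ratios `ξ k` are the functions `xₖ / x₀`.
  choose L hL hL' using fun k => exists_linear hB (Matrix.single 0 k 1)
  simp only [bilin_single] at hL'
  have hL0 : L 0 ∉ P := by
    intro h0
    have h1 := add_mem (hF (hL' 0)) h0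
    rw [sub_add_cancel] at h1
    have := (isZeroOf_diagonal hm).eval_eq_zero _ h1
    simp [ratios] at this
  choose ξ hξ using fun k => exists_isFraction P (hL k) (hL 0) hL0
  refine ⟨L 0, hL 0, hL0, wedge (dlog (ξ 1) - dlog (ξ 0)) (dlog (ξ 2) - dlog (ξ 0)), ?_⟩
  intro p hp g hg hgp c hc
  have hgP : g ∉ P := fun h0 => hgp (hp h0)
  obtain ⟨x, y, h, ⟨i, j, hij, hi, hj⟩, rfl⟩ := exists_distinct_indices hB hl hm hlm hp
  obtain ⟨χ, hχ, hχ0, hloc, hfrac⟩ := exists_chartCoordinates hB (bilin_mem _) h hi hj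
  have hχF : ∀ f ∈ Ideal.span {incidence, bilin !![l, 0, 0; 0, m, 0; 0, 0, 0]}, χ f = 0 :=
    fun f hf => hχ f (span_le_chartIdeal _ i j hf)
  have hχL : ∀ k, χ (segre B (L k)) = χ (yv 0) * χ (xv k) := by
    intro k
    have := hχF _ (hF (hL' k))
    rw [map_sub, sub_eq_zero, map_mul] at this
    exact this.symm
  have hxi : χ (xv i) = 1 := by
    have := hχ _ (chartEquations_mem _ i j 2)
    rwa [show chartEquations _ i j 2 = xv i - 1 from rfl, map_sub, map_one, sub_eq_zero] at this
  have hyj : χ (yv j) = 1 := by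
    have := hχ _ (chartEquations_mem _ i j 3)
    rwa [show chartEquations _ i j 3 = yv j - 1 from rfl, map_sub, map_one, sub_eq_zero] at this
  have h00 : χ (yv 0) * χ (xv 0) ≠ 0 := by
    rw [← hχL]
    exact (hfrac 1 (L 0) (L 0) (hL 0) (hL 0) hL0 (ξ 0) (hξ 0)).1
  have hξx : ∀ k, ξ k * χ (xv 0) = χ (xv k) := by
    intro k
    have := (hfrac 1 (L k) (L 0) (hL k) (hL 0) hL0 (ξ k) (hξ k)).2
    rw [hχL, hχL] at this
    apply mul_left_cancel₀ (left_ne_zero_of_mul h00)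
    rw [← this]; ring
  have hgs : eval (pt x y) (segre B g) ≠ 0 := by
    rw [eval_segre]
    rwa [mem_vanishingIdeal_singleton (h.segrePoint_ne_zero hB) hg] at hgp
  have hcg := (hfrac 1 (L 0) g (hL 0) hg hgP c hc).2
  rw [hχL] at hcg
  exact regularTwoForms_eq_span_wedge_dlog hl hm hlm χ (hχF _ (Ideal.subset_span (by simp)))
    (hχF _ (Ideal.subset_span (by simp))) hij hxi hyj (S := fun s => eval (pt x y) s ≠ 0)
    (by simp) hχ0 hloc h00 hξx hgs hcg

end TangentPlane

end

noncomputable section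

namespace TangentPlane

open MvPolynomial

/-! ### Hyperplane sections -/

theorem hyperplaneSection_eq_saturation (b : Module.Basis (Fin 8) ℂ Sections)
    (e : Module.Basis (Fin 3) ℂ V) {h : MvPolynomial (Fin 8) ℂ} {q : BiPoly}
    (hq : q ∈ biPart (1, 1)) {α β : ℂ} (hα : α ≠ 0)
    (hh : segre (sectionMatrix b e) h = C α * q + C β * incidence) :
    hyperplaneSection (Set.range (naturalEmbedding b)) h =
      saturation ((Ideal.span {incidence, q}).comap (segre (sectionMatrix b e))) := by
  rw [hyperplaneSection, vanishingIdeal_range b e,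
    comap_segre_sup (spansModOne_sectionMatrix b e) hq hα hh]

/-- A zero with nonzero vector and covector gives a point of `ℙ⁷`, so the prime omits some
coordinate and is already saturated. -/
theorem saturation_comap_of_isPrime {B : Fin 8 → Matrix (Fin 3) (Fin 3) ℂ} (hB : SpansModOne B)
    {q : BiPoly} [(Ideal.span {incidence, q}).IsPrime] {x y : Fin 3 → ℂ}
    (h : IsZeroOf (Ideal.span {incidence, q}) x y) :
    saturation ((Ideal.span {incidence, q}).comap (segre B)) =
      (Ideal.span {incidence, q}).comap (segre B) := by
  obtain ⟨i, hi⟩ := exists_X_notMem hB (Ideal.subset_span (Set.mem_insert _ _)) h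
  exact le_antisymm (saturation_le (Ideal.comap_isPrime _ _) le_rfl hi) (le_saturation _)

theorem not_incidence_dvd {q : BiPoly} (h : eval (pt ![1, 1, 0] ![1, -1, 0]) q ≠ 0) :
    ¬ incidence ∣ q := by
  rintro ⟨a, rfl⟩
  simp [incidence_eq] at h

/-- An intersection of two incomparable primes is radical and not prime. -/
theorem reducible_conclusion {B : Fin 8 → Matrix (Fin 3) (Fin 3) ℂ} (hB : SpansModOne B)
    {j k : Fin 3} (hk2 : k ≠ 2) (hkj : k ≠ j) {I : Ideal (MvPolynomial (Fin 8) ℂ)}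
    (hI : I = saturation
      ((Ideal.span {incidence, (X (.inr j) * X (.inl 2) : BiPoly)}).comap (segre B))) :
    (∃ P₁ P₂ : Ideal (MvPolynomial (Fin 8) ℂ), P₁ ≠ P₂ ∧
      IsIrreducibleSurface P₁ 3 ∧ IsIrreducibleSurface P₂ 3 ∧ I = P₁ ⊓ P₂) ∧
    ¬ I.radical.IsPrime := by
  obtain ⟨h1, h2, h3⟩ := saturation_reducible hB hk2 hkj hk2 hkj
  have i1 := isIrreducibleSurface_three hB (.inl 2)
  have i2 := isIrreducibleSurface_three hB (.inr j)
  rw [hI, h1]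
  refine ⟨⟨_, _, fun h => h2 h.le, i1, i2, rfl⟩, fun hp => ?_⟩
  rw [Ideal.radical_inf, i1.isPrime.radical, i2.isPrime.radical] at hp
  rcases hp.inf_le.1 le_rfl with h | h
  · exact h2 (h.trans inf_le_right)
  · exact h3 (h.trans inf_le_left)

end TangentPlane

end

/-! ### The classification by the five normal forms -/

open TangentPlane in
theorem theorem1 (b : Module.Basis (Fin 8) ℂ Sections)
    (h : MvPolynomial (Fin 8) ℂ) (h_linear : h.IsHomogeneous 1) (h_ne : h ≠ 0) :
    ((IsIrreducibleSurface (hyperplaneSection (Set.range (naturalEmbedding b)) h) 6 ∧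
        SpansDim (hyperplaneSection (Set.range (naturalEmbedding b)) h) 6) ∨
      ∃ P₁ P₂ : Ideal (MvPolynomial (Fin 8) ℂ), P₁ ≠ P₂ ∧
        IsIrreducibleSurface P₁ 3 ∧ IsIrreducibleSurface P₂ 3 ∧
        hyperplaneSection (Set.range (naturalEmbedding b)) h = P₁ ⊓ P₂) ∧
    ((hyperplaneSection (Set.range (naturalEmbedding b)) h).radical.IsPrime →
      ∃ _ : (hyperplaneSection (Set.range (naturalEmbedding b)) h).IsPrime,
        IsNonsingularDelPezzo (hyperplaneSection (Set.range (naturalEmbedding b)) h) 6 ∨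
        ∃ p, singularLocus (hyperplaneSection (Set.range (naturalEmbedding b)) h) = {p} ∧
          (HasMultiplicityAt (hyperplaneSection (Set.range (naturalEmbedding b)) h) p 2 ∨
            HasMultiplicityAt (hyperplaneSection (Set.range (naturalEmbedding b)) h) p 3)) := by
  obtain ⟨A, hA, hseg⟩ := exists_endomorphism b h_linear h_ne
  obtain ⟨e, N, r, hN, hform⟩ := exists_normalForm hA
  have hB := spansModOne_sectionMatrix b e
  -- The scalar part of `A` only contributes a multiple of the incidence form, which vanishes on the
  -- flag variety.
  have hh : segre (sectionMatrix b e) h =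
      MvPolynomial.C 1 * bilin N + MvPolynomial.C r * incidence := by
    rw [hseg e, hN, map_add, map_smul, MvPolynomial.smul_eq_C_mul, MvPolynomial.C_1, one_mul]
    rfl
  have hsat := hyperplaneSection_eq_saturation b e (bilin_mem N) one_ne_zero hh
  rcases hform with ⟨l, m, hl, hm, hlm, rfl⟩ | ⟨l, hl, rfl⟩ | rfl | ⟨l, hl, rfl⟩ | rfl
  · have hne : MvPolynomial.eval (pt ![1, 1, 0] ![1, -1, 0]) (MvPolynomial.C l * (xv 0 * yv 0) +
        MvPolynomial.C m * (xv 1 * yv 1)) ≠ 0 := by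
      simpa [← sub_eq_add_neg, sub_eq_zero] using hlm
    have hJ := isPrime_span_incidence_two_terms (by decide) hl hm hne
    rw [← bilin_diagonal] at hne hJ
    rw [hsat, saturation_comap_of_isPrime hB (isZeroOf_diagonal hm)]
    have h1 := isIrreducibleSurface_six hB (bilin_mem _) (not_incidence_dvd hne) hJ
    have h2 := spansDim_six hB (bilin_mem _) (not_incidence_dvd hne)
    exact ⟨Or.inl ⟨h1, h2⟩, fun _ => ⟨Ideal.comap_isPrime _ _, Or.inl
      ⟨h1, h2, singularLocus_diagonal hB hl hm hlm, canonicalIsMinusOne_diagonal hB hl hm hlm⟩⟩⟩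
  · have hne : MvPolynomial.eval (pt ![1, 1, 0] ![1, -1, 0]) (MvPolynomial.C l * (xv 0 * yv 0) +
        MvPolynomial.C 1 * (xv 2 * yv 1)) ≠ 0 := by
      simpa using hl
    have hJ := isPrime_span_incidence_two_terms (by decide) hl one_ne_zero hne
    rw [MvPolynomial.C_1, one_mul, ← bilin_two_blocks] at hne hJ
    rw [hsat, saturation_comap_of_isPrime hB (isZeroOf_two_blocks l)]
    have h1 := isIrreducibleSurface_six hB (bilin_mem _) (not_incidence_dvd hne) hJ
    have h2 := spansDim_six hB (bilin_mem _) (not_incidence_dvd hne)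
    exact ⟨Or.inl ⟨h1, h2⟩, fun _ => ⟨Ideal.comap_isPrime _ _, Or.inr
      ⟨_, singularLocus_two_blocks hB hl, Or.inl (singular_two_blocks hB hl).2⟩⟩⟩
  · have hne : MvPolynomial.eval (pt ![1, 1, 0] ![1, -1, 0]) (MvPolynomial.C 1 * (xv 1 * yv 0) +
        MvPolynomial.C 1 * (xv 2 * yv 1)) ≠ 0 := by
      simp
    have hJ := isPrime_span_incidence_two_terms (by decide) one_ne_zero one_ne_zero hne
    rw [MvPolynomial.C_1, one_mul, one_mul, ← bilin_one_block] at hne hJ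
    rw [hsat, saturation_comap_of_isPrime hB isZeroOf_one_block]
    have h1 := isIrreducibleSurface_six hB (bilin_mem _) (not_incidence_dvd hne) hJ
    have h2 := spansDim_six hB (bilin_mem _) (not_incidence_dvd hne)
    exact ⟨Or.inl ⟨h1, h2⟩, fun _ => ⟨Ideal.comap_isPrime _ _, Or.inr
      ⟨_, singularLocus_one_block hB, Or.inl (singular_one_block hB).2⟩⟩⟩
  -- In rank one the bilinear form splits into linear factors; the section is reducible, and the
  -- second assertion holds vacuously.
  · have hbil : bilin !![0, 0, 0; 0, 0, 0; 0, 0, l] =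
        MvPolynomial.C l * (MvPolynomial.X (.inr 2) * MvPolynomial.X (.inl 2)) := by
      simp [bilin, Fin.sum_univ_three, xv, yv]
    rw [hbil, map_one, one_mul] at hh
    have h1 := reducible_conclusion hB (j := 2) (k := 0) (by decide) (by decide)
      (hyperplaneSection_eq_saturation b e
        ((yv_mem 2).mul (xv_mem 2)) hl hh)
    exact ⟨Or.inr h1.1, fun hp => absurd hp h1.2⟩
  · have hbil : bilin !![0, 0, 1; 0, 0, 0; 0, 0, 0] =
        MvPolynomial.X (.inr 0) * MvPolynomial.X (.inl 2) := by
      simp [bilin, Fin.sum_univ_three, xv, yv]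
    rw [hbil] at hh
    have h1 := reducible_conclusion hB (j := 0) (k := 1) (by decide) (by decide)
      (hyperplaneSection_eq_saturation b e
        ((yv_mem 0).mul (xv_mem 2)) one_ne_zero hh)
    exact ⟨Or.inr h1.1, fun hp => absurd hp h1.2⟩
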